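/- **Setting.** Let $d\ge 1$ and let $p:\mathbb Z^d\times\mathbb Z^d\to[0,\infty)$ be a symmetric, translation invariant, finite range, irreducible Markov transition function: $p(i,j)=p(j,i)=p(0,j-i)$, $\sum_j p(i,j)=1$, $p(i,j)=0$ for $|i-j|>R$ for some $R>0$, and any two sites are joined by a path of jumps of positive probability. Let $\{\eta(t):t\ge 0\}$ be the system of independent random walkers on $\mathbb Z^d$, in which each particle performs, independently of all others, a continuous-time random walk that jumps from $i$ to $j$ at rate $p(i,j)$, and $\eta_x(t)\in\mathbb N$ is the number of particles at $x$ at time $t$. For $\rho>0$ let $\nu_\rho$ be the product measure on $\mathbb N^{\mathbb Z^d}$ with Poisson($\rho$) marginals, and let $\mathbb E_{\nu_\rho}$ be the expectation for the process started from $\eta(0)\sim\nu_\rho$. For a configuration $\xi\in\mathbb N^{\mathbb Z^d}$ with finitely many particles put $\|\xi\|=\sum_x\xi_x$ and $$D(\xi,\eta)=\prod_{x}\ \sum_{j=0}^{\xi_x}\binom{\xi_x}{j}(-\rho)^{-j}\frac{\eta_x!}{(\eta_x-j)!},\qquad a(\xi)=\int D(\xi,\eta)^2\,d\nu_\rho(\eta)$$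 (terms with $j>\eta_x$ are $0$). Let $\mathcal H_n$ be the closed linear span in $L^2(\nu_\rho)$ of the $D(\xi,\cdot)$ with $\|\xi\|\le n$. For $f\in L^2(\nu_\rho)$ let $f_n$ be its orthogonal projection on $\mathcal H_n$, and let $C_\xi=a(\xi)^{-1}\int f\,D(\xi,\cdot)\,d\nu_\rho$ be its coefficients in the orthogonal expansion $f=\sum_\xi C_\xi D(\xi,\cdot)$. **Theorem.** Let $f\in L^2(\nu_\rho)$ satisfy $$\sum_{\xi,\xi':\ \|\xi\|=\|\xi'\|}|C_\xi C_{\xi'}|\,a(\xi')<\infty,$$ let $k\ge 1$ be an integer and let $\phi\in\mathcal S(\mathbb R^d)$ be a Schwartz function. For $N\ge 1$ consider the field $$\mathsf X_N(f-f_{k-1},\eta;\phi)=\sum_{x\in\mathbb Z^d}\phi\left(\tfrac xN\right)\bigl(f(\tau_x\eta)-f_{k-1}(\tau_x\eta)\bigr),\qquad (\tau_x\eta)_y=\eta_{x+y}.$$ For every $N\ge1$ and $t\ge0$ the series defining $\mathsf X_N(f-f_{k-1},\eta(N^2t);\phi)$ converges absolutely almost surely, to a square integrable random variable, and for every $T>0$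 the function $(t,s)\mapsto\mathbb E_{\nu_\rho}\left[\mathsf X_N(f-f_{k-1},\eta(N^2t);\phi)\,\mathsf X_N(f-f_{k-1},\eta(N^2s);\phi)\right]$ is integrable on $[0,T]^2$. Moreover, for every $T>0$ there is a constant $C(T)$, which may depend on $d,p,\rho,f,k,\phi$ but not on $N$, such that for all sufficiently large integers $N$ $$\frac1{N^d}\int_0^T\int_0^T\mathbb E_{\nu_\rho}\left[\mathsf X_N(f-f_{k-1},\eta(N^2t);\phi)\,\mathsf X_N(f-f_{k-1},\eta(N^2s);\phi)\right]ds\,dt\ \le\ C(T)\,N^{-\frac{2(k-1)d}{2+(k-1)d}}.$$ -/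

import Mathlib

open MeasureTheory ProbabilityTheory Filter
open scoped NNReal ENNReal SchwartzMap

noncomputable section

namespace IRW

/-- The lattice `ℤ^d`. -/
abbrev Site (d : ℕ) : Type := Fin d → ℤ

/-- Particle configurations: `η x` is the number of particles at `x`. -/
abbrev Config (d : ℕ) : Type := Site d → ℕ

/-- Configurations with finitely many particles; the number of particles of `ξ` is `ξ.degree`. -/
abbrev FinConfig (d : ℕ) : Type := Site d →₀ ℕ

variable {d : ℕ}

/-- Translation invariant, symmetric, finite range, irreducible Markov transition functions
on `ℤ^d`. -/
structure IsJumpKernel (p : Site d → Site d → ℝ) : Prop where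
  nonneg : ∀ i j, 0 ≤ p i j
  symm : ∀ i j, p i j = p j i
  translation : ∀ i j, p i j = p 0 (j - i)
  hasSum_one : ∀ i, HasSum (fun j => p i j) 1
  finite_range : ∃ R : ℝ, 0 < R ∧ ∀ i j, R < ‖i - j‖ → p i j = 0
  irreducible : ∀ x y, Relation.ReflTransGen (fun i j => 0 < p i j) x y

/-- The `n`-step transition probabilities of the discrete-time chain with transition function
`p`. -/
def stepProb (p : Site d → Site d → ℝ) : ℕ → Site d → Site d → ℝ
  | 0, x, y => if x = y then 1 else 0
  | n + 1, x, y => ∑' z, stepProb p n x z * p z y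

/-- The transition probabilities at time `t` of the continuous-time random walk which jumps from
`i` to `j` at rate `p i j`. -/
def walkProb (p : Site d → Site d → ℝ) (t : ℝ) (x y : Site d) : ℝ :=
  ∑' n : ℕ, Real.exp (-t) * t ^ n / (n.factorial : ℝ) * stepProb p n x y

/-- `S` is a continuous-time random walk on `ℤ^d` started at the origin which jumps from
`i` to `j` at rate `p i j`. -/
structure IsWalk {Ω : Type*} [MeasurableSpace Ω] (P : Measure Ω) (p : Site d → Site d → ℝ)
    (S : ℝ≥0 → Ω → Site d) : Prop where
  measurable : ∀ t, Measurable (S t)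
  start : ∀ᵐ ω ∂P, S 0 ω = 0
  indep_increments : HasIndepIncrements S P
  increment_law : ∀ s t : ℝ≥0, s ≤ t → ∀ z : Site d,
    P.real {ω | S t ω - S s ω = z} = walkProb p ((t : ℝ) - (s : ℝ)) 0 z
  right_continuous : ∀ᵐ ω ∂P, ∀ t, ContinuousWithinAt (fun s => S s ω) (Set.Ici t) t

/-- The product measure on configurations whose marginals are Poisson with mean `ρ`. -/
def nu (d : ℕ) (ρ : ℝ≥0) : Measure (Config d) :=
  Measure.infinitePi (fun _ : Site d => poissonMeasure ρ)

/-- A realization of a system of independent random walkers started from `nu d ρ`.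
`η₀` is the initial configuration; the particles which start at `y` carry the labels `(y, i)` with
`i < η₀ y`, and `S (y, i)` is the displacement of the particle `(y, i)` from its starting point.
The displacements are independent of each other and of the initial configuration. -/
structure IsSystem {Ω : Type*} [MeasurableSpace Ω] (P : Measure Ω) (p : Site d → Site d → ℝ)
    (ρ : ℝ≥0) (η₀ : Ω → Config d) (S : Site d × ℕ → ℝ≥0 → Ω → Site d) : Prop where
  measurable_init : Measurable η₀
  law_init : P.map η₀ = nu d ρ
  walk : ∀ a, IsWalk P p (S a)
  indep_walks : iIndepFun (fun (a : Site d × ℕ) (ω : Ω) (t : ℝ≥0) => S a t ω) P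
  indep_init : IndepFun η₀ (fun (ω : Ω) (a : Site d × ℕ) (t : ℝ≥0) => S a t ω) P

/-- The configuration at time `t`: the number of particles at `x` is the number of labels
`a = (y, i)` of existing particles whose position `y + S a t` is `x`. (For each `t` this is almost
surely finite for all `x`.) -/
def config {Ω : Type*} (η₀ : Ω → Config d) (S : Site d × ℕ → ℝ≥0 → Ω → Site d)
    (t : ℝ≥0) (ω : Ω) : Config d :=
  fun x => Set.ncard {a : Site d × ℕ | a.2 < η₀ ω a.1 ∧ a.1 + S a t ω = x}

/-- The spatial shift, `(τ_x η)_y = η_{y + x}`. -/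
def shift (x : Site d) (η : Config d) : Config d := fun y => η (y + x)

/-- The single-site duality polynomials (Charlier polynomials)
`d(k, n) = ₂F₀(-k, -n; -; -1/ρ) = ∑_{j ≤ k} (k choose j) (-1/ρ)^j n! / (n - j)!`. -/
def charlier (ρ : ℝ≥0) (k n : ℕ) : ℝ :=
  ∑ j ∈ Finset.range (k + 1),
    (k.choose j : ℝ) * (-(1 / (ρ : ℝ))) ^ j * (n.descFactorial j : ℝ)

/-- The orthogonal duality polynomials `D(ξ, η) = ∏_x d(ξ_x, η_x)`. -/
def dual (ρ : ℝ≥0) (ξ : FinConfig d) (η : Config d) : ℝ :=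
  ξ.prod (fun x m => charlier ρ m (η x))

/-- The squared norm `a(ξ)` of `D(ξ, ·)` in `L²(ν_ρ)`. -/
def normSq (ρ : ℝ≥0) (ξ : FinConfig d) : ℝ :=
  ∫ η, dual ρ ξ η ^ 2 ∂(nu d ρ)

/-- The coefficient `⟨f, D(ξ, ·)⟩ / a(ξ)` of `D(ξ, ·)` in the orthogonal expansion of `f`. -/
def coeff (ρ : ℝ≥0) (f : Config d → ℝ) (ξ : FinConfig d) : ℝ :=
  (∫ η, f η * dual ρ ξ η ∂(nu d ρ)) / normSq ρ ξ

/-- The summability condition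
`∑_{ξ, ξ' : ‖ξ‖ = ‖ξ'‖} |C_ξ C_ξ'| a(ξ') < ∞` on the coefficients of `f`. -/
def CoeffSummable (ρ : ℝ≥0) (f : Config d → ℝ) : Prop :=
  Summable (fun q : {q : FinConfig d × FinConfig d // q.1.degree = q.2.degree} =>
    |coeff ρ f q.1.1 * coeff ρ f q.1.2| * normSq ρ q.1.2)

/-- The closed subspace `H_n` of `L²(ν_ρ)` generated by the polynomials `D(ξ, ·)` with
`‖ξ‖ ≤ n`. -/
def polySpace (d : ℕ) (ρ : ℝ≥0) (n : ℕ) : Submodule ℝ (Lp ℝ 2 (nu d ρ)) :=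
  (Submodule.span ℝ {g : Lp ℝ 2 (nu d ρ) |
    ∃ ξ : FinConfig d, ξ.degree ≤ n ∧ g =ᵐ[nu d ρ] dual ρ ξ}).topologicalClosure

instance (d : ℕ) (ρ : ℝ≥0) (n : ℕ) : CompleteSpace (polySpace d ρ n) :=
  Submodule.topologicalClosure.completeSpace _

/-- (A representative of) the orthogonal projection `f_n` of `f ∈ L²(ν_ρ)` on `H_n`. -/
def proj (ρ : ℝ≥0) (n : ℕ) (f : Config d → ℝ) (hf : MemLp f 2 (nu d ρ)) : Config d → ℝ :=
  ((polySpace d ρ n).starProjection (hf.toLp f) : Lp ℝ 2 (nu d ρ))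

/-- The rescaled lattice point `x / N` in `ℝ^d`. -/
def scaled (N : ℕ) (x : Site d) : EuclideanSpace ℝ (Fin d) :=
  WithLp.toLp 2 (fun i => (x i : ℝ) / (N : ℝ))

/-- The summands `φ(x/N) g(τ_x η)` of the fluctuation field. -/
def fieldTerm (N : ℕ) (φ : 𝓢(EuclideanSpace ℝ (Fin d), ℝ)) (g : Config d → ℝ) (η : Config d)
    (x : Site d) : ℝ :=
  φ (scaled N x) * g (shift x η)

/-- The fluctuation field `X_N(g, η; φ) = ∑_x φ(x/N) g(τ_x η)` (for `g` with mean zero and with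
normalization constant `1`). -/
def field (N : ℕ) (φ : 𝓢(EuclideanSpace ℝ (Fin d), ℝ)) (g : Config d → ℝ) (η : Config d) : ℝ :=
  ∑' x : Site d, fieldTerm N φ g η x

/-- The field of `f - f_{k-1}` at microscopic time `N² t`, for `t ≥ 0`. -/
def projField {Ω : Type*} (η₀ : Ω → Config d) (S : Site d × ℕ → ℝ≥0 → Ω → Site d)
    (ρ : ℝ≥0) (k : ℕ) (f : Config d → ℝ) (hf : MemLp f 2 (nu d ρ))
    (φ : 𝓢(EuclideanSpace ℝ (Fin d), ℝ)) (N : ℕ) (t : ℝ) (ω : Ω) : ℝ :=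
  field N φ (fun η => f η - proj ρ (k - 1) f hf η) (config η₀ S (((N : ℝ) ^ 2 * t).toNNReal) ω)

end IRW

end

open IRW

noncomputable section

namespace IRW

/-! ### Power series determined by their values on the unit cube; the Charlier generating function.
-/

section

/-! Expand f - f_{k-1} in the orthogonal basis of duality polynomials: only configurations with at
least k particles survive (`hasSum_tailLp`). What remains is to compute the correlations of D(ξ,
η(s)) and D(ξ', η(t)), to sum them over positions, and to integrate over time.

Correlations. The Charlier polynomials satisfy Σ_k (ρu)^k/k! d(k,n) = e^{ρu}(1-u)^n
(`hasSum_charlier`). For a Poisson system of independent walks, E ∏ (1-u_x)^{η_x(s)}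
(1-v_x)^{η_x(t)} equals exp(ρ(-Σu - Σv + Σ u_x v_z q(z-x))) with q the transition probability over
time t-s (`IsSystem.integral_prod_config`). The factors e^{ρu}, e^{ρv} cancel the linear terms, so
the correlations have generating function exp(ρ Σ u_x v_z q(z-x)). Comparing coefficients
(`integral_dual_mul_dual_of_pgf`) yields a sum over matchings of the particles of ξ with those of
ξ', weighted by products of q; it vanishes unless the particle numbers agree. Taking q = δ_0 gives
orthogonality and the value of a(ξ).

Summation over translates (`tsum_translates_le`). Let Q bound q and let n ≥ k be the particle
number. Bound the transition probabilities of k-1 particles by Q. The other n-k+1 ≥ 1 particles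
contribute total weight at most 1, and their final positions leave at most k choices for the
translation of ξ'. Hence the correlations summed over all translates of ξ' are at most a(ξ') k!
Q^{k-1}. The constant does not depend on n, so the summability assumption on the coefficients
controls all degrees at once. Summing |φ(x/N)| over x costs N^d, and the other test function is
bounded by its supremum (`exists_enorm_fieldCorrelation_le`).

Time scale. Fourier analysis gives Q ≤ C r^{-d/2} at r = N²|t-s|
(`IsJumpKernel.exists_walkProb_le`). With m = (k-1)d, use the trivial bound Q ≤ 1 for |t-s| < δ and
decay for |t-s| ≥ δ. The two contributions balance when δ = (N²δ)^{-m/2}, that is δ = N^{-2m/(2+m)},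
which is the claimed rate. -/

theorem eq_zero_of_tsum_pow_eq_zero {c : ℕ → ℝ} (hc : Summable c)
    (h : ∀ u : ℝ, 0 ≤ u → u ≤ 1 → ∑' n, c n * u ^ n = 0) (n : ℕ) : c n = 0 := by
  have hn : Summable fun n => |c n| := hc.abs
  induction n using Nat.strong_induction_on with
  | _ n ih =>
    set M : ℝ := ∑' m, |c (m + (n + 1))| with hM
    have hs : ∀ u : ℝ, 0 ≤ u → u ≤ 1 → Summable fun m => c m * u ^ m := fun u h0 h1 => by
      refine Summable.of_norm_bounded hn fun m => ?_
      rw [Real.norm_eq_abs, abs_mul, abs_of_nonneg (pow_nonneg h0 m)]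
      exact mul_le_of_le_one_right (abs_nonneg _) (pow_le_one₀ h0 h1)
    -- The lower coefficients vanish by induction, so c_n u^n cancels a tail of size at most u^{n+1}
    -- M. Dividing by u^n and letting u tend to 0 kills c_n.
    have key : ∀ u : ℝ, 0 < u → u ≤ 1 → |c n| ≤ u * M := by
      intro u h0 h1
      have e1 := (hs u h0.le h1).sum_add_tsum_nat_add (n + 1)
      rw [h u h0.le h1, Finset.sum_range_succ, Finset.sum_eq_zero, zero_add] at e1
      · have e2 : |∑' m, c (m + (n + 1)) * u ^ (m + (n + 1))| ≤ u ^ (n + 1) * M := by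
          rw [hM, ← tsum_mul_left, ← Real.norm_eq_abs]
          refine tsum_of_norm_bounded
            (((summable_nat_add_iff (n + 1)).2 hn).mul_left _).hasSum fun m => ?_
          rw [Real.norm_eq_abs, abs_mul, abs_of_nonneg (pow_nonneg h0.le _), mul_comm]
          exact mul_le_mul_of_nonneg_right (pow_le_pow_of_le_one h0.le h1 (by lia)) (abs_nonneg _)
        have e3 : |c n| * u ^ n ≤ u ^ n * (u * M) := by
          calc |c n| * u ^ n = |c n * u ^ n| := by
                rw [abs_mul, abs_of_nonneg (pow_nonneg h0.le _)]
            _ = |∑' m, c (m + (n + 1)) * u ^ (m + (n + 1))| := by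
                rw [eq_neg_of_add_eq_zero_left e1, abs_neg]
            _ ≤ u ^ (n + 1) * M := e2
            _ = _ := by ring
        rw [mul_comm] at e3
        exact le_of_mul_le_mul_left e3 (pow_pos h0 n)
      · intro m hm
        rw [ih m (Finset.mem_range.1 hm), zero_mul]
    have hM0 : 0 ≤ M := tsum_nonneg fun _ => abs_nonneg _
    by_contra hne
    have hpos : 0 < |c n| := abs_pos.2 hne
    -- This u makes u M at most |c_n|/2; the extra 1 keeps the denominator positive when M = 0.
    have := key (min 1 (|c n| / (2 * (M + 1)))) (by positivity) (min_le_left _ _)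
    have h2 : min 1 (|c n| / (2 * (M + 1))) * M ≤ |c n| / (2 * (M + 1)) * M :=
      mul_le_mul_of_nonneg_right (min_le_right _ _) hM0
    have h3 : |c n| / (2 * (M + 1)) * M ≤ |c n| / 2 := by
      rw [div_mul_eq_mul_div, div_le_div_iff₀ (by positivity) (by norm_num)]
      nlinarith
    linarith

/-- Induction on the number of variables: group by the exponent of one variable, apply the
one-variable result to it, then the induction hypothesis to each coefficient. Only values on [0,1]
are used, because the probabilistic identities are available only there. -/
theorem eq_zero_of_tsum_prod_pow_eq_zero {σ : Type*} [Fintype σ] {c : (σ → ℕ) → ℝ}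
    (hc : Summable c)
    (h : ∀ u : σ → ℝ, (∀ a, 0 ≤ u a) → (∀ a, u a ≤ 1) → ∑' m, c m * ∏ a, u a ^ m a = 0)
    (m : σ → ℕ) : c m = 0 := by
  suffices H : ∀ c : (σ → ℕ) → ℝ, Summable c →
      (∀ u : σ → ℝ, (∀ a, 0 ≤ u a) → (∀ a, u a ≤ 1) → ∑' m, c m * ∏ a, u a ^ m a = 0) →
      ∀ m : σ → ℕ, c m = 0 from H c hc h m
  clear! c
  refine Fintype.induction_empty_option (P := fun σ _ => ∀ c : (σ → ℕ) → ℝ, Summable c →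
    (∀ u : σ → ℝ, (∀ a, 0 ≤ u a) → (∀ a, u a ≤ 1) → ∑' m, c m * ∏ a, u a ^ m a = 0) →
    ∀ m : σ → ℕ, c m = 0) ?_ ?_ ?_ σ
  · intro α β _ e ih c hc h m
    let _ := Fintype.ofEquiv β e.symm
    let E : (α → ℕ) ≃ (β → ℕ) := e.arrowCongr (Equiv.refl ℕ)
    have := ih (c ∘ E) (E.summable_iff.2 hc) (fun u h0 h1 => ?_) (E.symm m)
    · simpa using this
    · rw [← h (u ∘ e.symm) (fun a => h0 _) (fun a => h1 _), ← E.tsum_eq]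
      refine tsum_congr fun m => ?_
      congr 1
      refine Fintype.prod_equiv e _ _ fun a => ?_
      simp [E]
  · intro c hc h m
    have := h 0 (by simp) (by simp)
    have e : ∀ m' : PEmpty → ℕ, m' = m := fun m' => Subsingleton.elim _ _
    rw [tsum_eq_single m (fun m' hm' => absurd (e m') hm')] at this
    simpa using this
  · intro α _ ih c hc h m
    let E : (Option α → ℕ) ≃ ℕ × (α → ℕ) := Equiv.piOptionEquivProd
    let d : ℕ × (α → ℕ) → ℝ := c ∘ E.symm
    have hd : Summable d := E.symm.summable_iff.2 hc
    have hds : ∀ k, Summable fun m' => d (k, m') := fun k => hd.prod_factor k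
    suffices ∀ k m', d (k, m') = 0 by
      have := this (E m).1 (E m).2
      simpa [d] using this
    intro k
    refine ih _ (hds k) fun u h0 h1 => ?_
    have hp0 : ∀ m' : α → ℕ, 0 ≤ ∏ a, u a ^ m' a :=
      fun m' => Finset.prod_nonneg fun a _ => pow_nonneg (h0 a) _
    have hp1 : ∀ m' : α → ℕ, ∏ a, u a ^ m' a ≤ 1 :=
      fun m' => Finset.prod_le_one (fun a _ => pow_nonneg (h0 a) _)
        fun a _ => pow_le_one₀ (h0 a) (h1 a)
    have hdu : Summable fun q : ℕ × (α → ℕ) => d q * ∏ a, u a ^ q.2 a := by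
      refine Summable.of_norm_bounded hd.abs fun q => ?_
      rw [Real.norm_eq_abs, abs_mul, abs_of_nonneg (hp0 q.2)]
      exact mul_le_of_le_one_right (abs_nonneg _) (hp1 _)
    refine eq_zero_of_tsum_pow_eq_zero (c := fun k => ∑' m', d (k, m') * ∏ a, u a ^ m' a)
      hdu.prod (fun t t0 t1 => ?_) k
    have := h (fun o => o.elim t u) (by rintro (_ | a) <;> simp [t0, h0])
      (by rintro (_ | a) <;> simp [t1, h1])
    rw [← E.symm.tsum_eq] at this
    have e : ∀ q : ℕ × (α → ℕ), c (E.symm q) * ∏ a : Option α, (a.elim t u) ^ (E.symm q a)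
        = d q * (∏ a, u a ^ q.2 a) * t ^ q.1 := by
      intro q
      rw [Fintype.prod_option]
      simp [E, d, Equiv.piOptionEquivProd]
      ring
    simp_rw [e] at this
    have hsum : Summable fun q : ℕ × (α → ℕ) => d q * (∏ a, u a ^ q.2 a) * t ^ q.1 := by
      refine Summable.of_norm_bounded hdu.abs fun q => ?_
      rw [Real.norm_eq_abs, abs_mul, abs_of_nonneg (pow_nonneg t0 _)]
      exact mul_le_of_le_one_right (abs_nonneg _) (pow_le_one₀ t0 t1)
    rw [hsum.tsum_prod] at this
    simpa [tsum_mul_right] using this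

theorem eq_zero_of_tsum_prod_pow_mul_eq_zero {σ τ : Type*} [Fintype σ] [Fintype τ]
    {c : (σ → ℕ) × (τ → ℕ) → ℝ} (hc : Summable c)
    (h : ∀ (u : σ → ℝ) (v : τ → ℝ), (∀ a, 0 ≤ u a) → (∀ a, u a ≤ 1) → (∀ a, 0 ≤ v a) →
      (∀ a, v a ≤ 1) → ∑' m : (σ → ℕ) × (τ → ℕ),
        c m * ((∏ a, u a ^ m.1 a) * ∏ b, v b ^ m.2 b) = 0)
    (m : (σ → ℕ) × (τ → ℕ)) : c m = 0 := by
  let E : (σ ⊕ τ → ℕ) ≃ (σ → ℕ) × (τ → ℕ) := Equiv.sumArrowEquivProdArrow σ τ ℕ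
  have := eq_zero_of_tsum_prod_pow_eq_zero (c := c ∘ E) (E.summable_iff.2 hc)
    (fun u h0 h1 => ?_) (E.symm m)
  · simpa using this
  · rw [← h (fun a => u (.inl a)) (fun b => u (.inr b)) (fun a => h0 _) (fun a => h1 _)
      (fun a => h0 _) (fun a => h1 _), ← E.tsum_eq]
    refine tsum_congr fun m => ?_
    rw [Fintype.prod_sum_type]
    rfl

theorem hasSum_fin_prod (n : ℕ) (f : Fin n → ℕ → ℝ) (s : Fin n → ℝ)
    (hs : ∀ a, HasSum (f a) (s a)) :
    HasSum (fun m : Fin n → ℕ => ∏ a, f a (m a)) (∏ a, s a) := by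
  induction n with
  | zero =>
    simp only [Finset.univ_eq_empty, Finset.prod_empty]
    exact hasSum_unique _
  | succ n ih =>
    have h1 := ih (fun a => f a.succ) (fun a => s a.succ) fun a => hs _
    have h2 := hs 0
    have h3 : Summable fun q : ℕ × (Fin n → ℕ) => f 0 q.1 * ∏ a, f (Fin.succ a) (q.2 a) :=
      summable_mul_of_summable_norm (f := f 0)
        (g := fun m : Fin n → ℕ => ∏ a, f (Fin.succ a) (m a)) h2.summable.norm h1.summable.norm
    rw [Fin.prod_univ_succ, ← (Fin.consEquiv (fun _ : Fin (n + 1) => ℕ)).hasSum_iff]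
    have e : (fun m : Fin (n + 1) → ℕ => ∏ a, f a (m a)) ∘ (Fin.consEquiv (fun _ => ℕ)) =
        fun q : ℕ × (Fin n → ℕ) => f 0 q.1 * ∏ a, f (Fin.succ a) (q.2 a) := by
      funext q
      simp [Fin.prod_univ_succ, Fin.consEquiv]
    rw [e]
    exact HasSum.mul (f := f 0) (g := fun m : Fin n → ℕ => ∏ a, f (Fin.succ a) (m a)) h2 h1 h3

theorem hasSum_fintype_prod {σ : Type*} [Fintype σ] {f : σ → ℕ → ℝ} {s : σ → ℝ}
    (hs : ∀ a, HasSum (f a) (s a)) :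
    HasSum (fun m : σ → ℕ => ∏ a, f a (m a)) (∏ a, s a) := by
  have e := (Fintype.equivFin σ).symm
  have h := hasSum_fin_prod _ (fun a => f (e a)) (fun a => s (e a)) fun a => hs _
  rw [← (e.arrowCongr (Equiv.refl ℕ)).hasSum_iff, ← e.prod_comp]
  have e1 : (fun m : σ → ℕ => ∏ a, f a (m a)) ∘ (e.arrowCongr (Equiv.refl ℕ)) =
      fun m => ∏ a, f (e a) (m a) := by
    funext m
    exact (Fintype.prod_equiv e _ _ fun a => by simp).symm
  rw [e1]
  exact h

/-- The coefficient of u^k in e^{ρu}(1-u)^n as a Cauchy product: (ρu)^k (-1/ρ)^j = (ρu)^{k-j}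
(-u)^j. -/
theorem charlier_mul_pow {ρ : ℝ≥0} (hρ : 0 < ρ) (k n : ℕ) (u : ℝ) :
    (ρ * u) ^ k / (k.factorial : ℝ) * charlier ρ k n =
      ∑ q ∈ Finset.HasAntidiagonal.antidiagonal k,
        ((ρ * u) ^ q.1 / (q.1.factorial : ℝ)) * ((n.choose q.2 : ℝ) * (-u) ^ q.2) := by
  have hρ' : (ρ : ℝ) ≠ 0 := by exact_mod_cast hρ.ne'
  rw [← Finset.Nat.sum_antidiagonal_swap, Finset.Nat.sum_antidiagonal_eq_sum_range_succ_mk,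
    charlier, Finset.mul_sum]
  refine Finset.sum_congr rfl fun j hj => ?_
  have hjk : j ≤ k := Nat.lt_succ_iff.1 (Finset.mem_range.1 hj)
  simp only [Prod.fst_swap, Prod.snd_swap]
  rw [Nat.descFactorial_eq_factorial_mul_choose]
  obtain ⟨i, rfl⟩ := Nat.exists_eq_add_of_le hjk
  have h1 : ((j + i).choose j : ℝ) * j.factorial * i.factorial = (j + i).factorial := by
    have := Nat.choose_mul_factorial_mul_factorial hjk
    rw [Nat.add_sub_cancel_left] at this
    exact_mod_cast this
  have h2 : ((j + i).factorial : ℝ) ≠ 0 := by positivity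
  have h3 : (i.factorial : ℝ) ≠ 0 := by positivity
  have h4 : (ρ * u) ^ (j + i) * (-(1 / (ρ : ℝ))) ^ j = (ρ * u) ^ i * (-u) ^ j := by
    rw [pow_add, mul_assoc, mul_comm ((ρ * u : ℝ) ^ i), ← mul_assoc, ← mul_pow]
    have : (ρ : ℝ) * u * (-(1 / (ρ : ℝ))) = -u := by field_simp
    rw [this, mul_comm]
  rw [Nat.add_sub_cancel_left]
  push_cast
  rw [div_mul_eq_mul_div, div_mul_eq_mul_div, div_eq_div_iff h2 h3]
  linear_combination ((ρ * u) ^ i * (-u) ^ j * (n.choose j : ℝ)) * h1 +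
    ((j + i).choose j : ℝ) * j.factorial * (n.choose j : ℝ) * i.factorial * h4

theorem hasSum_choose_mul_pow (n : ℕ) (u : ℝ) :
    HasSum (fun j => (n.choose j : ℝ) * u ^ j) ((1 + u) ^ n) := by
  have : (1 + u) ^ n = ∑ j ∈ Finset.range (n + 1), (n.choose j : ℝ) * u ^ j := by
    rw [add_comm, add_pow]
    simp [mul_comm]
  rw [this]
  refine hasSum_sum_of_ne_finset_zero fun j hj => ?_
  rw [Nat.choose_eq_zero_of_lt (by simpa using hj)]
  simp

theorem hasSum_pow_div_factorial (u : ℝ) :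
    HasSum (fun j : ℕ => u ^ j / (j.factorial : ℝ)) (Real.exp u) := by
  rw [Real.exp_eq_exp_ℝ]
  exact NormedSpace.expSeries_div_hasSum_exp u

theorem summable_abs_charlier {ρ : ℝ≥0} (hρ : 0 < ρ) (n : ℕ) (u : ℝ) :
    Summable (fun k : ℕ => |(ρ * u) ^ k / (k.factorial : ℝ) * charlier ρ k n|) := by
  simp_rw [charlier_mul_pow hρ, ← Real.norm_eq_abs]
  exact summable_norm_sum_mul_antidiagonal_of_summable_norm
    (f := fun j : ℕ => (ρ * u) ^ j / (j.factorial : ℝ))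
    (g := fun j : ℕ => (n.choose j : ℝ) * (-u) ^ j) (hasSum_pow_div_factorial _).summable.norm
    (hasSum_choose_mul_pow _ _).summable.norm

theorem hasSum_charlier {ρ : ℝ≥0} (hρ : 0 < ρ) (n : ℕ) (u : ℝ) :
    HasSum (fun k : ℕ => (ρ * u) ^ k / (k.factorial : ℝ) * charlier ρ k n)
      (Real.exp (ρ * u) * (1 - u) ^ n) := by
  have h1 := hasSum_pow_div_factorial (ρ * u)
  have h2 := hasSum_choose_mul_pow n (-u)
  have h3 := tsum_mul_tsum_eq_tsum_sum_antidiagonal_of_summable_norm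
    (f := fun j : ℕ => (ρ * u) ^ j / (j.factorial : ℝ))
    (g := fun j : ℕ => (n.choose j : ℝ) * (-u) ^ j) h1.summable.norm h2.summable.norm
  rw [h1.tsum_eq, h2.tsum_eq, ← sub_eq_add_neg] at h3
  rw [h3]
  simp_rw [← charlier_mul_pow hρ]
  exact (summable_abs_charlier hρ n u).of_abs.hasSum

/-- Dropping the signs in the Cauchy product leaves the series of e^{ρ|u|}(1+|u|)^n. For |u| ≤ 1
this is a multiple of 2^n, which is square integrable under the Poisson law and so dominates later
exchanges of sum and integral. -/
theorem tsum_abs_charlier_le {ρ : ℝ≥0} (hρ : 0 < ρ) (n : ℕ) (u : ℝ) :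
    ∑' k : ℕ, |(ρ * u) ^ k / (k.factorial : ℝ) * charlier ρ k n| ≤
      Real.exp (ρ * |u|) * (1 + |u|) ^ n := by
  have h1 := hasSum_pow_div_factorial (ρ * |u|)
  have h2 := hasSum_choose_mul_pow n |u|
  have h3 := tsum_mul_tsum_eq_tsum_sum_antidiagonal_of_summable_norm
    (f := fun j : ℕ => (ρ * |u|) ^ j / (j.factorial : ℝ))
    (g := fun j : ℕ => (n.choose j : ℝ) * |u| ^ j) h1.summable.norm h2.summable.norm
  rw [h1.tsum_eq, h2.tsum_eq] at h3
  rw [h3]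
  refine (summable_abs_charlier hρ n u).tsum_le_tsum (fun k => ?_)
    (summable_norm_sum_mul_antidiagonal_of_summable_norm h1.summable.norm h2.summable.norm).of_norm
  rw [charlier_mul_pow hρ]
  refine (Finset.abs_sum_le_sum_abs _ _).trans_eq (Finset.sum_congr rfl fun q _ => ?_)
  simp [abs_mul, abs_div, abs_pow]

theorem abs_charlier_le {ρ : ℝ≥0} (hρ : 0 < ρ) (k n : ℕ) :
    |charlier ρ k n| ≤ (k.factorial / (ρ : ℝ) ^ k * Real.exp ρ) * 2 ^ n := by
  have hρ' : (0 : ℝ) < ρ := by exact_mod_cast hρ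
  have h := ((summable_abs_charlier hρ n 1).le_tsum k fun _ _ => abs_nonneg _).trans
    (tsum_abs_charlier_le hρ n 1)
  rw [mul_one, abs_mul, abs_of_pos (by positivity), abs_one, mul_one, one_add_one_eq_two] at h
  rw [div_mul_eq_mul_div, div_le_iff₀ (by positivity)] at h
  rw [div_mul_eq_mul_div, div_mul_eq_mul_div, le_div_iff₀ (by positivity)]
  linarith

end

/-! ### Labelled arrangements of configurations, and sums over translates. -/

section

variable {d : ℕ}

/-- The configuration of a tuple of particle positions. -/
def counts {n : ℕ} (x : Fin n → Site d) : FinConfig d := ∑ i, Finsupp.single (x i) 1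

/-- The tuples of particle positions with a given configuration. -/
def arrangements (n : ℕ) (ξ : FinConfig d) : Finset (Fin n → Site d) :=
  {x ∈ Fintype.piFinset fun _ => ξ.support | counts x = ξ}

/-- The configuration `ξ` moved by `y`. -/
def translate (y : Site d) (ξ : FinConfig d) : FinConfig d :=
  Finsupp.equivMapDomain (Equiv.addRight y) ξ

theorem translate_apply (y : Site d) (ξ : FinConfig d) (x : Site d) :
    translate y ξ x = ξ (x - y) := by
  simp [translate, sub_eq_add_neg]

theorem translate_eq_mapDomain (y : Site d) (ξ : FinConfig d) :
    translate y ξ = Finsupp.mapDomain (Equiv.addRight y) ξ :=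
  Finsupp.equivMapDomain_eq_mapDomain _ _

theorem prod_translate (y : Site d) (ξ : FinConfig d) (h : Site d → ℕ → ℝ) :
    (translate y ξ).prod h = ξ.prod fun x m => h (x + y) m := by
  rw [translate_eq_mapDomain, Finsupp.prod_mapDomain_index_inj (Equiv.injective _)]
  rfl

theorem degree_translate (y : Site d) (ξ : FinConfig d) : (translate y ξ).degree = ξ.degree := by
  rw [translate_eq_mapDomain]
  have := Finsupp.sum_mapDomain_index_inj (s := ξ) (h := fun _ m => m)
    (Equiv.injective (Equiv.addRight y))
  simpa [Finsupp.sum, Finsupp.degree_apply] using this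

theorem degree_counts {n : ℕ} (x : Fin n → Site d) : (counts x).degree = n := by
  simp [counts, map_sum, Finsupp.degree_single]

theorem counts_apply {n : ℕ} (x : Fin n → Site d) (a : Site d) :
    counts x a = ({i | x i = a} : Finset (Fin n)).card := by
  rw [Finset.card_filter, counts, Finsupp.finsetSum_apply]
  exact Finset.sum_congr rfl fun i _ => Finsupp.single_apply

theorem mem_arrangements {n : ℕ} {ξ : FinConfig d} {x : Fin n → Site d} :
    x ∈ arrangements n ξ ↔ counts x = ξ := by
  simp only [arrangements, Finset.mem_filter, Fintype.mem_piFinset, and_iff_right_iff_imp]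
  rintro rfl i
  rw [Finsupp.mem_support_iff, counts_apply]
  exact (Finset.card_pos.2 ⟨i, by simp⟩).ne'

theorem arrangements_eq_empty {n : ℕ} {ξ : FinConfig d} (h : ξ.degree ≠ n) :
    arrangements n ξ = ∅ := by
  refine Finset.eq_empty_of_forall_notMem fun x hx => h ?_
  rw [← mem_arrangements.1 hx, degree_counts]

theorem counts_cons {n : ℕ} (a : Site d) (x : Fin n → Site d) :
    counts (Fin.cons a x : Fin (n + 1) → Site d) = Finsupp.single a 1 + counts x := by
  simp [counts, Fin.sum_univ_succ]

/-- The product of the factorials of the particle numbers. -/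
def factorials (ξ : FinConfig d) : ℕ := ξ.prod fun _ m => m.factorial

theorem factorials_single_add (a : Site d) (ζ : FinConfig d) :
    factorials (Finsupp.single a 1 + ζ) = (ζ a + 1) * factorials ζ := by
  have hz : ∀ (ξ : FinConfig d) (s : Finset (Site d)), ξ.support ⊆ s →
      factorials ξ = ∏ x ∈ s, (ξ x).factorial := fun ξ s hs =>
    Finsupp.prod_of_support_subset _ hs _ (by simp)
  have hs : ζ.support ⊆ insert a ζ.support := Finset.subset_insert _ _
  have hs' : (Finsupp.single a 1 + ζ).support ⊆ insert a ζ.support := by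
    intro x hx
    by_contra hx'
    simp only [Finset.mem_insert, Finsupp.mem_support_iff, not_or, not_not] at hx'
    simp [hx'.2, Ne.symm hx'.1] at hx
  rw [hz _ _ hs', hz _ _ hs, ← Finset.mul_prod_erase _ _ (Finset.mem_insert_self a _),
    ← Finset.mul_prod_erase _ (fun x => (ζ x).factorial) (Finset.mem_insert_self a _), ← mul_assoc]
  congr 1
  · simp [add_comm 1, Nat.factorial_succ]
  · refine Finset.prod_congr rfl fun x hx => ?_
    simp [(Finset.ne_of_mem_erase hx).symm]

/-- The multinomial count, by removing the first particle: if it sits at a, then ξ! = ξ_a (ξ -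
δ_a)!, and Σ_a ξ_a is the particle number. -/
theorem card_arrangements_mul_factorials (n : ℕ) (ξ : FinConfig d) (hξ : ξ.degree = n) :
    (arrangements n ξ).card * factorials ξ = n.factorial := by
  induction n generalizing ξ with
  | zero =>
    have h0 : ξ = 0 := (Finsupp.degree_eq_zero_iff ξ).1 hξ
    subst h0
    have : arrangements 0 (0 : FinConfig d) = {Fin.elim0} := by
      ext x
      simp [mem_arrangements, counts, Subsingleton.elim x Fin.elim0]
    simp [this, factorials]
  | succ n ih =>
    have hsplit : (arrangements (n + 1) ξ).card =
        ∑ a ∈ ξ.support, (arrangements n (ξ - Finsupp.single a 1)).card := by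
      rw [Finset.card_eq_sum_card_fiberwise (f := fun x => x 0) (t := ξ.support)]
      · refine Finset.sum_congr rfl fun a ha => ?_
        have hle : Finsupp.single a 1 ≤ ξ := by
          rw [Finsupp.single_le_iff]
          exact Nat.one_le_iff_ne_zero.2 (Finsupp.mem_support_iff.1 ha)
        symm
        refine Finset.card_bij (fun x _ => Fin.cons a x) (fun x hx => ?_) (fun x _ y _ h => ?_)
          fun x hx => ?_
        · rw [mem_arrangements] at hx
          simp [mem_arrangements, counts_cons, hx, add_tsub_cancel_of_le hle]
        · exact (Fin.cons_injective2 h).2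
        · simp only [Finset.mem_filter, mem_arrangements] at hx
          refine ⟨Fin.tail x, ?_, ?_⟩
          · have h := counts_cons (x 0) (Fin.tail x)
            rw [Fin.cons_self_tail, hx.1, hx.2] at h
            rw [mem_arrangements, h, add_tsub_cancel_left]
          · rw [← hx.2, Fin.cons_self_tail]
      · intro x hx
        have := mem_arrangements.1 hx
        simp only [Finset.mem_coe, Finsupp.mem_support_iff, ← this, counts_apply]
        exact (Finset.card_pos.2 ⟨0, by simp⟩).ne'
    have hterm : ∀ a ∈ ξ.support,
        (arrangements n (ξ - Finsupp.single a 1)).card * factorials ξ = n.factorial * ξ a := by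
      intro a ha
      have hle : Finsupp.single a 1 ≤ ξ := by
        rw [Finsupp.single_le_iff]
        exact Nat.one_le_iff_ne_zero.2 (Finsupp.mem_support_iff.1 ha)
      obtain ⟨ζ, rfl⟩ := exists_add_of_le hle
      rw [add_tsub_cancel_left, factorials_single_add]
      have hd : ζ.degree = n := by
        rw [map_add, Finsupp.degree_single] at hξ
        lia
      rw [← ih ζ hd]
      simp
      ring
    rw [hsplit, Finset.sum_mul, Finset.sum_congr rfl hterm, ← Finset.mul_sum, Nat.factorial_succ,
      mul_comm, ← Finsupp.degree_apply, hξ]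

theorem card_arrangements_le (n : ℕ) (ξ : FinConfig d) :
    (arrangements n ξ).card ≤ n.factorial := by
  by_cases h : ξ.degree = n
  · rw [← card_arrangements_mul_factorials n ξ h]
    refine Nat.le_mul_of_pos_right _ (Finset.prod_pos fun x _ => Nat.factorial_pos _)
  · simp [arrangements_eq_empty h]

theorem counts_append {j m : ℕ} (a : Fin j → Site d) (b : Fin m → Site d) :
    counts (Fin.append a b) = counts a + counts b := by
  simp [counts, Fin.sum_univ_add]

theorem ennreal_tsum_prod {β : Type*} (n : ℕ) (w : Fin n → β → ℝ≥0∞) :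
    ∑' b : Fin n → β, ∏ i, w i (b i) = ∏ i, ∑' z, w i z := by
  induction n with
  | zero => simp
  | succ n ih =>
    rw [Fin.prod_univ_succ, ← ih, ← (Fin.consEquiv (fun _ => β)).tsum_eq, ENNReal.tsum_prod',
      ← ENNReal.tsum_mul_right]
    refine tsum_congr fun z => ?_
    rw [← ENNReal.tsum_mul_left]
    refine tsum_congr fun b => ?_
    simp [Fin.prod_univ_succ, Fin.consEquiv]

-- Moved back by y, the particles of R lie inside ξ at sites not below b₀ - y in the lexicographic
-- order. They are therefore disjoint from the particles of ξ strictly below b₀ - y, and the two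
-- numbers add up to at most the total.
open scoped Classical in
theorem sum_below_add_degree_le {ξ R : FinConfig d} {y b₀ : Site d} (hR : R ≤ translate y ξ)
    (hb : ∀ x ∈ R.support, toLex b₀ ≤ toLex x) :
    ∑ q ∈ ξ.support with toLex q < toLex (b₀ - y), ξ q + R.degree ≤ ξ.degree := by
  rw [Finsupp.degree_apply ξ,
    ← Finset.sum_filter_add_sum_filter_not ξ.support (fun q => toLex q < toLex (b₀ - y))]
  refine Nat.add_le_add_left ?_ _
  have himage : ∑ q ∈ R.support.image (fun x => x - y), R (q + y) = R.degree := by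
    rw [Finset.sum_image (fun x _ x' _ h => sub_left_injective h), Finsupp.degree_apply]
    simp
  rw [← himage]
  have hsub : R.support.image (fun x => x - y) ⊆
      {q ∈ ξ.support | ¬toLex q < toLex (b₀ - y)} := by
    intro q hq
    obtain ⟨x, hx, rfl⟩ := Finset.mem_image.1 hq
    have h1 := hR x
    rw [translate_apply] at h1
    simp only [Finset.mem_filter, Finsupp.mem_support_iff]
    refine ⟨fun h0 => ?_, ?_⟩
    · rw [h0] at h1
      exact Finsupp.mem_support_iff.1 hx (Nat.le_zero.1 h1)
    · rw [toLex_sub, toLex_sub]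
      exact not_lt_of_ge (sub_le_sub_right (hb x hx) _)
  refine (Finset.sum_le_sum fun q _ => ?_).trans (Finset.sum_le_sum_of_subset hsub)
  have := hR (q + y)
  rwa [translate_apply, add_sub_cancel_right] at this

/-- A nonempty configuration which arises from `ξ` by moving it and removing `j` particles
determines the translation up to `j + 1` possibilities. -/
theorem card_translates_le {ξ R : FinConfig d} {j : ℕ} (hR0 : R ≠ 0)
    (hj : ξ.degree ≤ j + R.degree) (Y : Finset (Site d)) (hY : ∀ y ∈ Y, R ≤ translate y ξ) :
    Y.card ≤ j + 1 := by
  classical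
  -- Every admissible y makes b₀ - y an occupied site of ξ. Relative to the greatest of these sites,
  -- all the others lie strictly below, hence among the at most j particles of ξ not used by R; so
  -- there are at most j + 1.
  obtain ⟨b₀, hb₀, hb⟩ := Finset.exists_min_image R.support (toLex : Site d → Lex (Site d))
    (Finsupp.support_nonempty_iff.2 hR0)
  set Q := Y.image fun y => b₀ - y with hQ
  have hcard : Q.card = Y.card := Finset.card_image_of_injective _ sub_right_injective
  rw [← hcard]
  rcases Q.eq_empty_or_nonempty with h0 | hne
  · simp [h0]
  obtain ⟨p, hp, hmax⟩ := Finset.exists_max_image Q (toLex : Site d → Lex (Site d)) hne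
  obtain ⟨y, hy, rfl⟩ := Finset.mem_image.1 hp
  have h1 := sum_below_add_degree_le (hY y hy) hb
  have h2 : (Q.erase (b₀ - y)).card ≤
      ∑ q ∈ ξ.support with toLex q < toLex (b₀ - y), ξ q := by
    rw [Finset.card_eq_sum_ones]
    have hsupp : ∀ q ∈ Q, ξ q ≠ 0 := by
      intro q hq h0
      obtain ⟨y', hy', rfl⟩ := Finset.mem_image.1 hq
      have := hY y' hy' b₀
      rw [translate_apply, h0] at this
      exact Finsupp.mem_support_iff.1 hb₀ (Nat.le_zero.1 this)
    refine (Finset.sum_le_sum fun q hq => ?_).trans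
      (Finset.sum_le_sum_of_subset (f := fun q => ξ q) fun q hq => ?_)
    · exact Nat.one_le_iff_ne_zero.2 (hsupp q (Finset.mem_of_mem_erase hq))
    · rw [Finset.mem_filter, Finsupp.mem_support_iff]
      refine ⟨hsupp q (Finset.mem_of_mem_erase hq), lt_of_le_of_ne
        (hmax q (Finset.mem_of_mem_erase hq)) fun h => ?_⟩
      exact Finset.ne_of_mem_erase hq (toLex.injective h)
  rw [Finset.card_erase_of_mem hp] at h2
  lia

/-- Split a tuple into j coordinates a, estimated by Q each, and m + 1 ≥ 1 coordinates b, kept with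
their weights. For fixed b at most j + 1 translations are compatible, each leaving at most j!
choices of a; this gives (j+1)! Q^j, and the weights of b sum to at most 1. -/
theorem tsum_translates_le_aux {j m : ℕ} (w : Fin (j + (m + 1)) → Site d → ℝ≥0∞) (Q : ℝ≥0∞)
    (hw : ∀ i, ∑' z, w i z ≤ 1) (hQ : ∀ i z, w i z ≤ Q) (ξ : FinConfig d)
    (hξ : ξ.degree = j + (m + 1)) :
    ∑' y, ∑ z ∈ arrangements (j + (m + 1)) (translate y ξ), ∏ i, w i (z i) ≤
      (j + 1).factorial * Q ^ j := by
  classical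
  have e1 : ∀ y, ∑ z ∈ arrangements (j + (m + 1)) (translate y ξ), ∏ i, w i (z i) =
      ∑' b : Fin (m + 1) → Site d, ∑' a : Fin j → Site d,
        if counts a + counts b = translate y ξ then
          (∏ i, w (Fin.castAdd (m + 1) i) (a i)) * ∏ i, w (Fin.natAdd j i) (b i) else 0 := by
    intro y
    rw [ENNReal.tsum_comm, ← ENNReal.tsum_prod, ← (Fin.appendEquiv j (m + 1)).symm.tsum_eq]
    have h := tsum_eq_sum (L := .unconditional _) (s := arrangements (j + (m + 1)) (translate y ξ))
      (f := fun z => if counts z = translate y ξ then ∏ i, w i (z i) else 0) fun z hz =>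
        if_neg fun h => hz (mem_arrangements.2 h)
    refine (Eq.trans ?_ h.symm).trans ?_
    · exact (Finset.sum_congr rfl fun z hz => if_pos (mem_arrangements.1 hz)).symm
    · refine tsum_congr fun z => ?_
      have hz := (Fin.appendEquiv j (m + 1)).apply_symm_apply z
      set q := (Fin.appendEquiv j (m + 1)).symm z
      rw [← hz]
      simp [Fin.appendEquiv, counts_append, Fin.prod_univ_add]
  simp_rw [e1]
  rw [ENNReal.tsum_comm]
  have e2 : ∀ b : Fin (m + 1) → Site d, ∑' y, ∑' a : Fin j → Site d,
        (if counts a + counts b = translate y ξ then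
          (∏ i, w (Fin.castAdd (m + 1) i) (a i)) * ∏ i, w (Fin.natAdd j i) (b i) else 0) ≤
      ((j + 1).factorial * Q ^ j) * ∏ i, w (Fin.natAdd j i) (b i) := by
    intro b
    set W := ∏ i, w (Fin.natAdd j i) (b i)
    have hy : ∀ y, ∑' a : Fin j → Site d,
        (if counts a + counts b = translate y ξ then
          (∏ i, w (Fin.castAdd (m + 1) i) (a i)) * W else 0) ≤
        if counts b ≤ translate y ξ then (j.factorial : ℝ≥0∞) * Q ^ j * W else 0 := by
      intro y
      split_ifs with hb
      · obtain ⟨ζ, hζ⟩ := exists_add_of_le hb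
        rw [tsum_eq_sum (s := arrangements j ζ)]
        · refine (Finset.sum_le_sum (g := fun _ => Q ^ j * W) fun a _ => ?_).trans ?_
          · split_ifs
            · gcongr
              refine (Finset.prod_le_prod' fun i _ => hQ _ (a i)).trans_eq ?_
              simp
            · exact zero_le
          · rw [Finset.sum_const, nsmul_eq_mul, mul_assoc]
            gcongr
            exact card_arrangements_le _ _
        · intro a ha
          rw [if_neg fun h => ha (mem_arrangements.2 ?_)]
          rw [hζ, add_comm] at h
          exact add_left_cancel h
      · refine le_of_eq (ENNReal.tsum_eq_zero.2 fun a => if_neg fun h => hb ?_)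
        rw [← h]
        exact le_add_self
    refine (ENNReal.tsum_le_tsum hy).trans ?_
    rw [ENNReal.tsum_eq_iSup_sum]
    refine iSup_le fun s => ?_
    rw [← Finset.sum_filter, Finset.sum_const, nsmul_eq_mul, Nat.factorial_succ]
    have hc : (s.filter fun y => counts b ≤ translate y ξ).card ≤ j + 1 := by
      refine card_translates_le (R := counts b) (fun h => ?_) (by rw [hξ, degree_counts]) _
        fun y hy => (Finset.mem_filter.1 hy).2
      have := degree_counts b
      rw [h] at this
      simp at this
    calc _ ≤ ((j + 1 : ℕ) : ℝ≥0∞) * ((j.factorial : ℝ≥0∞) * Q ^ j * W) := by gcongr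
      _ = _ := by push_cast; ring
  refine (ENNReal.tsum_le_tsum e2).trans ?_
  rw [ENNReal.tsum_mul_left, ennreal_tsum_prod (m + 1) fun i => w (Fin.natAdd j i)]
  exact mul_le_of_le_one_right' (Finset.prod_le_one' fun i _ => hw _)

/-- The case j = k - 1. The bound involves k but not n, which is essential because all degrees n ≥ k
are summed afterwards. -/
theorem tsum_translates_le {n k : ℕ} (hk : 1 ≤ k) (hkn : k ≤ n) (w : Fin n → Site d → ℝ≥0∞)
    (Q : ℝ≥0∞) (hw : ∀ i, ∑' z, w i z ≤ 1) (hQ : ∀ i z, w i z ≤ Q) (ξ : FinConfig d) :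
    ∑' y, ∑ z ∈ arrangements n (translate y ξ), ∏ i, w i (z i) ≤ k.factorial * Q ^ (k - 1) := by
  by_cases hξ : ξ.degree = n
  · obtain ⟨j, rfl⟩ := Nat.exists_eq_add_of_le' hk
    obtain ⟨m, rfl⟩ := Nat.exists_eq_add_of_le hkn
    have e : j + 1 + m = j + (m + 1) := by ring
    generalize j + 1 + m = n at *
    subst e
    exact tsum_translates_le_aux w Q hw hQ ξ hξ
  · simp [arrangements_eq_empty ((degree_translate _ ξ).trans_ne hξ)]

end

/-! ### Fourier analysis on the torus and the heat kernel bound. -/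

section

variable {d : ℕ}

/-- The uniform distribution on `[-π, π]`. -/
def angleMeasure : Measure ℝ :=
  ENNReal.ofReal (1 / (2 * Real.pi)) • volume.restrict (Set.Ioc (-Real.pi) Real.pi)

theorem integral_angleMeasure {E : Type*} [NormedAddCommGroup E] [NormedSpace ℝ E] (f : ℝ → E) :
    ∫ x, f x ∂angleMeasure = (1 / (2 * Real.pi)) • ∫ x in (-Real.pi)..Real.pi, f x := by
  rw [angleMeasure, integral_smul_measure,
    intervalIntegral.integral_of_le (by linarith [Real.pi_pos]),
    ENNReal.toReal_ofReal (by positivity)]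

instance : IsProbabilityMeasure angleMeasure := by
  constructor
  rw [angleMeasure, Measure.smul_apply, Measure.restrict_apply_univ, Real.volume_Ioc, smul_eq_mul,
    ← ENNReal.ofReal_mul (by positivity), ← ENNReal.ofReal_one]
  congr 1
  field_simp
  ring

/-- The uniform distribution on `[-π, π]^d`. -/
def torusMeasure (d : ℕ) : Measure (Fin d → ℝ) := Measure.pi fun _ => angleMeasure

instance : IsProbabilityMeasure (torusMeasure d) := by
  unfold torusMeasure; infer_instance

/-- The phase `⟨θ, y⟩`. -/
def phase (θ : Fin d → ℝ) (y : Site d) : ℝ := ∑ i, θ i * (y i : ℝ)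

theorem phase_add (θ : Fin d → ℝ) (x y : Site d) : phase θ (x + y) = phase θ x + phase θ y := by
  simp [phase, mul_add, Finset.sum_add_distrib]

theorem phase_neg (θ : Fin d → ℝ) (x : Site d) : phase θ (-x) = -phase θ x := by
  simp [phase]

theorem continuous_phase (y : Site d) : Continuous fun θ : Fin d → ℝ => phase θ y := by
  unfold phase; fun_prop

theorem integral_angleMeasure_exp (m : ℤ) :
    ∫ x, Complex.exp (Complex.I * ((x * m : ℝ) : ℂ)) ∂angleMeasure = if m = 0 then 1 else 0 := by
  rw [integral_angleMeasure]
  split_ifs with hm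
  · subst hm
    have hpi : (Real.pi : ℂ) ≠ 0 := by exact_mod_cast Real.pi_ne_zero
    simp only [Int.cast_zero, mul_zero, Complex.ofReal_zero, Complex.exp_zero,
      intervalIntegral.integral_const, Complex.real_smul]
    push_cast
    field_simp
    norm_num
  · have hc : Complex.I * (m : ℂ) ≠ 0 :=
      mul_ne_zero Complex.I_ne_zero (by exact_mod_cast hm)
    have h : ∀ x : ℝ, Complex.exp (Complex.I * ((x * m : ℝ) : ℂ)) =
        Complex.exp (Complex.I * (m : ℂ) * x) := fun x => by
      push_cast; ring_nf
    simp_rw [h]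
    rw [integral_exp_mul_complex hc]
    have : Complex.exp (Complex.I * m * (Real.pi : ℝ)) =
        Complex.exp (Complex.I * m * ((-Real.pi : ℝ) : ℂ)) := by
      rw [Complex.exp_eq_exp_iff_exists_int]
      exact ⟨m, by push_cast; ring⟩
    rw [this]
    simp

theorem integral_torusMeasure_exp (y : Site d) :
    ∫ θ, Complex.exp (Complex.I * (phase θ y : ℂ)) ∂(torusMeasure d) = if y = 0 then 1 else 0 := by
  have h : ∀ θ : Fin d → ℝ, Complex.exp (Complex.I * (phase θ y : ℂ)) =
      ∏ i, Complex.exp (Complex.I * ((θ i * y i : ℝ) : ℂ)) := fun θ => by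
    rw [← Complex.exp_sum, phase, Complex.ofReal_sum, Finset.mul_sum]
  simp_rw [h]
  rw [torusMeasure, integral_fintype_prod_eq_prod
    (fun i (t : ℝ) => Complex.exp (Complex.I * ((t * y i : ℝ) : ℂ)))]
  simp_rw [integral_angleMeasure_exp]
  split_ifs with hy
  · simp [hy]
  · obtain ⟨i, hi⟩ := Function.ne_iff.1 hy
    exact Finset.prod_eq_zero (Finset.mem_univ i) (if_neg hi)

variable {p : Site d → Site d → ℝ}

theorem IsJumpKernel.finite_support (hp : IsJumpKernel p) : {a | p 0 a ≠ 0}.Finite := by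
  obtain ⟨R, _, hR⟩ := hp.finite_range
  refine (isCompact_closedBall (0 : Site d) R).finite_of_discrete.subset fun a ha => ?_
  rw [mem_closedBall_zero_iff]
  by_contra h
  exact ha (hR 0 a (by simpa using h))

/-- The possible jumps. -/
def IsJumpKernel.jumps (hp : IsJumpKernel p) : Finset (Site d) := hp.finite_support.toFinset

theorem IsJumpKernel.mem_jumps (hp : IsJumpKernel p) (a : Site d) : a ∈ hp.jumps ↔ p 0 a ≠ 0 := by
  simp [IsJumpKernel.jumps]

theorem IsJumpKernel.sum_jumps (hp : IsJumpKernel p) : ∑ a ∈ hp.jumps, p 0 a = 1 := by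
  rw [← (hp.hasSum_one 0).tsum_eq, tsum_eq_sum]
  intro a ha
  simpa [hp.mem_jumps] using ha

/-- The characteristic function of a jump. -/
def IsJumpKernel.char (hp : IsJumpKernel p) (θ : Fin d → ℝ) : ℂ :=
  ∑ a ∈ hp.jumps, (p 0 a : ℂ) * Complex.exp (-(Complex.I * (phase θ a : ℂ)))

theorem IsJumpKernel.continuous_char (hp : IsJumpKernel p) : Continuous hp.char := by
  unfold IsJumpKernel.char
  have := fun a : Site d => continuous_phase (d := d) a
  fun_prop

theorem IsJumpKernel.re_char (hp : IsJumpKernel p) (θ : Fin d → ℝ) :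
    (hp.char θ).re = 1 - ∑ a ∈ hp.jumps, p 0 a * (1 - Real.cos (phase θ a)) := by
  have h : ∀ a, ((p 0 a : ℂ) * Complex.exp (-(Complex.I * (phase θ a : ℂ)))).re =
      p 0 a * Real.cos (phase θ a) := fun a => by
    rw [Complex.re_ofReal_mul, mul_comm Complex.I, ← neg_mul, ← Complex.ofReal_neg,
      Complex.exp_ofReal_mul_I_re, Real.cos_neg]
  simp_rw [IsJumpKernel.char, Complex.re_sum, h, mul_sub, Finset.sum_sub_distrib, mul_one,
    hp.sum_jumps]
  ring

theorem IsJumpKernel.norm_char_le (hp : IsJumpKernel p) (θ : Fin d → ℝ) : ‖hp.char θ‖ ≤ 1 := by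
  refine (norm_sum_le _ _).trans_eq ?_
  rw [← hp.sum_jumps]
  refine Finset.sum_congr rfl fun a _ => ?_
  rw [norm_mul, mul_comm Complex.I, ← neg_mul, ← Complex.ofReal_neg, Complex.norm_exp_ofReal_mul_I,
    mul_one, Complex.norm_real, Real.norm_of_nonneg (hp.nonneg _ _)]

theorem IsJumpKernel.stepProb_succ (hp : IsJumpKernel p) (n : ℕ) (y : Site d) :
    stepProb p (n + 1) 0 y = ∑ a ∈ hp.jumps, stepProb p n 0 (y - a) * p 0 a := by
  rw [stepProb, ← (Equiv.subLeft y).tsum_eq, tsum_eq_sum (s := hp.jumps)]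
  · refine Finset.sum_congr rfl fun a _ => ?_
    rw [Equiv.subLeft_apply, hp.translation (y - a), sub_sub_cancel]
  · intro a ha
    rw [Equiv.subLeft_apply, hp.translation (y - a), sub_sub_cancel]
    rw [hp.mem_jumps, not_not] at ha
    rw [ha, mul_zero]

theorem integrable_torusMeasure_of_continuous {f : (Fin d → ℝ) → ℂ} (hf : Continuous f) (C : ℝ)
    (hC : ∀ θ, ‖f θ‖ ≤ C) : Integrable f (torusMeasure d) :=
  (integrable_const C).mono' hf.aestronglyMeasurable (.of_forall hC)

theorem norm_exp_phase (θ : Fin d → ℝ) (y : Site d) :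
    ‖Complex.exp (Complex.I * (phase θ y : ℂ))‖ = 1 := by
  rw [mul_comm, Complex.norm_exp_ofReal_mul_I]

/-- Fourier inversion: convolution with one jump multiplies the transform by the characteristic
function, and the sum over jumps is finite. -/
theorem IsJumpKernel.stepProb_eq_integral (hp : IsJumpKernel p) (n : ℕ) (y : Site d) :
    (stepProb p n 0 y : ℂ) =
      ∫ θ, hp.char θ ^ n * Complex.exp (Complex.I * (phase θ y : ℂ)) ∂(torusMeasure d) := by
  induction n generalizing y with
  | zero =>
    simp only [pow_zero, one_mul, integral_torusMeasure_exp, stepProb, eq_comm (a := (0 : Site d))]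
    split_ifs <;> simp
  | succ n ih =>
    rw [hp.stepProb_succ]
    push_cast
    simp_rw [ih, ← integral_mul_const]
    rw [← integral_finsetSum]
    · refine integral_congr_ae (.of_forall fun θ => ?_)
      simp only [pow_succ]
      generalize hp.char θ ^ n = X
      conv_rhs => rw [IsJumpKernel.char, mul_assoc, Finset.sum_mul, Finset.mul_sum]
      refine Finset.sum_congr rfl fun a _ => ?_
      rw [sub_eq_add_neg, phase_add, phase_neg, Complex.ofReal_add, Complex.ofReal_neg, mul_add,
        Complex.exp_add, mul_neg]
      ring
    · intro a _
      have h1 := hp.continuous_char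
      have h2 := continuous_phase (d := d) (y - a)
      refine integrable_torusMeasure_of_continuous (by fun_prop) ‖(p 0 a : ℂ)‖ fun θ => ?_
      rw [norm_mul, norm_mul, norm_exp_phase, mul_one, norm_pow]
      exact mul_le_of_le_one_left (norm_nonneg _)
        (pow_le_one₀ (norm_nonneg _) (hp.norm_char_le θ))

theorem IsJumpKernel.abs_stepProb_le (hp : IsJumpKernel p) (n : ℕ) (y : Site d) : |stepProb p n 0 y| ≤ 1 := by
  rw [← Real.norm_eq_abs, ← Complex.norm_real, hp.stepProb_eq_integral]
  refine (norm_integral_le_of_norm_le_const (C := 1) (.of_forall fun θ => ?_)).trans_eq (by simp)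
  rw [norm_mul, norm_exp_phase, mul_one, norm_pow]
  exact pow_le_one₀ (norm_nonneg _) (hp.norm_char_le θ)

theorem IsJumpKernel.summable_walkProb (hp : IsJumpKernel p) (t : ℝ) (y : Site d) :
    Summable fun n : ℕ => Real.exp (-t) * t ^ n / (n.factorial : ℝ) * stepProb p n 0 y := by
  refine Summable.of_norm_bounded
    (g := fun n : ℕ => Real.exp (-t) * (|t| ^ n / (n.factorial : ℝ)))
    ((hasSum_pow_div_factorial _).summable.mul_left _) fun n => ?_
  rw [norm_mul]
  refine (mul_le_of_le_one_right (norm_nonneg _) (hp.abs_stepProb_le n y)).trans_eq ?_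
  rw [norm_div, norm_mul, norm_pow, Real.norm_of_nonneg (Real.exp_nonneg _), Real.norm_natCast,
    Real.norm_eq_abs, mul_div_assoc]

theorem IsJumpKernel.measurable_walkProb (hp : IsJumpKernel p) (y : Site d) :
    Measurable fun t => walkProb p t 0 y := by
  refine measurable_of_tendsto_metrizable
    (f := fun (m : ℕ) (t : ℝ) => ∑ n ∈ Finset.range m,
      Real.exp (-t) * t ^ n / (n.factorial : ℝ) * stepProb p n 0 y) (fun m => by fun_prop) ?_
  rw [tendsto_pi_nhds]
  exact fun t => (hp.summable_walkProb t y).hasSum.tendsto_sum_nat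

/-- A Poisson number of jumps turns powers of the characteristic function into an exponential; the
series is dominated by e^{-t} t^n/n!. -/
theorem IsJumpKernel.walkProb_eq_integral (hp : IsJumpKernel p) {t : ℝ} (ht : 0 ≤ t) (y : Site d) :
    (walkProb p t 0 y : ℂ) = ∫ θ, Complex.exp (-t + t * hp.char θ) *
      Complex.exp (Complex.I * (phase θ y : ℂ)) ∂(torusMeasure d) := by
  have h1 := hp.continuous_char
  have h2 := continuous_phase (d := d) y
  have h : HasSum (fun n : ℕ => ∫ θ, (Complex.exp (-t) * (t * hp.char θ) ^ n / (n.factorial : ℂ)) *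
      Complex.exp (Complex.I * (phase θ y : ℂ)) ∂(torusMeasure d))
      (∫ θ, Complex.exp (-t + t * hp.char θ) *
      Complex.exp (Complex.I * (phase θ y : ℂ)) ∂(torusMeasure d)) := by
    refine hasSum_integral_of_dominated_convergence
      (fun n _ => Real.exp (-t) * (t ^ n / (n.factorial : ℝ))) (fun n => ?_)
      (fun n => .of_forall fun θ => ?_) (.of_forall fun θ => ?_) (integrable_const _)
      (.of_forall fun θ => ?_)
    · exact Continuous.aestronglyMeasurable (by fun_prop)
    · rw [norm_mul, norm_exp_phase, mul_one, norm_div, norm_mul, norm_pow, norm_mul,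
        Complex.norm_natCast, Complex.norm_real, Real.norm_of_nonneg ht, ← Complex.ofReal_neg,
        Complex.norm_exp_ofReal, mul_div_assoc]
      gcongr
      exact mul_le_of_le_one_right ht (hp.norm_char_le θ)
    · exact (hasSum_pow_div_factorial t).summable.mul_left _
    · rw [Complex.exp_add]
      refine HasSum.mul_right _ ?_
      simp_rw [mul_div_assoc]
      refine HasSum.mul_left _ ?_
      rw [Complex.exp_eq_exp_ℂ]
      exact NormedSpace.expSeries_div_hasSum_exp _
  rw [← h.tsum_eq, walkProb, Complex.ofReal_tsum]
  refine tsum_congr fun n => ?_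
  push_cast
  rw [hp.stepProb_eq_integral, ← integral_const_mul]
  refine integral_congr_ae (.of_forall fun θ => ?_)
  simp only [mul_pow]
  ring

/-- Since 1 - cos x = 2 sin²(x/2), this is a quasi-triangle inequality for squared sines. It
propagates bounds along paths of jumps. -/
theorem one_sub_cos_add_le (a b : ℝ) :
    1 - Real.cos (a + b) ≤ 2 * (1 - Real.cos a) + 2 * (1 - Real.cos b) := by
  have h : ∀ x : ℝ, 1 - Real.cos x = 2 * Real.sin (x / 2) ^ 2 := fun x => by
    have := Real.cos_sq' (x / 2)
    have h2 := Real.cos_two_mul (x / 2)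
    rw [mul_div_cancel₀ _ two_ne_zero] at h2
    linarith
  rw [h, h, h, add_div, Real.sin_add]
  set A := a / 2
  set B := b / 2
  have h1 := Real.sin_sq_add_cos_sq A
  have h2 := Real.sin_sq_add_cos_sq B
  nlinarith [sq_nonneg (Real.sin A * Real.cos B - Real.cos A * Real.sin B),
    sq_nonneg (Real.sin A * Real.sin B), sq_nonneg (Real.cos A), sq_nonneg (Real.cos B)]

theorem IsJumpKernel.mul_one_sub_cos_le (hp : IsJumpKernel p) (θ : Fin d → ℝ) (a : Site d) :
    p 0 a * (1 - Real.cos (phase θ a)) ≤ 1 - (hp.char θ).re := by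
  have hnn : ∀ a, 0 ≤ p 0 a * (1 - Real.cos (phase θ a)) := fun a =>
    mul_nonneg (hp.nonneg _ _) (sub_nonneg.2 (Real.cos_le_one _))
  rw [hp.re_char, sub_sub_cancel]
  by_cases ha : a ∈ hp.jumps
  · exact Finset.single_le_sum (f := fun a => p 0 a * (1 - Real.cos (phase θ a)))
      (fun a _ => hnn a) ha
  · rw [hp.mem_jumps, not_not] at ha
    rw [ha, zero_mul]
    exact Finset.sum_nonneg fun a _ => hnn a

/-- Follow a path of possible jumps from 0 to y, provided by irreducibility; a jump of probability p
costs at most 1/p times 1 - Re of the characteristic function. -/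
theorem IsJumpKernel.exists_one_sub_cos_le (hp : IsJumpKernel p) (y : Site d) :
    ∃ K : ℝ, 0 ≤ K ∧ ∀ θ, 1 - Real.cos (phase θ y) ≤ K * (1 - (hp.char θ).re) := by
  induction hp.irreducible 0 y with
  | refl => exact ⟨0, le_rfl, fun θ => by simp [phase]⟩
  | @tail y z _ hyz ih =>
    obtain ⟨K, hK, h⟩ := ih
    rw [hp.translation] at hyz
    refine ⟨2 * K + 2 * (1 / p 0 (z - y)), by positivity, fun θ => ?_⟩
    have h1 := one_sub_cos_add_le (phase θ y) (phase θ (z - y))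
    rw [← phase_add, add_sub_cancel] at h1
    have h2 := hp.mul_one_sub_cos_le θ (z - y)
    have h3 : 1 - Real.cos (phase θ (z - y)) ≤ 1 / p 0 (z - y) * (1 - (hp.char θ).re) := by
      rw [div_mul_eq_mul_div, le_div_iff₀ hyz]
      linarith
    linarith [h θ]

theorem IsJumpKernel.exists_sum_one_sub_cos_le (hp : IsJumpKernel p) :
    ∃ c : ℝ, 0 < c ∧ ∀ θ : Fin d → ℝ, c * ∑ i, (1 - Real.cos (θ i)) ≤ 1 - (hp.char θ).re := by
  choose K hK h using hp.exists_one_sub_cos_le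
  have h0 : ∀ θ, 0 ≤ 1 - (hp.char θ).re := fun θ => by
    have := hp.mul_one_sub_cos_le θ 0
    simpa [phase] using this
  -- The summand 1 only ensures M > 0.
  set M : ℝ := 1 + ∑ i : Fin d, K (Pi.single i 1)
  have hM : 0 < M := by
    have : 0 ≤ ∑ i : Fin d, K (Pi.single i 1) := Finset.sum_nonneg fun i _ => hK _
    positivity
  refine ⟨1 / M, by positivity, fun θ => ?_⟩
  rw [div_mul_eq_mul_div, div_le_iff₀ hM, one_mul]
  calc ∑ i, (1 - Real.cos (θ i)) ≤ ∑ i, K (Pi.single i 1) * (1 - (hp.char θ).re) := by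
        refine Finset.sum_le_sum fun i _ => ?_
        have := h (Pi.single i 1) θ
        rwa [phase, Finset.sum_eq_single i (fun j _ hj => by simp [hj]) (by simp),
          Pi.single_eq_same, Int.cast_one, mul_one] at this
    _ ≤ _ := by
        rw [← Finset.sum_mul, mul_comm]
        exact mul_le_mul_of_nonneg_left (by simp [M]) (h0 θ)

/-- On [-π, π] one has cos x ≤ 1 - 2x²/π², so a Gaussian integral dominates. The constant 1 is
enough because π ≤ 8. -/
theorem integral_exp_one_sub_cos_le {b : ℝ} (hb : 0 < b) :
    ∫ x, Real.exp (-b * (1 - Real.cos x)) ∂angleMeasure ≤ 1 / √b := by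
  rw [integral_angleMeasure, smul_eq_mul]
  have hpi := Real.pi_pos
  have hc : 0 < b * (2 / Real.pi ^ 2) := by positivity
  have h1 : ∫ x in (-Real.pi)..Real.pi, Real.exp (-b * (1 - Real.cos x)) ≤
      √(Real.pi / (b * (2 / Real.pi ^ 2))) := by
    rw [← integral_gaussian, intervalIntegral.integral_of_le (by linarith)]
    refine (setIntegral_mono_on ?_ (integrable_exp_neg_mul_sq hc).integrableOn
      measurableSet_Ioc fun x hx => ?_).trans (setIntegral_le_integral
      (integrable_exp_neg_mul_sq hc) (.of_forall fun x => (Real.exp_pos _).le))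
    · exact (Continuous.integrableOn_Icc (by fun_prop)).mono_set Set.Ioc_subset_Icc_self
    · refine Real.exp_le_exp.2 ?_
      have h := Real.cos_le_one_sub_mul_cos_sq (x := x) (abs_le.2 ⟨hx.1.le, hx.2⟩)
      nlinarith
  have h2 : √(Real.pi / (b * (2 / Real.pi ^ 2))) ≤ 2 * Real.pi * (1 / √b) := by
    rw [Real.sqrt_le_left (by positivity)]
    rw [mul_pow, div_pow, Real.sq_sqrt hb.le]
    rw [one_pow, mul_one_div, div_le_div_iff₀ hc hb]
    have : (2 * Real.pi) ^ 2 * (b * (2 / Real.pi ^ 2)) = 8 * b := by field_simp; norm_num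
    rw [this]
    exact mul_le_mul_of_nonneg_right (by linarith [Real.pi_le_four]) hb.le
  calc _ ≤ 1 / (2 * Real.pi) * (2 * Real.pi * (1 / √b)) := by gcongr; exact h1.trans h2
    _ = _ := by field_simp

/-- In continuous time the modulus of the transform is exp(-t(1 - Re char)). Only the real part
matters, so no aperiodicity is needed, and the lower bound by Σ(1 - cos θ_i) makes the integral
factorize over coordinates. -/
theorem IsJumpKernel.exists_walkProb_le (hp : IsJumpKernel p) :
    ∃ C : ℝ, 0 < C ∧ ∀ t : ℝ, 0 < t → ∀ y, walkProb p t 0 y ≤ C * (1 / √t) ^ d := by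
  obtain ⟨c, hc, h⟩ := hp.exists_sum_one_sub_cos_le
  refine ⟨(1 / √c) ^ d, by positivity, fun t ht y => ?_⟩
  refine (le_abs_self _).trans ?_
  rw [← Real.norm_eq_abs, ← Complex.norm_real, hp.walkProb_eq_integral ht.le]
  refine (norm_integral_le_integral_norm _).trans ?_
  have hcont := hp.continuous_char
  have hle : ∀ θ, ‖Complex.exp (-t + t * hp.char θ) * Complex.exp (Complex.I * (phase θ y : ℂ))‖ ≤
      ∏ i, Real.exp (-(t * c) * (1 - Real.cos (θ i))) := fun θ => by
    rw [norm_mul, norm_exp_phase, mul_one, Complex.norm_exp, ← Real.exp_sum, ← Finset.mul_sum]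
    refine Real.exp_le_exp.2 ?_
    simp only [Complex.add_re, Complex.neg_re, Complex.ofReal_re, Complex.re_ofReal_mul]
    nlinarith [h θ]
  have hone : ∀ θ : Fin d → ℝ, ∏ i, Real.exp (-(t * c) * (1 - Real.cos (θ i))) ≤ 1 := fun θ =>
    Finset.prod_le_one (fun i _ => (Real.exp_pos _).le) fun i _ => Real.exp_le_one_iff.2 <| by
      have := Real.cos_le_one (θ i)
      have : 0 ≤ t * c * (1 - Real.cos (θ i)) := by
        apply mul_nonneg (by positivity); linarith
      linarith
  have hphase := continuous_phase (d := d) y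
  calc _ ≤ ∫ θ, ∏ i, Real.exp (-(t * c) * (1 - Real.cos (θ i))) ∂(torusMeasure d) := by
        refine integral_mono ?_ ?_ hle
        · exact ((integrable_const (1 : ℝ)).mono' (Continuous.aestronglyMeasurable (by fun_prop))
            (.of_forall fun θ => by rw [norm_norm]; exact (hle θ).trans (hone θ)))
        · exact ((integrable_const (1 : ℝ)).mono' (Continuous.aestronglyMeasurable (by fun_prop))
            (.of_forall fun θ => by
              rw [Real.norm_of_nonneg (Finset.prod_nonneg fun i _ => (Real.exp_pos _).le)]
              exact hone θ))
    _ = (∫ x, Real.exp (-(t * c) * (1 - Real.cos x)) ∂angleMeasure) ^ d := by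
        rw [torusMeasure, integral_fintype_prod_eq_pow
          (fun x => Real.exp (-(t * c) * (1 - Real.cos x))), Fintype.card_fin]
    _ ≤ (1 / √(t * c)) ^ d := by
        exact pow_le_pow_left₀ (integral_nonneg fun x => Real.exp_nonneg _)
          (integral_exp_one_sub_cos_le (by positivity)) d
    _ = _ := by
        rw [← mul_pow, Real.sqrt_mul ht.le]
        congr 1
        field_simp

end

/-! ### The Poisson product measure. -/

section

variable {d : ℕ}

instance isProbabilityMeasure_nu (ρ : ℝ≥0) : IsProbabilityMeasure (nu d ρ) := by
  unfold nu; infer_instance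

theorem hasSum_poisson_pow (ρ : ℝ≥0) (z : ℝ) :
    HasSum (fun n : ℕ => Real.exp (-ρ) * ρ ^ n / (n.factorial : ℝ) * z ^ n)
      (Real.exp (ρ * (z - 1))) := by
  have h := (hasSum_pow_div_factorial (ρ * z)).mul_left (Real.exp (-ρ))
  rw [← Real.exp_add] at h
  have e1 : Real.exp (ρ * (z - 1)) = Real.exp (-ρ + ρ * z) := by ring_nf
  rw [e1]
  refine h.congr_fun fun n => ?_
  rw [mul_pow]
  ring

theorem integrable_poisson_pow (ρ : ℝ≥0) (z : ℝ) :
    Integrable (fun n : ℕ => z ^ n) (poissonMeasure ρ) := by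
  rw [integrable_poissonMeasure_iff]
  simp_rw [norm_pow]
  exact (hasSum_poisson_pow ρ ‖z‖).summable

theorem integral_poisson_pow (ρ : ℝ≥0) (z : ℝ) :
    ∫ n : ℕ, z ^ n ∂(poissonMeasure ρ) = Real.exp (ρ * (z - 1)) := by
  rw [integral_poissonMeasure]
  exact (hasSum_poisson_pow ρ z).tsum_eq

theorem measurable_prod_eval (F : Finset (Site d)) (h : Site d → ℕ → ℝ) :
    Measurable fun η : Config d => ∏ x ∈ F, h x (η x) := by
  have : ∀ x, Measurable (h x) := fun x => measurable_of_countable _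
  fun_prop

theorem map_restrict_nu (ρ : ℝ≥0) (F : Finset (Site d)) :
    (nu d ρ).map F.restrict = Measure.pi fun _ : F => poissonMeasure ρ :=
  Measure.infinitePi_map_restrict _

theorem prod_eval_eq_comp_restrict (F : Finset (Site d)) (h : Site d → ℕ → ℝ) :
    (fun η : Config d => ∏ x ∈ F, h x (η x)) =
      (fun y : F → ℕ => ∏ x : F, h x (y x)) ∘ F.restrict := by
  ext η
  simp only [Function.comp_apply, Finset.restrict]
  rw [← Finset.prod_coe_sort F fun x => h x (η x)]

theorem integral_prod_eval (ρ : ℝ≥0) (F : Finset (Site d)) (h : Site d → ℕ → ℝ) :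
    ∫ η, ∏ x ∈ F, h x (η x) ∂(nu d ρ) = ∏ x ∈ F, ∫ n, h x n ∂(poissonMeasure ρ) := by
  have hm : Measurable fun y : F → ℕ => ∏ x : F, h x (y x) := measurable_of_countable _
  rw [prod_eval_eq_comp_restrict F h]
  have h1 := integral_map (μ := nu d ρ) (φ := F.restrict)
    (f := fun y : F → ℕ => ∏ x : F, h x (y x))
    (Finset.measurable_restrict F).aemeasurable hm.aestronglyMeasurable
  refine h1.symm.trans ?_
  rw [map_restrict_nu, integral_fintype_prod_eq_prod (fun (x : F) => h x), ← Finset.prod_coe_sort F]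

theorem integrable_prod_eval (ρ : ℝ≥0) (F : Finset (Site d)) {h : Site d → ℕ → ℝ}
    (hh : ∀ x, Integrable (h x) (poissonMeasure ρ)) :
    Integrable (fun η : Config d => ∏ x ∈ F, h x (η x)) (nu d ρ) := by
  have hm : Measurable fun y : F → ℕ => ∏ x : F, h x (y x) := measurable_of_countable _
  rw [prod_eval_eq_comp_restrict F h]
  rw [← integrable_map_measure hm.aestronglyMeasurable
    (Finset.measurable_restrict F).aemeasurable, map_restrict_nu]
  exact Integrable.fintype_prod_dep fun x : F => hh x

/-- Poisson variables have all exponential moments. These products serve as the dominating functions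
throughout. -/
theorem memLp_prod_pow (ρ : ℝ≥0) (F : Finset (Site d)) (c : ℝ) :
    MemLp (fun η : Config d => ∏ x ∈ F, c ^ η x) 2 (nu d ρ) := by
  rw [memLp_two_iff_integrable_sq (measurable_prod_eval F fun _ n => c ^ n).aestronglyMeasurable]
  refine (integrable_prod_eval ρ F (h := fun _ n => (c ^ 2) ^ n)
    fun _ => integrable_poisson_pow ρ _).congr (.of_forall fun η => ?_)
  simp only [← Finset.prod_pow, ← pow_mul, mul_comm 2]

theorem measurable_dual (ρ : ℝ≥0) (ξ : FinConfig d) : Measurable (dual ρ ξ) :=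
  measurable_prod_eval ξ.support fun x n => charlier ρ (ξ x) n

theorem dual_eq_prod (ρ : ℝ≥0) {ξ : FinConfig d} {F : Finset (Site d)} (h : ξ.support ⊆ F)
    (η : Config d) : dual ρ ξ η = ∏ x ∈ F, charlier ρ (ξ x) (η x) :=
  Finsupp.prod_of_support_subset _ h _ fun x _ => by simp [charlier]

theorem memLp_dual {ρ : ℝ≥0} (hρ : 0 < ρ) (ξ : FinConfig d) : MemLp (dual ρ ξ) 2 (nu d ρ) := by
  refine ((memLp_prod_pow ρ ξ.support 2).const_mul
    (∏ x ∈ ξ.support, ((ξ x).factorial / (ρ : ℝ) ^ ξ x * Real.exp ρ))).of_le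
    (measurable_dual ρ ξ).aestronglyMeasurable (.of_forall fun η => ?_)
  rw [← Finset.prod_mul_distrib, dual_eq_prod ρ subset_rfl, norm_prod, norm_prod]
  refine Finset.prod_le_prod (fun _ _ => norm_nonneg _) fun x _ => ?_
  exact (abs_charlier_le hρ _ _).trans (le_abs_self _)

theorem measurable_shift (x : Site d) : Measurable (shift (d := d) x) := by
  unfold shift; fun_prop

theorem measurePreserving_shift (ρ : ℝ≥0) (x : Site d) :
    MeasurePreserving (shift x) (nu d ρ) (nu d ρ) :=
  ⟨measurable_shift x, Measure.map_infinitePi_infinitePi_of_inj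
    (P := fun _ : Site d => poissonMeasure ρ) (f := fun y => y + x) (add_left_injective x)⟩

theorem dual_shift (ρ : ℝ≥0) (ξ : FinConfig d) (x : Site d) (η : Config d) :
    dual ρ ξ (shift x η) = dual ρ (translate x ξ) η := by
  rw [dual, dual, prod_translate]
  rfl

/-! ### Completeness of the duality polynomials -/

/-- The expansion of the Charlier polynomials in falling factorials is triangular, with nonzero
diagonal entries (-1/ρ)^k, hence invertible. -/
theorem descFactorial_mem_span_charlier {ρ : ℝ≥0} (hρ : 0 < ρ) (k : ℕ) :
    (fun n : ℕ => (n.descFactorial k : ℝ)) ∈ Submodule.span ℝ (Set.range (charlier ρ)) := by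
  have hρ' : (ρ : ℝ) ≠ 0 := by exact_mod_cast hρ.ne'
  induction k using Nat.strong_induction_on with
  | _ k ih =>
    have e : (fun n : ℕ => (n.descFactorial k : ℝ)) = ((-(ρ : ℝ)) ^ k) • (charlier ρ k -
        ∑ j ∈ Finset.range k, ((k.choose j : ℝ) * (-(1 / (ρ : ℝ))) ^ j) •
          fun n : ℕ => (n.descFactorial j : ℝ)) := by
      ext n
      simp only [Pi.smul_apply, Pi.sub_apply, Finset.sum_apply, smul_eq_mul, charlier,
        Finset.sum_range_succ, add_sub_cancel_left, Nat.choose_self, Nat.cast_one, one_mul,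
        ← mul_assoc, ← mul_pow]
      have : -(ρ : ℝ) * -(1 / ρ) = 1 := by field_simp
      rw [this, one_pow, one_mul]
    rw [e]
    refine Submodule.smul_mem _ _ (Submodule.sub_mem _ (Submodule.subset_span ⟨k, rfl⟩)
      (Submodule.sum_mem _ fun j hj => Submodule.smul_mem _ _ (ih j (Finset.mem_range.1 hj))))

/-- Polynomials which approximate the indicator function of `{m}`. -/
def indicatorApprox (J m n : ℕ) : ℝ :=
  ∑ j ∈ Finset.range J, ((-1) ^ (j + m) * (j.choose m : ℝ)) * (n.choose j : ℝ)

theorem indicatorApprox_mem_span {ρ : ℝ≥0} (hρ : 0 < ρ) (J m : ℕ) :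
    indicatorApprox J m ∈ Submodule.span ℝ (Set.range (charlier ρ)) := by
  have e : indicatorApprox J m = ∑ j ∈ Finset.range J,
      ((-1) ^ (j + m) * (j.choose m : ℝ) / (j.factorial : ℝ)) •
        fun n : ℕ => (n.descFactorial j : ℝ) := by
    ext n
    simp only [indicatorApprox, Finset.sum_apply, Pi.smul_apply, smul_eq_mul]
    refine Finset.sum_congr rfl fun j _ => ?_
    rw [Nat.descFactorial_eq_factorial_mul_choose]
    push_cast
    field_simp
  rw [e]
  exact Submodule.sum_mem _ fun j _ =>
    Submodule.smul_mem _ _ (descFactorial_mem_span_charlier hρ j)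

/-- Inclusion-exclusion: binomials (n choose j) with j > n vanish, so truncation at J > n loses
nothing. Then (j choose m)(n choose j) = (n choose m)(n-m choose j-m) leaves an alternating binomial
sum. -/
theorem indicatorApprox_eq {J m n : ℕ} (h : n < J) :
    indicatorApprox J m n = if n = m then 1 else 0 := by
  have h1 : indicatorApprox J m n = ∑ j ∈ Finset.range (n + 1),
      ((-1) ^ (j + m) * (j.choose m : ℝ)) * (n.choose j : ℝ) := by
    refine (Finset.sum_subset (Finset.range_subset_range.2 h) fun j _ hj => ?_).symm
    rw [Nat.choose_eq_zero_of_lt (show n < j by simpa using hj)]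
    simp
  rw [h1]
  rcases lt_or_ge n m with hnm | hmn
  · rw [if_neg hnm.ne]
    refine Finset.sum_eq_zero fun j hj => ?_
    have : j < m := lt_of_lt_of_le (Finset.mem_range.1 hj) hnm
    rw [Nat.choose_eq_zero_of_lt this]
    simp
  · obtain ⟨r, rfl⟩ := Nat.exists_eq_add_of_le hmn
    rw [show m + r + 1 = m + (r + 1) by ring, Finset.sum_range_add, Finset.sum_eq_zero, zero_add]
    · have h2 : ∀ i ∈ Finset.range (r + 1), ((-1 : ℝ) ^ (m + i + m) * ((m + i).choose m : ℝ)) *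
          ((m + r).choose (m + i) : ℝ) = ((m + r).choose m : ℝ) * ((-1) ^ i * (r.choose i : ℝ)) := by
        intro i hi
        have := Nat.choose_mul (n := m + r) (k := m + i) (s := m) (Nat.le_add_right m i)
        rw [Nat.add_sub_cancel_left, Nat.add_sub_cancel_left] at this
        have h3 : ((m + r).choose (m + i) : ℝ) * ((m + i).choose m : ℝ) =
            ((m + r).choose m : ℝ) * (r.choose i : ℝ) := by exact_mod_cast this
        have h4 : (-1 : ℝ) ^ (m + i + m) = (-1) ^ i := by
          rw [show m + i + m = i + 2 * m by ring, pow_add, pow_mul]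
          simp
        rw [h4]
        linear_combination (-1 : ℝ) ^ i * h3
      rw [Finset.sum_congr rfl h2, ← Finset.mul_sum]
      have h5 := Int.alternating_sum_range_choose (n := r)
      have h6 : ∑ i ∈ Finset.range (r + 1), ((-1 : ℝ) ^ i * (r.choose i : ℝ)) =
          if r = 0 then 1 else 0 := by exact_mod_cast h5
      rw [h6]
      by_cases hr : r = 0 <;> simp [hr]
    · intro j hj
      rw [Nat.choose_eq_zero_of_lt (Finset.mem_range.1 hj)]
      simp

/-- From (j choose m) ≤ 2^j and Σ_j 2^j (n choose j) = 3^n. Uniformity in J is what dominated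
convergence needs. -/
theorem abs_indicatorApprox_le (J m n : ℕ) : |indicatorApprox J m n| ≤ 3 ^ n := by
  have h := hasSum_choose_mul_pow n 2
  rw [show (1 : ℝ) + 2 = 3 by norm_num] at h
  refine (Finset.abs_sum_le_sum_abs _ _).trans
    ((Finset.sum_le_sum fun j _ => ?_).trans (h.summable.sum_le_tsum (Finset.range J)
      fun j _ => by positivity) |>.trans_eq h.tsum_eq)
  rw [abs_mul, abs_mul, abs_pow, abs_neg, abs_one, one_pow, one_mul, Nat.abs_cast, Nat.abs_cast,
    mul_comm]
  gcongr
  exact_mod_cast Nat.choose_le_two_pow j m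

/-- Sites are added one at a time. By linearity the new factor may be taken to be a Charlier
polynomial, and since ξ is empty at that site, multiplying by it places particles there. -/
theorem dual_mul_prod_mem_span {ρ : ℝ≥0} (F : Finset (Site d)) (q : Site d → ℕ → ℝ)
    (hq : ∀ x, q x ∈ Submodule.span ℝ (Set.range (charlier ρ))) (ξ : FinConfig d)
    (hξ : ∀ x ∈ F, ξ x = 0) :
    (fun η => dual ρ ξ η * ∏ x ∈ F, q x (η x)) ∈ Submodule.span ℝ (Set.range (dual (d := d) ρ)) := by
  classical
  induction F using Finset.induction_on generalizing ξ with
  | empty =>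
    simp only [Finset.prod_empty, mul_one]
    exact Submodule.subset_span ⟨ξ, rfl⟩
  | insert a F ha ih =>
    let Λ : (ℕ → ℝ) →ₗ[ℝ] (Config d → ℝ) :=
      { toFun := fun r η => dual ρ ξ η * (r (η a) * ∏ x ∈ F, q x (η x))
        map_add' := fun r s => by ext η; simp; ring
        map_smul' := fun c r => by ext η; simp; ring }
    have key : ∀ r ∈ Submodule.span ℝ (Set.range (charlier ρ)),
        Λ r ∈ Submodule.span ℝ (Set.range (dual (d := d) ρ)) := by
      intro r hr
      induction hr using Submodule.span_induction with
      | mem r hr =>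
        obtain ⟨k, rfl⟩ := hr
        have hξa : ξ a = 0 := hξ a (Finset.mem_insert_self a F)
        have h1 : ∀ η, dual ρ (ξ + Finsupp.single a k) η = dual ρ ξ η * charlier ρ k (η a) := by
          intro η
          have hs : (ξ + Finsupp.single a k).support ⊆ insert a ξ.support := by
            intro x hx
            by_contra hx'
            simp only [Finset.mem_insert, Finsupp.mem_support_iff, not_or, not_not] at hx'
            simp [hx'.2, Ne.symm hx'.1] at hx
          rw [dual_eq_prod ρ hs, dual_eq_prod ρ (Finset.Subset.refl _),
            Finset.prod_insert (by simp [hξa]), mul_comm]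
          congr 1
          · refine Finset.prod_congr rfl fun x hx => ?_
            have : a ≠ x := by
              rintro rfl
              exact Finsupp.mem_support_iff.1 hx hξa
            simp [this]
          · simp [hξa]
        have h2 := ih (ξ + Finsupp.single a k) fun x hx => by
          have hax : a ≠ x := fun h => ha (h ▸ hx)
          simp [hξ x (Finset.mem_insert_of_mem hx), hax]
        convert h2 using 1
        ext η
        simp only [Λ, LinearMap.coe_mk, AddHom.coe_mk, h1]
        ring
      | zero => simp
      | add r s _ _ hr hs => rw [map_add]; exact Submodule.add_mem _ hr hs
      | smul c r _ hr => rw [map_smul]; exact Submodule.smul_mem _ _ hr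
    convert key (q a) (hq a) using 1
    ext η
    simp [Λ, Finset.prod_insert ha]

/-- A function orthogonal to all duality polynomials is orthogonal to products of the polynomials
`indicatorApprox`. At each η these are eventually equal to the cylinder indicator, and |h| ∏ 3^{η_x}
dominates. -/
theorem setIntegral_cylinder_eq_zero {ρ : ℝ≥0} (hρ : 0 < ρ) {h : Config d → ℝ}
    (hh : MemLp h 2 (nu d ρ)) (h0 : ∀ ξ, ∫ η, h η * dual ρ ξ η ∂(nu d ρ) = 0)
    (F : Finset (Site d)) (m : Config d) :
    ∫ η in {η | ∀ x ∈ F, η x = m x}, h η ∂(nu d ρ) = 0 := by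
  have hspan : ∀ G ∈ Submodule.span ℝ (Set.range (dual (d := d) ρ)),
      MemLp G 2 (nu d ρ) ∧ ∫ η, h η * G η ∂(nu d ρ) = 0 := by
    intro G hG
    induction hG using Submodule.span_induction with
    | mem G hG =>
      obtain ⟨ξ, rfl⟩ := hG
      exact ⟨memLp_dual hρ ξ, h0 ξ⟩
    | zero => exact ⟨MemLp.zero, by simp⟩
    | add G G' _ _ hG hG' =>
      refine ⟨hG.1.add hG'.1, ?_⟩
      simp only [Pi.add_apply, mul_add]
      have h1 : Integrable (fun η => h η * G η) (nu d ρ) := hh.integrable_mul hG.1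
      have h2 : Integrable (fun η => h η * G' η) (nu d ρ) := hh.integrable_mul hG'.1
      rw [integral_add h1 h2, hG.2, hG'.2, add_zero]
    | smul c G _ hG =>
      refine ⟨hG.1.const_smul c, ?_⟩
      simp only [Pi.smul_apply, smul_eq_mul, mul_left_comm _ c]
      rw [integral_const_mul, hG.2, mul_zero]
  have hJ : ∀ J, ∫ η, h η * ∏ x ∈ F, indicatorApprox J (m x) (η x) ∂(nu d ρ) = 0 := by
    intro J
    have := dual_mul_prod_mem_span F (fun x => indicatorApprox J (m x))
      (fun x => indicatorApprox_mem_span hρ J (m x)) 0 (by simp)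
    simpa [dual] using (hspan _ this).2
  have hmeas : MeasurableSet {η : Config d | ∀ x ∈ F, η x = m x} := by
    have : {η : Config d | ∀ x ∈ F, η x = m x} = ⋂ x ∈ F, (fun η => η x) ⁻¹' {m x} := by
      ext η; simp
    rw [this]
    exact Finset.measurableSet_biInter _ fun x _ => measurable_pi_apply x (measurableSet_singleton _)
  rw [← integral_indicator hmeas]
  have hlim : Tendsto (fun J => ∫ η, h η * ∏ x ∈ F, indicatorApprox J (m x) (η x) ∂(nu d ρ)) atTop
      (nhds (∫ η, {η : Config d | ∀ x ∈ F, η x = m x}.indicator h η ∂(nu d ρ))) := by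
    refine tendsto_integral_of_dominated_convergence (fun η => |h η * ∏ x ∈ F, 3 ^ η x|)
      (fun J => hh.1.mul (measurable_prod_eval F
        fun x => indicatorApprox J (m x)).aestronglyMeasurable)
      (hh.integrable_mul (memLp_prod_pow ρ F 3)).abs (fun J => .of_forall fun η => ?_)
      (.of_forall fun η => ?_)
    · rw [norm_mul, abs_mul, norm_prod, Finset.abs_prod]
      refine mul_le_mul_of_nonneg_left (Finset.prod_le_prod (fun _ _ => norm_nonneg _) fun x _ => ?_)
        (norm_nonneg _)
      exact (abs_indicatorApprox_le _ _ _).trans (le_abs_self _)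
    · refine tendsto_const_nhds.congr' ?_
      filter_upwards [eventually_gt_atTop (∑ x ∈ F, η x)] with J hJ
      have : ∀ x ∈ F, indicatorApprox J (m x) (η x) = if η x = m x then 1 else 0 := fun x hx =>
        indicatorApprox_eq ((Finset.single_le_sum (fun _ _ => Nat.zero_le _) hx).trans_lt hJ)
      rw [Finset.prod_congr rfl this, Finset.prod_ite_zero]
      simp [Set.indicator_apply]
  simp_rw [hJ] at hlim
  exact tendsto_nhds_unique hlim tendsto_const_nhds

theorem measurableSpace_eq_generateFrom_cylinders :
    (inferInstance : MeasurableSpace (Config d)) = MeasurableSpace.generateFrom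
      {s | ∃ (F : Finset (Site d)) (m : Config d), s = {η | ∀ x ∈ F, η x = m x}} := by
  apply le_antisymm
  · refine iSup_le fun x => ?_
    rw [← measurable_iff_comap_le]
    refine @measurable_to_countable' ℕ (Config d) _ _ (MeasurableSpace.generateFrom
      {s | ∃ (F : Finset (Site d)) (m : Config d), s = {η | ∀ x ∈ F, η x = m x}}) _ fun n => ?_
    exact MeasurableSpace.measurableSet_generateFrom ⟨{x}, fun _ => n, by ext η; simp⟩
  · refine MeasurableSpace.generateFrom_le ?_
    rintro _ ⟨F, m, rfl⟩
    have : {η : Config d | ∀ x ∈ F, η x = m x} = ⋂ x ∈ F, (fun η => η x) ⁻¹' {m x} := by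
      ext η; simp
    rw [this]
    exact Finset.measurableSet_biInter _ fun x _ => measurable_pi_apply x (measurableSet_singleton _)

theorem isPiSystem_cylinders : IsPiSystem
    {s : Set (Config d) | ∃ (F : Finset (Site d)) (m : Config d), s = {η | ∀ x ∈ F, η x = m x}} := by
  classical
  rintro _ ⟨F, m, rfl⟩ _ ⟨G, m', rfl⟩ ⟨η, h1, h2⟩
  refine ⟨F ∪ G, η, ?_⟩
  ext ζ
  simp only [Set.mem_inter_iff, Set.mem_ofPred_eq, Finset.mem_union] at *
  constructor
  · rintro ⟨h3, h4⟩ x (hx | hx)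
    · rw [h3 x hx, h1 x hx]
    · rw [h4 x hx, h2 x hx]
  · intro h3
    exact ⟨fun x hx => by rw [h3 x (.inl hx), h1 x hx], fun x hx => by rw [h3 x (.inr hx), h2 x hx]⟩

/-- The duality polynomials are total in `L²(ν_ρ)`. -/
theorem ae_eq_zero_of_integral_mul_dual_eq_zero {ρ : ℝ≥0} (hρ : 0 < ρ) {h : Config d → ℝ}
    (hh : MemLp h 2 (nu d ρ)) (h0 : ∀ ξ, ∫ η, h η * dual ρ ξ η ∂(nu d ρ) = 0) :
    h =ᵐ[nu d ρ] 0 := by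
  have hint : Integrable h (nu d ρ) := hh.integrable (by norm_num)
  have huniv : ∫ η, h η ∂(nu d ρ) = 0 := by simpa [dual] using h0 0
  refine ae_eq_zero_of_forall_setIntegral_eq_of_sigmaFinite (fun s _ _ => hint.integrableOn)
    fun s hs _ => ?_
  refine MeasurableSpace.induction_on_inter
    (C := fun s _ => ∫ η in s, h η ∂(nu d ρ) = 0) measurableSpace_eq_generateFrom_cylinders
    isPiSystem_cylinders (by simp) ?_ ?_ ?_ s hs
  · rintro _ ⟨F, m, rfl⟩
    exact setIntegral_cylinder_eq_zero hρ hh h0 F m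
  · intro t ht h1
    rw [setIntegral_compl ht hint, huniv, h1, sub_zero]
  · intro f hdis hf h1
    rw [integral_iUnion hf hdis hint.integrableOn]
    simp [h1]

end

section

variable {d : ℕ} {Ω : Type*} [MeasurableSpace Ω] {P : Measure Ω}
  {p : Site d → Site d → ℝ} {ρ : ℝ≥0}

/-! ### A single walk -/

theorem hasSum_measureReal_eq [IsProbabilityMeasure P] {X : Ω → Site d} (hX : Measurable X) :
    HasSum (fun z => P.real {ω | X ω = z}) 1 := by
  have h : ∑' z, P {ω | X ω = z} = 1 := by
    have := tsum_measure_preimage_singleton (μ := P) (s := (Set.univ : Set (Site d)))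
      Set.countable_univ (f := X) fun z _ => hX (measurableSet_singleton z)
    rw [tsum_univ (fun b => P (X ⁻¹' {b}))] at this
    simpa [Set.preimage] using this
  have h2 := ENNReal.hasSum_toReal (f := fun z => P {ω | X ω = z}) (by rw [h]; simp)
  rw [← ENNReal.tsum_toReal_eq (fun z => measure_ne_top _ _), h] at h2
  simpa [measureReal_def] using h2

theorem IsWalk.measureReal_sub_eq {S : ℝ≥0 → Ω → Site d} (hS : IsWalk P p S) (t : ℝ≥0)
    (z : Site d) : P.real {ω | S t ω = z} = walkProb p t 0 z := by
  have h := hS.increment_law 0 t zero_le z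
  rw [NNReal.coe_zero, sub_zero] at h
  rw [← h]
  refine measureReal_congr ?_
  filter_upwards [hS.start] with ω hω
  change (S t ω = z) = (S t ω - S 0 ω = z)
  rw [hω, sub_zero]

theorem IsWalk.hasSum_walkProb [IsProbabilityMeasure P] {S : ℝ≥0 → Ω → Site d}
    (hS : IsWalk P p S) (t : ℝ≥0) : HasSum (fun z => walkProb p t 0 z) 1 := by
  simpa only [← hS.measureReal_sub_eq] using hasSum_measureReal_eq (hS.measurable t)

theorem IsWalk.walkProb_nonneg {S : ℝ≥0 → Ω → Site d} (hS : IsWalk P p S) (t : ℝ≥0)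
    (z : Site d) : 0 ≤ walkProb p t 0 z := by
  rw [← hS.measureReal_sub_eq]
  exact measureReal_nonneg

theorem IsWalk.measureReal_pair [IsProbabilityMeasure P] {S : ℝ≥0 → Ω → Site d}
    (hS : IsWalk P p S) {s t : ℝ≥0} (hst : s ≤ t) (y x z : Site d) :
    P.real {ω | y + S s ω = x ∧ y + S t ω = z} =
      walkProb p s 0 (x - y) * walkProb p ((t : ℝ) - s) 0 (z - x) := by
  have hind := hS.indep_increments.indepFun_eval_sub zero_le hst hS.start
  have h := hind.measure_inter_preimage_eq_mul {x - y} {z - x} (measurableSet_singleton _)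
    (measurableSet_singleton _)
  have e : {ω | y + S s ω = x ∧ y + S t ω = z} =
      S s ⁻¹' {x - y} ∩ (S t - S s) ⁻¹' {z - x} := by
    ext ω
    simp only [Set.mem_ofPred_eq, Set.mem_inter_iff, Set.mem_preimage, Set.mem_singleton_iff,
      Pi.sub_apply]
    constructor
    · rintro ⟨rfl, rfl⟩
      exact ⟨by abel, by abel⟩
    · rintro ⟨h1, h2⟩
      rw [h1] at h2
      refine ⟨by rw [h1]; abel, ?_⟩
      rw [sub_eq_iff_eq_add.1 h2]
      abel
  rw [e, measureReal_def, h, ENNReal.toReal_mul, ← measureReal_def, ← measureReal_def]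
  congr 1
  · exact hS.measureReal_sub_eq s _
  · exact hS.increment_law s t hst _

theorem integral_one_sub_mul_one_sub [IsProbabilityMeasure P] {X Y : Ω → Site d}
    (hX : Measurable X) (hY : Measurable Y) {F : Finset (Site d)} {u v : Site d → ℝ}
    (hu : ∀ x ∉ F, u x = 0) (hv : ∀ x ∉ F, v x = 0) :
    ∫ ω, (1 - u (X ω)) * (1 - v (Y ω)) ∂P =
      1 - ∑ x ∈ F, u x * P.real {ω | X ω = x} - ∑ z ∈ F, v z * P.real {ω | Y ω = z} +
        ∑ x ∈ F, ∑ z ∈ F, u x * v z * P.real {ω | X ω = x ∧ Y ω = z} := by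
  have hmX : ∀ x, MeasurableSet {ω | X ω = x} := fun x => hX (measurableSet_singleton x)
  have hmY : ∀ x, MeasurableSet {ω | Y ω = x} := fun x => hY (measurableSet_singleton x)
  have hmXY : ∀ x z, MeasurableSet {ω | X ω = x ∧ Y ω = z} := fun x z => (hmX x).inter (hmY z)
  have hexp : ∀ (w : Site d → ℝ), (∀ x ∉ F, w x = 0) → ∀ y : Site d,
      w y = ∑ x ∈ F, if y = x then w x else 0 := by
    intro w hw y
    rw [Finset.sum_ite_eq]
    split_ifs with h
    · rfl
    · exact hw y h
  have hpt : ∀ ω, (1 - u (X ω)) * (1 - v (Y ω)) =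
      1 - ∑ x ∈ F, u x * {ω | X ω = x}.indicator (fun _ => (1 : ℝ)) ω -
        ∑ z ∈ F, v z * {ω | Y ω = z}.indicator (fun _ => (1 : ℝ)) ω +
        ∑ x ∈ F, ∑ z ∈ F, u x * v z *
          {ω | X ω = x ∧ Y ω = z}.indicator (fun _ => (1 : ℝ)) ω := by
    intro ω
    have e1 : ∑ x ∈ F, u x * {ω | X ω = x}.indicator (fun _ => (1 : ℝ)) ω = u (X ω) := by
      rw [hexp u hu (X ω)]
      refine Finset.sum_congr rfl fun x _ => ?_
      simp [Set.indicator_apply]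
    have e2 : ∑ x ∈ F, v x * {ω | Y ω = x}.indicator (fun _ => (1 : ℝ)) ω = v (Y ω) := by
      rw [hexp v hv (Y ω)]
      refine Finset.sum_congr rfl fun x _ => ?_
      simp [Set.indicator_apply]
    have e3 : ∑ x ∈ F, ∑ z ∈ F, u x * v z *
          {ω | X ω = x ∧ Y ω = z}.indicator (fun _ => (1 : ℝ)) ω = u (X ω) * v (Y ω) := by
      rw [← e1, ← e2, Finset.sum_mul_sum]
      refine Finset.sum_congr rfl fun x _ => Finset.sum_congr rfl fun z _ => ?_
      by_cases h1 : X ω = x <;> by_cases h2 : Y ω = z <;> simp [h1, h2]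
    rw [e1, e2, e3]
    ring
  have hi : ∀ (s : Set Ω), MeasurableSet s → Integrable (s.indicator fun _ => (1 : ℝ)) P :=
    fun s hs => (integrable_const 1).indicator hs
  have hI : ∀ (s : Set Ω), MeasurableSet s → ∫ ω, s.indicator (fun _ => (1 : ℝ)) ω ∂P = P.real s :=
    fun s hs => by rw [integral_indicator_const _ hs, smul_eq_mul, mul_one]
  simp_rw [hpt]
  have i1 : Integrable (fun ω => ∑ x ∈ F, u x * {ω | X ω = x}.indicator (fun _ => (1 : ℝ)) ω) P :=
    integrable_finsetSum _ fun x _ => (hi _ (hmX x)).const_mul _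
  have i2 : Integrable (fun ω => ∑ x ∈ F, v x * {ω | Y ω = x}.indicator (fun _ => (1 : ℝ)) ω) P :=
    integrable_finsetSum _ fun x _ => (hi _ (hmY x)).const_mul _
  have i3 : Integrable (fun ω => ∑ x ∈ F, ∑ z ∈ F, u x * v z *
      {ω | X ω = x ∧ Y ω = z}.indicator (fun _ => (1 : ℝ)) ω) P :=
    integrable_finsetSum _ fun x _ => integrable_finsetSum _ fun z _ =>
      (hi _ (hmXY x z)).const_mul _
  have i4 : Integrable (fun ω => 1 -
      ∑ x ∈ F, u x * {ω | X ω = x}.indicator (fun _ => (1 : ℝ)) ω) P := (integrable_const 1).sub i1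
  have i5 : Integrable (fun ω => 1 -
      ∑ x ∈ F, u x * {ω | X ω = x}.indicator (fun _ => (1 : ℝ)) ω -
      ∑ x ∈ F, v x * {ω | Y ω = x}.indicator (fun _ => (1 : ℝ)) ω) P := i4.sub i2
  rw [integral_add i5 i3, integral_sub i4 i2, integral_sub (integrable_const 1) i1,
    integral_finsetSum _ fun x _ => (hi _ (hmX x)).const_mul _,
    integral_finsetSum _ fun x _ => (hi _ (hmY x)).const_mul _,
    integral_finsetSum _ fun x _ => integrable_finsetSum _ fun z _ => (hi _ (hmXY x z)).const_mul _]
  congr 1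
  · congr 1
    · congr 1
      · simp
      · refine Finset.sum_congr rfl fun x _ => ?_
        rw [integral_const_mul, hI _ (hmX x)]
    · refine Finset.sum_congr rfl fun x _ => ?_
      rw [integral_const_mul, hI _ (hmY x)]
  · refine Finset.sum_congr rfl fun x _ => ?_
    rw [integral_finsetSum _ fun z _ => (hi _ (hmXY x z)).const_mul _]
    refine Finset.sum_congr rfl fun z _ => ?_
    rw [integral_const_mul, hI _ (hmXY x z)]

/-- The expectation of `(1 - u) (1 - v)` evaluated at the positions at times `s` and `t` of a walk
which starts at `y`. -/
def walkPgf (p : Site d → Site d → ℝ) (s t : ℝ≥0) (F : Finset (Site d)) (u v : Site d → ℝ)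
    (y : Site d) : ℝ :=
  1 - ∑ x ∈ F, u x * walkProb p s 0 (x - y) - ∑ z ∈ F, v z * walkProb p t 0 (z - y) +
    ∑ x ∈ F, ∑ z ∈ F, u x * v z *
      (walkProb p s 0 (x - y) * walkProb p ((t : ℝ) - s) 0 (z - x))

theorem IsWalk.integral_eq_walkPgf [IsProbabilityMeasure P] {S : ℝ≥0 → Ω → Site d}
    (hS : IsWalk P p S) {s t : ℝ≥0} (hst : s ≤ t) {F : Finset (Site d)} {u v : Site d → ℝ}
    (hu : ∀ x ∉ F, u x = 0) (hv : ∀ x ∉ F, v x = 0) (y : Site d) :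
    ∫ ω, (1 - u (y + S s ω)) * (1 - v (y + S t ω)) ∂P = walkPgf p s t F u v y := by
  have h1 : ∀ r x, P.real {ω | y + S r ω = x} = walkProb p r 0 (x - y) := fun r x => by
    rw [← hS.measureReal_sub_eq]
    congr 1
    ext ω
    exact eq_sub_iff_add_eq'.symm
  rw [integral_one_sub_mul_one_sub ((hS.measurable s).const_add y) ((hS.measurable t).const_add y)
    hu hv]
  simp_rw [h1, hS.measureReal_pair hst]
  rfl

/-- Summing over starting points replaces the transition probabilities from the start by 1, as
counting measure is invariant. Only the transition from time s to time t survives: this is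
stationarity. -/
theorem IsWalk.hasSum_walkPgf_sub_one [IsProbabilityMeasure P] {S : ℝ≥0 → Ω → Site d}
    (hS : IsWalk P p S) (s t : ℝ≥0) (F : Finset (Site d)) (u v : Site d → ℝ) :
    HasSum (fun y => walkPgf p s t F u v y - 1)
      (-∑ x ∈ F, u x - ∑ z ∈ F, v z +
        ∑ x ∈ F, ∑ z ∈ F, u x * v z * walkProb p ((t : ℝ) - s) 0 (z - x)) := by
  have h : ∀ (r : ℝ≥0) (x : Site d), HasSum (fun y => walkProb p r 0 (x - y)) 1 := fun r x =>
    (Equiv.subLeft x).hasSum_iff.2 (hS.hasSum_walkProb r)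
  have h1 : HasSum (fun y => ∑ x ∈ F, u x * walkProb p s 0 (x - y)) (∑ x ∈ F, u x) :=
    hasSum_sum fun x _ => by simpa using (h s x).mul_left (u x)
  have h2 : HasSum (fun y => ∑ x ∈ F, v x * walkProb p t 0 (x - y)) (∑ x ∈ F, v x) :=
    hasSum_sum fun x _ => by simpa using (h t x).mul_left (v x)
  have h3 : HasSum (fun y => ∑ x ∈ F, ∑ z ∈ F, u x * v z *
      (walkProb p s 0 (x - y) * walkProb p ((t : ℝ) - s) 0 (z - x)))
      (∑ x ∈ F, ∑ z ∈ F, u x * v z * walkProb p ((t : ℝ) - s) 0 (z - x)) := by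
    refine hasSum_sum fun x _ => hasSum_sum fun z _ => ?_
    have e := (h s x).mul_right (u x * v z * walkProb p ((t : ℝ) - s) 0 (z - x))
    rw [one_mul] at e
    exact e.congr_fun fun y => by ring
  refine ((h1.neg.sub h2).add h3).congr_fun fun y => ?_
  rw [walkPgf]
  ring

/-! ### Systems of walks -/

/-- The number of particles of `η` which a family of positions puts at `x`. -/
theorem eventually_prod_one_sub_eq (η : Config d) (pos : Site d × ℕ → Site d)
    {F : Finset (Site d)} (hfin : ∀ x ∈ F, {a | a.2 < η a.1 ∧ pos a = x}.Finite) {u : Site d → ℝ}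
    (hu : ∀ x ∉ F, u x = 0) :
    ∀ᶠ Λ : Finset (Site d) in atTop, ∏ y ∈ Λ, ∏ i ∈ Finset.range (η y), (1 - u (pos (y, i))) =
      ∏ x ∈ F, (1 - u x) ^ Set.ncard {a | a.2 < η a.1 ∧ pos a = x} := by
  classical
  have hA : {a | a.2 < η a.1 ∧ pos a ∈ F}.Finite := by
    refine (F.finite_toSet.biUnion hfin).subset fun a ha => ?_
    simp only [Set.mem_iUnion]
    exact ⟨pos a, ha.2, ha.1, rfl⟩
  -- Once Λ contains the starting points of the finitely many particles now in F, the product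
  -- stabilizes: particles outside F contribute the factor 1.
  filter_upwards [eventually_ge_atTop (hA.toFinset.image Prod.fst)] with Λ hΛ
  have e1 : ∏ y ∈ Λ, ∏ i ∈ Finset.range (η y), (1 - u (pos (y, i))) =
      ∏ a ∈ (Λ.sigma fun y => Finset.range (η y)).image fun a => ((a.1, a.2) : Site d × ℕ),
        (1 - u (pos a)) := by
    rw [Finset.prod_image, Finset.prod_sigma]
    rintro ⟨y, i⟩ _ ⟨y', i'⟩ _ h
    simp only [Prod.mk.injEq] at h
    obtain ⟨rfl, rfl⟩ := h
    rfl
  have e2 : ∏ a ∈ (Λ.sigma fun y => Finset.range (η y)).image fun a => ((a.1, a.2) : Site d × ℕ),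
      (1 - u (pos a)) = ∏ a ∈ hA.toFinset, (1 - u (pos a)) := by
    symm
    refine Finset.prod_subset (fun a ha => ?_) fun a ha ha' => ?_
    · rw [Finset.mem_image]
      refine ⟨⟨a.1, a.2⟩, ?_, rfl⟩
      rw [Finset.mem_sigma, Finset.mem_range]
      exact ⟨hΛ (Finset.mem_image_of_mem _ ha), (hA.mem_toFinset.1 ha).1⟩
    · obtain ⟨⟨y, i⟩, hb, rfl⟩ := Finset.mem_image.1 ha
      rw [Finset.mem_sigma, Finset.mem_range] at hb
      rw [hu _ fun h => ha' (hA.mem_toFinset.2 ⟨hb.2, h⟩), sub_zero]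
  rw [e1, e2, ← Finset.prod_fiberwise_of_maps_to (g := pos) (t := F)
    fun a ha => (hA.mem_toFinset.1 ha).2]
  refine Finset.prod_congr rfl fun x hx => ?_
  rw [Finset.prod_congr rfl fun a ha => by rw [(Finset.mem_filter.1 ha).2], Finset.prod_const]
  congr 1
  rw [← Set.ncard_coe_finset]
  congr 1
  ext a
  simp only [Finset.coe_filter, Set.Finite.mem_toFinset, Set.mem_ofPred_eq]
  constructor
  · rintro ⟨⟨h1, _⟩, h2⟩
    exact ⟨h1, h2⟩
  · rintro ⟨h1, h2⟩
    exact ⟨⟨h1, h2 ▸ hx⟩, h2⟩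

theorem integral_comp_prod_of_indepFun [IsProbabilityMeasure P] {α β : Type*} [MeasurableSpace α]
    [MeasurableSpace β] {X : Ω → α} {Y : Ω → β} (hX : Measurable X) (hY : Measurable Y)
    (h : IndepFun X Y P) {G : α × β → ℝ} (hG : Measurable G) {C : ℝ} (hC : ∀ q, ‖G q‖ ≤ C) :
    ∫ ω, G (X ω, Y ω) ∂P = ∫ x, ∫ ω, G (x, Y ω) ∂P ∂(P.map X) := by
  have hXm : AEMeasurable X P := hX.aemeasurable
  have := Measure.isProbabilityMeasure_map (μ := P) hXm
  have := Measure.isProbabilityMeasure_map (μ := P) hY.aemeasurable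
  rw [← integral_map (φ := fun ω => (X ω, Y ω)) (hX.prodMk hY).aemeasurable
    hG.aestronglyMeasurable, (indepFun_iff_map_prod_eq_prod_map_map hXm hY.aemeasurable).1 h,
    integral_prod _ ((integrable_const C).mono' hG.aestronglyMeasurable (.of_forall hC))]
  refine integral_congr_ae (.of_forall fun x => ?_)
  exact integral_map (φ := Y) (f := fun y => G (x, y)) hY.aemeasurable
    (hG.comp measurable_prodMk_left).aestronglyMeasurable

section System
variable {η₀ : Ω → Config d} {S : Site d × ℕ → ℝ≥0 → Ω → Site d}

theorem IsSystem.measurable_walks (hS : IsSystem P p ρ η₀ S) :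
    Measurable fun (ω : Ω) (a : Site d × ℕ) (t : ℝ≥0) => S a t ω :=
  measurable_pi_iff.2 fun a => measurable_pi_iff.2 fun t => (hS.walk a).measurable t

/-- For a frozen initial configuration the labels are finitely many and independent, so the
expectation factorizes over particles. -/
theorem IsSystem.integral_prod_walks [IsProbabilityMeasure P] (hS : IsSystem P p ρ η₀ S)
    {s t : ℝ≥0} (hst : s ≤ t) {F : Finset (Site d)} {u v : Site d → ℝ}
    (hu : ∀ x ∉ F, u x = 0) (hv : ∀ x ∉ F, v x = 0) (Λ : Finset (Site d)) (η : Config d) :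
    ∫ ω, ∏ y ∈ Λ, ∏ i ∈ Finset.range (η y),
      (1 - u (y + S (y, i) s ω)) * (1 - v (y + S (y, i) t ω)) ∂P =
      ∏ y ∈ Λ, walkPgf p s t F u v y ^ η y := by
  classical
  let T : Finset (Σ _ : Site d, ℕ) := Λ.sigma fun y => Finset.range (η y)
  have hprod : ∀ g : Site d → ℕ → ℝ,
      ∏ y ∈ Λ, ∏ i ∈ Finset.range (η y), g y i = ∏ a : T, g a.1.1 a.1.2 := fun g => by
    rw [Finset.prod_coe_sort T fun a => g a.1 a.2, Finset.prod_sigma]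
  have hinj : Function.Injective fun a : T => ((a.1.1, a.1.2) : Site d × ℕ) := by
    rintro ⟨⟨y, i⟩, _⟩ ⟨⟨y', i'⟩, _⟩ h
    simp only [Prod.mk.injEq] at h
    obtain ⟨rfl, rfl⟩ := h
    rfl
  have hm : ∀ w : Site d → ℝ, Measurable w := fun w => measurable_of_countable w
  have key := iIndepFun.integral_fun_prod_comp (hS.indep_walks.precomp hinj)
    (f := fun a (path : ℝ≥0 → Site d) =>
      (1 - u (a.1.1 + path s)) * (1 - v (a.1.1 + path t)))
    (fun a => (measurable_pi_iff.2 fun r => (hS.walk _).measurable r).aemeasurable)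
    (fun a => by
      have := hm u
      have := hm v
      exact Measurable.aestronglyMeasurable (by fun_prop))
  simp_rw [hprod fun y i => (1 - u (y + S (y, i) s _)) * (1 - v (y + S (y, i) t _))]
  rw [key]
  have hw : ∀ a : T, ∫ ω, (1 - u (a.1.1 + S (a.1.1, a.1.2) s ω)) *
      (1 - v (a.1.1 + S (a.1.1, a.1.2) t ω)) ∂P = walkPgf p s t F u v a.1.1 := fun a =>
    (hS.walk _).integral_eq_walkPgf hst hu hv _
  simp_rw [hw]
  rw [← hprod fun y _ => walkPgf p s t F u v y]
  simp

theorem prod_prod_mem_Icc {Λ : Finset (Site d)} {η : Config d} {g : Site d → ℕ → ℝ}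
    (h0 : ∀ y i, 0 ≤ g y i) (h1 : ∀ y i, g y i ≤ 1) :
    ‖∏ y ∈ Λ, ∏ i ∈ Finset.range (η y), g y i‖ ≤ 1 := by
  rw [Real.norm_of_nonneg (Finset.prod_nonneg fun y _ => Finset.prod_nonneg fun i _ => h0 y i)]
  exact Finset.prod_le_one (fun y _ => Finset.prod_nonneg fun i _ => h0 y i) fun y _ =>
    Finset.prod_le_one (fun i _ => h0 y i) fun i _ => h1 y i

/-- Average the frozen case over independent Poisson initial numbers, using E z^n = e^{ρ(z-1)}. -/
theorem IsSystem.integral_finite_prod [IsProbabilityMeasure P] (hS : IsSystem P p ρ η₀ S)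
    {s t : ℝ≥0} (hst : s ≤ t) {F : Finset (Site d)} {u v : Site d → ℝ}
    (hu : ∀ x ∉ F, u x = 0) (hv : ∀ x ∉ F, v x = 0) (hu0 : ∀ x, 0 ≤ u x) (hu1 : ∀ x, u x ≤ 1)
    (hv0 : ∀ x, 0 ≤ v x) (hv1 : ∀ x, v x ≤ 1) (Λ : Finset (Site d)) :
    ∫ ω, ∏ y ∈ Λ, ∏ i ∈ Finset.range (η₀ ω y),
      (1 - u (y + S (y, i) s ω)) * (1 - v (y + S (y, i) t ω)) ∂P =
      Real.exp (ρ * ∑ y ∈ Λ, (walkPgf p s t F u v y - 1)) := by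
  have hmu : Measurable u := measurable_of_countable u
  have hmv : Measurable v := measurable_of_countable v
  let G : Config d × (Site d × ℕ → ℝ≥0 → Site d) → ℝ := fun q =>
    ∏ y ∈ Λ, ∏ i ∈ Finset.range (q.1 y),
      (1 - u (y + q.2 (y, i) s)) * (1 - v (y + q.2 (y, i) t))
  have hG : Measurable G := by
    refine Finset.measurable_fun_prod Λ fun y _ => ?_
    have h1 : Measurable fun r : ℕ × (Site d × ℕ → ℝ≥0 → Site d) =>
        ∏ i ∈ Finset.range r.1, (1 - u (y + r.2 (y, i) s)) * (1 - v (y + r.2 (y, i) t)) :=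
      measurable_from_prod_countable_right fun n =>
          Finset.measurable_fun_prod (Finset.range n) fun i _ => by fun_prop
    exact h1.comp (f := fun q : Config d × (Site d × ℕ → ℝ≥0 → Site d) => (q.1 y, q.2))
      (by fun_prop)
  have hG1 : ∀ q, ‖G q‖ ≤ 1 := fun q => prod_prod_mem_Icc
    (g := fun y i => (1 - u (y + q.2 (y, i) s)) * (1 - v (y + q.2 (y, i) t)))
    (fun y i => mul_nonneg (sub_nonneg.2 (hu1 _)) (sub_nonneg.2 (hv1 _)))
    fun y i => mul_le_one₀ (sub_le_self _ (hu0 _)) (sub_nonneg.2 (hv1 _)) (sub_le_self _ (hv0 _))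
  refine (integral_comp_prod_of_indepFun hS.measurable_init hS.measurable_walks hS.indep_init
    hG hG1).trans ?_
  simp only [G, hS.integral_prod_walks hst hu hv]
  rw [hS.law_init, integral_prod_eval ρ Λ fun y n => walkPgf p s t F u v y ^ n]
  simp_rw [integral_poisson_pow]
  rw [← Real.exp_sum, Finset.mul_sum]

/-- The tail sum is the Poisson mean. -/
theorem lintegral_poisson_lt_top (ρ : ℝ≥0) : ∑' i : ℕ, poissonMeasure ρ {n | i < n} ≠ ∞ := by
  have h : ∑' i : ℕ, poissonMeasure ρ {n | i < n} = ∫⁻ n, (n : ℝ≥0∞) ∂(poissonMeasure ρ) := by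
    have e : ∀ n : ℕ, (n : ℝ≥0∞) = ∑' i : ℕ, Set.indicator {n | i < n} (fun _ => (1 : ℝ≥0∞)) n := by
      intro n
      rw [tsum_eq_sum (s := Finset.range n)]
      · rw [Finset.sum_congr rfl fun i hi => Set.indicator_of_mem (s := {n | i < n})
          (by simpa using hi) _]
        simp
      · intro i hi
        exact Set.indicator_of_notMem (by simpa using hi) _
    simp_rw [e]
    rw [lintegral_tsum fun i => (measurable_of_countable _).aemeasurable]
    refine tsum_congr fun i => ?_
    rw [lintegral_indicator_const (MeasurableSet.of_discrete), one_mul]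
  rw [h]
  have h2 : Integrable (fun n : ℕ => (n : ℝ)) (poissonMeasure ρ) :=
    (integrable_poisson_pow ρ 2).mono' (measurable_of_countable _).aestronglyMeasurable
      (.of_forall fun n => by
        rw [Real.norm_natCast]
        exact_mod_cast Nat.lt_two_pow_self.le)
  have h3 := h2.lintegral_lt_top
  simpa using h3.ne

/-- Borel-Cantelli over labels: the expected number of particles at x is the Poisson mean times Σ_y
p_t(x-y), which is finite. -/
theorem IsSystem.ae_finite [IsProbabilityMeasure P] (hS : IsSystem P p ρ η₀ S) (t : ℝ≥0) :
    ∀ᵐ ω ∂P, ∀ x, {a : Site d × ℕ | a.2 < η₀ ω a.1 ∧ a.1 + S a t ω = x}.Finite := by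
  rw [ae_all_iff]
  intro x
  refine ae_finite_setOfPred_mem (s := fun a : Site d × ℕ =>
    {ω | a.2 < η₀ ω a.1 ∧ a.1 + S a t ω = x}) ?_
  have h : ∀ a : Site d × ℕ, P {ω | a.2 < η₀ ω a.1 ∧ a.1 + S a t ω = x} =
      ENNReal.ofReal (walkProb p t 0 (x - a.1)) * poissonMeasure ρ {n | a.2 < n} := by
    intro a
    have hind : IndepFun (fun ω => η₀ ω a.1) (S a t) P :=
      hS.indep_init.comp (φ := fun η : Config d => η a.1)
        (ψ := fun paths : Site d × ℕ → ℝ≥0 → Site d => paths a t) (by fun_prop) (by fun_prop)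
    have h1 := hind.measure_inter_preimage_eq_mul {n | a.2 < n} {x - a.1}
      .of_discrete (measurableSet_singleton _)
    have e : {ω | a.2 < η₀ ω a.1 ∧ a.1 + S a t ω = x} =
        (fun ω => η₀ ω a.1) ⁻¹' {n | a.2 < n} ∩ S a t ⁻¹' {x - a.1} := by
      ext ω
      simp only [Set.mem_ofPred_eq, Set.mem_inter_iff, Set.mem_preimage, Set.mem_singleton_iff,
        eq_sub_iff_add_eq']
    have h2 : P ((fun ω => η₀ ω a.1) ⁻¹' {n | a.2 < n}) = poissonMeasure ρ {n | a.2 < n} := by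
      rw [← Measure.infinitePi_map_eval (fun _ : Site d => poissonMeasure ρ) a.1,
        Measure.map_apply (by fun_prop) .of_discrete]
      change _ = nu d ρ _
      rw [← hS.law_init, Measure.map_apply hS.measurable_init
        ((measurable_pi_apply a.1) .of_discrete)]
      rfl
    have h3 : P (S a t ⁻¹' {x - a.1}) = ENNReal.ofReal (walkProb p t 0 (x - a.1)) := by
      rw [← (hS.walk a).measureReal_sub_eq, ofReal_measureReal]
      rfl
    rw [e, h1, h2, h3, mul_comm]
  simp_rw [h]
  rw [ENNReal.tsum_prod']
  simp_rw [ENNReal.tsum_mul_left, ENNReal.tsum_mul_right]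
  refine ENNReal.mul_ne_top ?_ (lintegral_poisson_lt_top ρ)
  have hq := (Equiv.subLeft x).hasSum_iff.2 ((hS.walk 0).hasSum_walkProb t)
  have := ENNReal.ofReal_tsum_of_nonneg (f := fun y => walkProb p t 0 (x - y))
    (fun y => (hS.walk 0).walkProb_nonneg t _) hq.summable
  rw [← this]
  exact ENNReal.ofReal_ne_top

/-- A measurable formula for the count that is valid everywhere: for infinite sets both sides take
the default value 0, through `Set.ncard` and `ENNReal.toReal`. -/
theorem ncard_eq_floor_tsum {α : Type*} (s : Set α) :
    s.ncard = ⌊(∑' a, s.indicator (fun _ => (1 : ℝ≥0∞)) a).toReal⌋₊ := by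
  rw [← tsum_subtype, ENNReal.tsum_set_one]
  rcases s.finite_or_infinite with h | h
  · rw [← h.cast_ncard_eq]
    simp
  · rw [h.encard_eq, h.ncard]
    simp

theorem IsSystem.measurable_config (hS : IsSystem P p ρ η₀ S) (t : ℝ≥0) :
    Measurable (config η₀ S t) := by
  refine measurable_pi_iff.2 fun x => ?_
  unfold config
  simp_rw [ncard_eq_floor_tsum]
  refine Nat.measurable_floor.comp (ENNReal.measurable_toReal.comp
    (Measurable.tsum fun a => ?_))
  have h : MeasurableSet {ω | a.2 < η₀ ω a.1 ∧ a.1 + S a t ω = x} := by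
    refine MeasurableSet.inter ?_ ?_
    · exact ((measurable_pi_apply a.1).comp hS.measurable_init)
        (MeasurableSet.of_discrete (s := {n | a.2 < n}))
    · exact (((hS.walk a).measurable t).const_add a.1) (measurableSet_singleton x)
  exact measurable_const.indicator h

/-- The joint probability generating function of the configurations at two times. -/
theorem IsSystem.integral_prod_config [IsProbabilityMeasure P] (hS : IsSystem P p ρ η₀ S)
    {s t : ℝ≥0} (hst : s ≤ t) {F : Finset (Site d)} {u v : Site d → ℝ}
    (hu : ∀ x ∉ F, u x = 0) (hv : ∀ x ∉ F, v x = 0) (hu0 : ∀ x, 0 ≤ u x) (hu1 : ∀ x, u x ≤ 1)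
    (hv0 : ∀ x, 0 ≤ v x) (hv1 : ∀ x, v x ≤ 1) :
    ∫ ω, (∏ x ∈ F, (1 - u x) ^ config η₀ S s ω x) * ∏ x ∈ F, (1 - v x) ^ config η₀ S t ω x ∂P =
      Real.exp (ρ * (-∑ x ∈ F, u x - ∑ z ∈ F, v z +
        ∑ x ∈ F, ∑ z ∈ F, u x * v z * walkProb p ((t : ℝ) - s) 0 (z - x))) := by
  -- Let the set Λ of starting sites exhaust the lattice. Almost surely the products are eventually
  -- constant, and they are bounded by 1.
  have h1 : Tendsto (fun Λ : Finset (Site d) => ∫ ω, ∏ y ∈ Λ, ∏ i ∈ Finset.range (η₀ ω y),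
      (1 - u (y + S (y, i) s ω)) * (1 - v (y + S (y, i) t ω)) ∂P) atTop
      (nhds (∫ ω, (∏ x ∈ F, (1 - u x) ^ config η₀ S s ω x) *
        ∏ x ∈ F, (1 - v x) ^ config η₀ S t ω x ∂P)) := by
    refine tendsto_integral_filter_of_dominated_convergence (fun _ => 1) (.of_forall fun Λ => ?_)
      (.of_forall fun Λ => .of_forall fun ω => ?_) (integrable_const 1) ?_
    · have hmu : Measurable u := measurable_of_countable u
      have hmv : Measurable v := measurable_of_countable v
      refine Measurable.aestronglyMeasurable (Finset.measurable_fun_prod Λ fun y _ => ?_)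
      have h1 : Measurable fun r : ℕ × (Site d × ℕ → ℝ≥0 → Site d) =>
          ∏ i ∈ Finset.range r.1, (1 - u (y + r.2 (y, i) s)) * (1 - v (y + r.2 (y, i) t)) :=
        measurable_from_prod_countable_right fun n =>
          Finset.measurable_fun_prod (Finset.range n) fun i _ => by fun_prop
      exact h1.comp (((measurable_pi_apply y).comp hS.measurable_init).prodMk hS.measurable_walks)
    · exact prod_prod_mem_Icc
        (g := fun y i => (1 - u (y + S (y, i) s ω)) * (1 - v (y + S (y, i) t ω)))
        (fun y i => mul_nonneg (sub_nonneg.2 (hu1 _)) (sub_nonneg.2 (hv1 _)))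
        fun y i => mul_le_one₀ (sub_le_self _ (hu0 _)) (sub_nonneg.2 (hv1 _))
          (sub_le_self _ (hv0 _))
    · filter_upwards [hS.ae_finite s, hS.ae_finite t] with ω hs ht
      refine tendsto_const_nhds.congr' ?_
      filter_upwards [eventually_prod_one_sub_eq (η₀ ω) (fun a => a.1 + S a s ω)
        (fun x _ => hs x) hu, eventually_prod_one_sub_eq (η₀ ω) (fun a => a.1 + S a t ω)
        (fun x _ => ht x) hv] with Λ h1 h2
      simp_rw [Finset.prod_mul_distrib, h1, h2]
      rfl
  simp_rw [hS.integral_finite_prod hst hu hv hu0 hu1 hv0 hv1] at h1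
  refine tendsto_nhds_unique h1 ?_
  exact (Real.continuous_exp.tendsto _).comp
    (((hS.walk 0).hasSum_walkPgf_sub_one s t F u v).const_mul (ρ : ℝ))

end System
end

section

variable {d : ℕ} {Ω : Type*} [MeasurableSpace Ω] {P : Measure Ω}
  {p : Site d → Site d → ℝ} {ρ : ℝ≥0}

/-! ### Stationarity -/

theorem measure_eq_of_integral_prod_pow_eq {σ : Type*} [Fintype σ] {μ ν : Measure (σ → ℕ)}
    [IsProbabilityMeasure μ] [IsProbabilityMeasure ν]
    (h : ∀ u : σ → ℝ, (∀ a, 0 ≤ u a) → (∀ a, u a ≤ 1) →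
      ∫ m, ∏ a, u a ^ m a ∂μ = ∫ m, ∏ a, u a ^ m a ∂ν) : μ = ν := by
  have hsum : ∀ (κ : Measure (σ → ℕ)) [IsProbabilityMeasure κ], Summable fun m => κ.real {m} := by
    intro κ _
    have h1 : ∑' m : σ → ℕ, κ {m} ≠ ∞ := by
      have := Measure.tsum_indicator_apply_singleton κ Set.univ MeasurableSet.univ
      simp only [Set.indicator_univ, measure_univ] at this
      rw [this]
      exact ENNReal.one_ne_top
    exact ENNReal.summable_toReal h1
  have hint : ∀ (κ : Measure (σ → ℕ)) [IsProbabilityMeasure κ] (u : σ → ℝ), (∀ a, 0 ≤ u a) →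
      (∀ a, u a ≤ 1) → Integrable (fun m : σ → ℕ => ∏ a, u a ^ m a) κ := by
    intro κ _ u h0 h1
    refine (integrable_const (1 : ℝ)).mono' (measurable_of_countable _).aestronglyMeasurable
      (.of_forall fun m => ?_)
    rw [Real.norm_of_nonneg (Finset.prod_nonneg fun a _ => pow_nonneg (h0 a) _)]
    exact Finset.prod_le_one (fun a _ => pow_nonneg (h0 a) _) fun a _ => pow_le_one₀ (h0 a) (h1 a)
  have hc := eq_zero_of_tsum_prod_pow_eq_zero (c := fun m => μ.real {m} - ν.real {m})
    ((hsum μ).sub (hsum ν)) fun u h0 h1 => by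
      have e := h u h0 h1
      have e1 := integral_countable (hint μ u h0 h1)
      have e2 := integral_countable (hint ν u h0 h1)
      have hs : ∀ (κ : Measure (σ → ℕ)) [IsProbabilityMeasure κ],
          Summable fun m : σ → ℕ => κ.real {m} * ∏ a, u a ^ m a := by
        intro κ _
        refine Summable.of_nonneg_of_le (fun m => mul_nonneg measureReal_nonneg
          (Finset.prod_nonneg fun a _ => pow_nonneg (h0 a) _)) (fun m => ?_) (hsum κ)
        exact mul_le_of_le_one_right measureReal_nonneg
          (Finset.prod_le_one (fun a _ => pow_nonneg (h0 a) _) fun a _ => pow_le_one₀ (h0 a) (h1 a))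
      simp_rw [sub_mul]
      rw [(hs μ).tsum_sub (hs ν)]
      simp only [smul_eq_mul] at e1 e2
      rw [← e1, ← e2, e, sub_self]
  refine Measure.ext_of_singleton fun m => ?_
  have := sub_eq_zero.1 (hc m)
  rwa [measureReal_def, measureReal_def,
    ENNReal.toReal_eq_toReal_iff' (measure_ne_top _ _) (measure_ne_top _ _)] at this

variable {η₀ : Ω → Config d} {S : Site d × ℕ → ℝ≥0 → Ω → Site d}

/-- Put v = 0 in the joint generating function: the finite-dimensional laws have the product Poisson
generating function, and the projective limit is unique. -/
theorem IsSystem.map_config [IsProbabilityMeasure P] (hS : IsSystem P p ρ η₀ S) (t : ℝ≥0) :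
    P.map (config η₀ S t) = nu d ρ := by
  have hm := hS.measurable_config t
  have := Measure.isProbabilityMeasure_map (μ := P) hm.aemeasurable
  have hlim : IsProjectiveLimit (nu d ρ) (fun I : Finset (Site d) =>
      Measure.pi fun _ : I => poissonMeasure ρ) :=
    Measure.isProjectiveLimit_infinitePi fun _ : Site d => poissonMeasure ρ
  refine IsProjectiveLimit.unique (fun F => ?_) hlim
  have hr : Measurable (F.restrict : Config d → F → ℕ) := Finset.measurable_restrict F
  have := Measure.isProbabilityMeasure_map (μ := P.map (config η₀ S t)) hr.aemeasurable
  refine measure_eq_of_integral_prod_pow_eq fun w h0 h1 => ?_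
  rw [integral_fintype_prod_eq_prod fun (x : F) n => w x ^ n]
  simp_rw [integral_poisson_pow]
  classical
  let u : Site d → ℝ := fun x => if h : x ∈ F then 1 - w ⟨x, h⟩ else 0
  have hw : ∀ x : F, w x = 1 - u x := fun x => by simp [u]
  have key := hS.integral_prod_config (le_refl t) (F := F) (u := u) (v := 0)
    (fun x hx => by simp [u, hx]) (fun _ _ => rfl)
    (fun x => by by_cases hx : x ∈ F <;> simp [u, hx, h1])
    (fun x => by by_cases hx : x ∈ F <;> simp [u, hx, h0]) (fun _ => le_rfl)
    (fun _ => zero_le_one)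
  have hg : Measurable fun y : F → ℕ => ∏ x, w x ^ y x := measurable_of_countable _
  rw [Measure.map_map hr hm, integral_map (hr.comp hm).aemeasurable hg.aestronglyMeasurable,
    ← Real.exp_sum]
  simp only [Pi.zero_apply, sub_zero, one_pow, Finset.prod_const_one, mul_one, mul_zero, zero_mul,
    Finset.sum_const_zero, add_zero] at key
  have e : ∀ ω, ∏ x : F, w x ^ (F.restrict ∘ config η₀ S t) ω x =
      ∏ x ∈ F, (1 - u x) ^ config η₀ S t ω x := fun ω => by
    rw [← Finset.prod_coe_sort F fun x => (1 - u x) ^ config η₀ S t ω x]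
    exact Finset.prod_congr rfl fun x _ => by rw [hw]; rfl
  simp_rw [e, key]
  congr 1
  rw [← Finset.sum_coe_sort F u, ← Finset.sum_neg_distrib, Finset.mul_sum]
  exact Finset.sum_congr rfl fun x _ => by rw [hw]; ring

theorem IsSystem.measurePreserving_config [IsProbabilityMeasure P] (hS : IsSystem P p ρ η₀ S)
    (t : ℝ≥0) : MeasurePreserving (config η₀ S t) P (nu d ρ) :=
  ⟨hS.measurable_config t, hS.map_config t⟩

/-! ### Expansion of the exponential of a bilinear form -/

theorem hasSum_tuples_exp {α : Type*} {a : α → ℝ} (ha : ∀ x, 0 ≤ a x) {G : Finset α}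
    (hG : ∀ x ∉ G, a x = 0) :
    HasSum (fun j : Σ n, Fin n → α => 1 / (j.1.factorial : ℝ) * ∏ i, a (j.2 i))
      (Real.exp (∑ x ∈ G, a x)) := by
  classical
  have h1 : ∀ n : ℕ, HasSum (fun w : Fin n → α => 1 / (n.factorial : ℝ) * ∏ i, a (w i))
      ((∑ x ∈ G, a x) ^ n / (n.factorial : ℝ)) := by
    intro n
    have e : (∑ x ∈ G, a x) ^ n / (n.factorial : ℝ) =
        ∑ w ∈ Fintype.piFinset fun _ : Fin n => G, 1 / (n.factorial : ℝ) * ∏ i, a (w i) := by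
      rw [Finset.sum_pow', ← Finset.mul_sum]
      ring
    rw [e]
    refine hasSum_sum_of_ne_finset_zero fun w hw => ?_
    rw [Fintype.mem_piFinset, not_forall] at hw
    obtain ⟨i, hi⟩ := hw
    rw [Finset.prod_eq_zero (Finset.mem_univ i) (hG _ hi), mul_zero]
  have h2 := hasSum_pow_div_factorial (∑ x ∈ G, a x)
  refine HasSum.sigma_of_hasSum h2 h1 ?_
  rw [summable_sigma_of_nonneg fun j => mul_nonneg (by positivity)
    (Finset.prod_nonneg fun i _ => ha _)]
  exact ⟨fun n => (h1 n).summable, by simpa only [(h1 _).tsum_eq] using h2.summable⟩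

theorem prod_counts {n : ℕ} (u : Site d → ℝ) (x : Fin n → Site d) :
    (counts x).prod (fun a k => u a ^ k) = ∏ i, u (x i) := by
  classical
  rw [counts, ← Finsupp.prod_finsetSum_index (by simp) (by simp [pow_add])]
  simp

/-- The sum over all pairs of arrangements of `ξ` and `ξ'` of the products of the transition
probabilities. -/
def transferSum (q : Site d → ℝ) (ξ ξ' : FinConfig d) : ℝ :=
  ∑ x ∈ arrangements ξ.degree ξ, ∑ z ∈ arrangements ξ.degree ξ', ∏ i, q (z i - x i)

/-- Expand the exponential over tuples of pairs (x_i, z_i) of every length and collect the tuples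
whose first and second entries have particle counts ξ and ξ'. -/
theorem hasSum_exp_bilinear {q : Site d → ℝ} (hq : ∀ z, 0 ≤ q z) {F : Finset (Site d)}
    {u v : Site d → ℝ} (hu : ∀ x ∉ F, u x = 0) (hv : ∀ x ∉ F, v x = 0) (hu0 : ∀ x, 0 ≤ u x)
    (hv0 : ∀ x, 0 ≤ v x) (ρ : ℝ≥0) :
    HasSum (fun c : FinConfig d × FinConfig d =>
      (ρ : ℝ) ^ c.1.degree / (c.1.degree.factorial : ℝ) * transferSum q c.1 c.2 *
        ((c.1.prod fun a k => u a ^ k) * c.2.prod fun a k => v a ^ k))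
      (Real.exp (ρ * ∑ x ∈ F, ∑ z ∈ F, u x * v z * q (z - x))) := by
  classical
  let a : Site d × Site d → ℝ := fun w => ρ * (u w.1 * v w.2 * q (w.2 - w.1))
  have ha : ∀ w, 0 ≤ a w := fun w =>
    mul_nonneg ρ.2 (mul_nonneg (mul_nonneg (hu0 _) (hv0 _)) (hq _))
  have hG : ∀ w ∉ F ×ˢ F, a w = 0 := by
    intro w hw
    rw [Finset.mem_product, not_and_or] at hw
    rcases hw with hw | hw
    · simp [a, hu _ hw]
    · simp [a, hv _ hw]
  have h := (hasSum_tuples_exp ha hG).tsum_fiberwise fun j =>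
    (counts fun i => (j.2 i).1, counts fun i => (j.2 i).2)
  rw [Finset.sum_product] at h
  simp_rw [a, ← Finset.mul_sum] at h
  refine h.congr_fun fun c => ?_
  obtain ⟨ξ, ξ'⟩ := c
  let n := ξ.degree
  let emb : (Fin n → Site d) × (Fin n → Site d) ↪ Σ n, Fin n → Site d × Site d :=
    ⟨fun w => ⟨n, fun i => (w.1 i, w.2 i)⟩, fun w w' h => by
      have h := eq_of_heq (Sigma.mk.inj h).2
      ext i : 2
      · exact congrArg Prod.fst (congrFun h i)
      · exact congrArg Prod.snd (congrFun h i)⟩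
  have hset : (fun j : Σ n, Fin n → Site d × Site d =>
      (counts fun i => (j.2 i).1, counts fun i => (j.2 i).2)) ⁻¹' {(ξ, ξ')} =
      ↑((arrangements n ξ ×ˢ arrangements n ξ').map emb) := by
    ext ⟨m, w⟩
    simp only [Set.mem_preimage, Set.mem_singleton_iff, Prod.mk.injEq, Finset.coe_map,
      Set.mem_image, Finset.mem_coe, Finset.mem_product, mem_arrangements]
    constructor
    · rintro ⟨h1, h2⟩
      have hmn : m = n := by rw [← degree_counts fun i => (w i).1, h1]
      subst hmn
      exact ⟨(fun i => (w i).1, fun i => (w i).2), ⟨h1, h2⟩, rfl⟩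
    · rintro ⟨⟨x, z⟩, ⟨h1, h2⟩, h3⟩
      change (⟨n, fun i => (x i, z i)⟩ : Σ n, Fin n → Site d × Site d) = ⟨m, w⟩ at h3
      cases h3
      exact ⟨h1, h2⟩
  rw [hset, Finset.tsum_subtype' ((arrangements n ξ ×ˢ arrangements n ξ').map emb)
    fun j : Σ n, Fin n → Site d × Site d => 1 / (j.1.factorial : ℝ) *
      ∏ i, (ρ * (u (j.2 i).1 * v (j.2 i).2 * q ((j.2 i).2 - (j.2 i).1))), Finset.sum_map,
    Finset.sum_product, transferSum, Finset.mul_sum, Finset.sum_mul]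
  refine Finset.sum_congr rfl fun x hx => ?_
  rw [Finset.mul_sum, Finset.sum_mul]
  refine Finset.sum_congr rfl fun z hz => ?_
  have e1 : (ξ.prod fun a k => u a ^ k) = ∏ i, u (x i) :=
    (congrArg (fun ζ : FinConfig d => ζ.prod fun a k => u a ^ k) (mem_arrangements.1 hx)).symm.trans
      (prod_counts u x)
  have e2 : (ξ'.prod fun a k => v a ^ k) = ∏ i, v (z i) :=
    (congrArg (fun ζ : FinConfig d => ζ.prod fun a k => v a ^ k) (mem_arrangements.1 hz)).symm.trans
      (prod_counts v z)
  have e3 : emb (x, z) = ⟨n, fun i => (x i, z i)⟩ := rfl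
  rw [e3]
  simp only [Finset.prod_mul_distrib, Finset.prod_const, Finset.card_univ, Fintype.card_fin, e1, e2]
  ring

/-! ### Configurations supported in a finite set -/

/-- The configuration which agrees with `m` on `F` and is empty off `F`. -/
def extend (F : Finset (Site d)) (m : F → ℕ) : FinConfig d := by
  classical
  exact Finsupp.onFinset F (fun x => if h : x ∈ F then m ⟨x, h⟩ else 0) fun x hx => by
    by_contra h
    simp [h] at hx

theorem extend_apply (F : Finset (Site d)) (m : F → ℕ) (x : F) : extend F m x = m x := by
  simp [extend]

theorem support_extend_subset (F : Finset (Site d)) (m : F → ℕ) : (extend F m).support ⊆ F :=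
  Finsupp.support_onFinset_subset

theorem extend_injective (F : Finset (Site d)) : Function.Injective (extend F) := fun m m' h => by
  ext x
  rw [← extend_apply F m, h, extend_apply]

theorem extend_restrict {F : Finset (Site d)} {ξ : FinConfig d} (h : ξ.support ⊆ F) :
    extend F (fun x => ξ x) = ξ := by
  ext x
  by_cases hx : x ∈ F
  · exact extend_apply F _ ⟨x, hx⟩
  · rw [Finsupp.notMem_support_iff.1 fun h' => hx (h h'),
      Finsupp.notMem_support_iff.1 fun h' => hx (support_extend_subset F _ h')]

theorem prod_extend (F : Finset (Site d)) (m : F → ℕ) {M : Type*} [CommMonoid M]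
    (h : Site d → ℕ → M) (h0 : ∀ x, h x 0 = 1) :
    (extend F m).prod h = ∏ x : F, h x (m x) := by
  rw [Finsupp.prod_of_support_subset _ (support_extend_subset F m) _ fun x _ => h0 x,
    ← Finset.prod_coe_sort F]
  exact Finset.prod_congr rfl fun x _ => by rw [extend_apply]

theorem hasSum_exp_bilinear_extend {q : Site d → ℝ} (hq : ∀ z, 0 ≤ q z) {F : Finset (Site d)}
    {u v : Site d → ℝ} (hu : ∀ x ∉ F, u x = 0) (hv : ∀ x ∉ F, v x = 0) (hu0 : ∀ x, 0 ≤ u x)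
    (hv0 : ∀ x, 0 ≤ v x) (ρ : ℝ≥0) :
    HasSum (fun m : (F → ℕ) × (F → ℕ) =>
      (ρ : ℝ) ^ (extend F m.1).degree / ((extend F m.1).degree.factorial : ℝ) *
        transferSum q (extend F m.1) (extend F m.2) *
        ((∏ x : F, u x ^ m.1 x) * ∏ x : F, v x ^ m.2 x))
      (Real.exp (ρ * ∑ x ∈ F, ∑ z ∈ F, u x * v z * q (z - x))) := by
  have h := hasSum_exp_bilinear hq hu hv hu0 hv0 ρ
  have hinj : Function.Injective (Prod.map (extend F) (extend F)) :=
    (extend_injective F).prodMap (extend_injective F)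
  rw [← hinj.hasSum_iff] at h
  · refine h.congr_fun fun m => ?_
    simp only [Function.comp_apply, Prod.map]
    rw [prod_extend F m.1 (fun a k => u a ^ k) (by simp),
      prod_extend F m.2 (fun a k => v a ^ k) (by simp)]
  · rintro ⟨ξ, ξ'⟩ hξ
    have hzero : ∀ (w : Site d → ℝ) (ζ : FinConfig d), (∀ x ∉ F, w x = 0) → ¬ζ.support ⊆ F →
        (ζ.prod fun a k => w a ^ k) = 0 := by
      intro w ζ hw hζ
      obtain ⟨x, hx, hxF⟩ := Finset.not_subset.1 hζ
      refine Finset.prod_eq_zero hx ?_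
      simp only
      rw [hw x hxF, zero_pow (Finsupp.mem_support_iff.1 hx)]
    by_cases h1 : ξ.support ⊆ F
    · by_cases h2 : ξ'.support ⊆ F
      · exact absurd ⟨(fun x => ξ x, fun x => ξ' x), by
          simp [Prod.map, extend_restrict h1, extend_restrict h2]⟩ hξ
      · simp [hzero v ξ' hv h2]
    · simp [hzero u ξ hu h1]

end

section

variable {d : ℕ} {Ω : Type*} [MeasurableSpace Ω] {P : Measure Ω}
  {p : Site d → Site d → ℝ} {ρ : ℝ≥0}

/-! ### Pair correlations of the duality polynomials -/

theorem measurable_config_eval (F : Finset (Site d)) (c : F → ℕ → ℝ) :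
    Measurable fun η : Config d => ∏ x : F, c x (η x) := by
  have : ∀ x, Measurable (c x) := fun x => measurable_of_countable _
  fun_prop

theorem dual_extend (F : Finset (Site d)) (m : F → ℕ) (η : Config d) :
    dual ρ (extend F m) η = ∏ x : F, charlier ρ (m x) (η x) :=
  prod_extend F m (fun x k => charlier ρ k (η x)) fun _ => by simp [charlier]

theorem hasSum_mul_prod {α β : Type*} {f : α → ℝ} {g : β → ℝ} {a b : ℝ} (hf : HasSum f a)
    (hg : HasSum g b) (hf' : Summable fun x => ‖f x‖) (hg' : Summable fun y => ‖g y‖) :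
    HasSum (fun m : α × β => f m.1 * g m.2) (a * b) :=
  HasSum.mul (f := f) (g := g) hf hg (summable_mul_of_summable_norm (f := f) (g := g) hf' hg')

/-- Multiply the Charlier generating functions over sites and integrate term by term. The joint law
of X and Y is arbitrary; the dominating product is integrable because each factor, a multiple of ∏
2^{η_x}, is in L² under the marginal law. -/
theorem hasSum_integral_dual_mul_dual (hρ : 0 < ρ) {X Y : Ω → Config d}
    (hX : MeasurePreserving X P (nu d ρ)) (hY : MeasurePreserving Y P (nu d ρ))
    (F : Finset (Site d)) {u v : F → ℝ} (hu0 : ∀ x, 0 ≤ u x) (hu1 : ∀ x, u x ≤ 1)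
    (hv0 : ∀ x, 0 ≤ v x) (hv1 : ∀ x, v x ≤ 1) :
    HasSum (fun m : (F → ℕ) × (F → ℕ) =>
      ((∏ x, (ρ : ℝ) ^ m.1 x / ((m.1 x).factorial : ℝ)) *
        (∏ x, (ρ : ℝ) ^ m.2 x / ((m.2 x).factorial : ℝ)) *
        ∫ ω, dual ρ (extend F m.1) (X ω) * dual ρ (extend F m.2) (Y ω) ∂P) *
        ((∏ x, u x ^ m.1 x) * ∏ x, v x ^ m.2 x))
      (∫ ω, (∏ x : F, Real.exp (ρ * u x) * (1 - u x) ^ X ω x) *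
        ∏ x : F, Real.exp (ρ * v x) * (1 - v x) ^ Y ω x ∂P) := by
  obtain ⟨T, hTdef⟩ : ∃ T : (F → ℝ) → (F → ℕ) → Config d → ℝ, ∀ w m η, T w m η =
    ∏ x : F, ((ρ * w x) ^ m x / ((m x).factorial : ℝ) * charlier ρ (m x) (η x)) :=
    ⟨_, fun _ _ _ => rfl⟩
  have hTmeas : ∀ w m, Measurable (T w m) := fun w m => by
    rw [funext (hTdef w m)]
    exact measurable_config_eval F fun x n => (ρ * w x) ^ m x / ((m x).factorial : ℝ) * charlier ρ (m x) n
  have hT : ∀ w η, HasSum (fun m => T w m η)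
      (∏ x : F, Real.exp (ρ * w x) * (1 - w x) ^ η x) := fun w η => by
    simp only [hTdef]
    exact hasSum_fintype_prod (f := fun (x : F) k =>
      (ρ * w x) ^ k / (k.factorial : ℝ) * charlier ρ k (η x)) fun x => hasSum_charlier hρ (η x) (w x)
  have hTn : ∀ w η, HasSum (fun m => ‖T w m η‖) (∏ x : F, ∑' k : ℕ,
      |(ρ * w x) ^ k / (k.factorial : ℝ) * charlier ρ k (η x)|) := by
    intro w η
    have := hasSum_fintype_prod (f := fun (x : F) k =>
      |(ρ * w x) ^ k / (k.factorial : ℝ) * charlier ρ k (η x)|)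
      fun x => (summable_abs_charlier hρ (η x) (w x)).hasSum
    refine this.congr_fun fun m => ?_
    simp only [hTdef, norm_prod, Real.norm_eq_abs]
  have hTb : ∀ w : F → ℝ, (∀ x, 0 ≤ w x) → (∀ x, w x ≤ 1) → ∀ η, ∑' m, ‖T w m η‖ ≤
      (∏ _x : F, Real.exp ρ) * ∏ x ∈ F, 2 ^ η x := by
    intro w h0 h1 η
    rw [(hTn w η).tsum_eq, ← Finset.prod_coe_sort F fun x => (2 : ℝ) ^ η x,
      ← Finset.prod_mul_distrib]
    refine Finset.prod_le_prod (fun x _ => tsum_nonneg fun _ => abs_nonneg _) fun x _ => ?_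
    refine (tsum_abs_charlier_le hρ _ _).trans ?_
    rw [abs_of_nonneg (h0 x)]
    have := h0 x
    have := h1 x
    gcongr
    · exact mul_le_of_le_one_right ρ.2 (h1 x)
    · linarith
  let B : (F → ℕ) × (F → ℕ) → Ω → ℝ := fun m ω => ‖T u m.1 (X ω)‖ * ‖T v m.2 (Y ω)‖
  have hBs : ∀ ω, HasSum (fun m => B m ω) ((∑' m, ‖T u m (X ω)‖) * ∑' m, ‖T v m (Y ω)‖) := by
    intro ω
    exact hasSum_mul_prod (f := fun m => ‖T u m (X ω)‖) (g := fun m => ‖T v m (Y ω)‖)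
      (hTn _ _).summable.hasSum (hTn _ _).summable.hasSum (hTn _ _).summable.norm
      (hTn _ _).summable.norm
  have hBm : ∀ m, Measurable (B m) := fun m =>
    ((hTmeas u m.1).comp hX.measurable).norm.mul ((hTmeas v m.2).comp hY.measurable).norm
  have key := hasSum_integral_of_dominated_convergence (μ := P)
    (F := fun (m : (F → ℕ) × (F → ℕ)) ω => T u m.1 (X ω) * T v m.2 (Y ω))
    (f := fun ω => (∏ x : F, Real.exp (ρ * u x) * (1 - u x) ^ X ω x) *
        ∏ x : F, Real.exp (ρ * v x) * (1 - v x) ^ Y ω x) B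
    (fun m => (((hTmeas u m.1).comp hX.measurable).mul
      ((hTmeas v m.2).comp hY.measurable)).aestronglyMeasurable)
    (fun m => .of_forall fun ω => (norm_mul _ _).le)
    (.of_forall fun ω => (hBs ω).summable) ?_ (.of_forall fun ω => ?_)
  · refine key.congr_fun fun m => ?_
    have e : ∀ (w : F → ℝ) (m : F → ℕ) η, T w m η =
        (∏ x, (ρ : ℝ) ^ m x / ((m x).factorial : ℝ)) * (∏ x, w x ^ m x) *
          dual ρ (extend F m) η := by
      intro w m η
      rw [hTdef, dual_extend, ← Finset.prod_mul_distrib, ← Finset.prod_mul_distrib]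
      exact Finset.prod_congr rfl fun x _ => by rw [mul_pow]; ring
    simp only [e]
    rw [← integral_const_mul, ← integral_mul_const]
    refine integral_congr_ae (.of_forall fun ω => ?_)
    simp only
    ring
  · have hL : ∀ Z : Ω → Config d, MeasurePreserving Z P (nu d ρ) →
        MemLp (fun ω => (∏ _x : F, Real.exp ρ) * ∏ x ∈ F, (2 : ℝ) ^ Z ω x) 2 P := fun Z hZ =>
      ((memLp_prod_pow ρ F 2).comp_measurePreserving hZ).const_mul _
    refine ((hL X hX).integrable_mul (hL Y hY)).mono'
      (Measurable.tsum hBm).aestronglyMeasurable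
      (.of_forall fun ω => ?_)
    rw [(hBs ω).tsum_eq, Real.norm_of_nonneg (mul_nonneg (tsum_nonneg fun _ => norm_nonneg _)
      (tsum_nonneg fun _ => norm_nonneg _))]
    refine mul_le_mul (hTb u hu0 hu1 _) (hTb v hv0 hv1 _) (tsum_nonneg fun _ => norm_nonneg _) ?_
    exact (tsum_nonneg fun _ => norm_nonneg _).trans (hTb u hu0 hu1 _)
  · exact hasSum_mul_prod (f := fun m => T u m (X ω)) (g := fun m => T v m (Y ω)) (hT _ _) (hT _ _)
      (hTn _ _).summable (hTn _ _).summable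

theorem factorials_extend (F : Finset (Site d)) (m : F → ℕ) :
    ((factorials (extend F m) : ℕ) : ℝ) = ∏ x : F, ((m x).factorial : ℝ) := by
  rw [factorials, prod_extend F m (fun _ k => k.factorial) fun _ => rfl, Nat.cast_prod]

theorem degree_extend (F : Finset (Site d)) (m : F → ℕ) : (extend F m).degree = ∑ x, m x := by
  rw [Finsupp.degree_apply, Finset.sum_subset (support_extend_subset F m) fun x _ h =>
    Finsupp.notMem_support_iff.1 h, ← Finset.sum_coe_sort F]
  exact Finset.sum_congr rfl fun x _ => extend_apply F m x

/-- The pair correlations of the duality polynomials are determined by the joint generating function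
of the two configurations. -/
theorem integral_dual_mul_dual_of_pgf (hρ : 0 < ρ) {X Y : Ω → Config d}
    (hX : MeasurePreserving X P (nu d ρ)) (hY : MeasurePreserving Y P (nu d ρ))
    {q : Site d → ℝ} (hq : ∀ z, 0 ≤ q z)
    (hpgf : ∀ (F : Finset (Site d)) (u v : Site d → ℝ), (∀ x ∉ F, u x = 0) → (∀ x ∉ F, v x = 0) →
      (∀ x, 0 ≤ u x) → (∀ x, u x ≤ 1) → (∀ x, 0 ≤ v x) → (∀ x, v x ≤ 1) →
      ∫ ω, (∏ x ∈ F, (1 - u x) ^ X ω x) * ∏ x ∈ F, (1 - v x) ^ Y ω x ∂P =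
        Real.exp (ρ * (-∑ x ∈ F, u x - ∑ x ∈ F, v x +
          ∑ x ∈ F, ∑ z ∈ F, u x * v z * q (z - x)))) (ξ ξ' : FinConfig d) :
    ∫ ω, dual ρ ξ (X ω) * dual ρ ξ' (Y ω) ∂P =
      factorials ξ * factorials ξ' / (ρ : ℝ) ^ ξ'.degree / (ξ.degree.factorial : ℝ) *
        transferSum q ξ ξ' := by
  classical
  have hρ' : (ρ : ℝ) ≠ 0 := by exact_mod_cast hρ.ne'
  set F := ξ.support ∪ ξ'.support with hF
  let K : (F → ℕ) × (F → ℕ) → ℝ := fun m =>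
    (∏ x, (ρ : ℝ) ^ m.1 x / ((m.1 x).factorial : ℝ)) *
        (∏ x, (ρ : ℝ) ^ m.2 x / ((m.2 x).factorial : ℝ)) *
        ∫ ω, dual ρ (extend F m.1) (X ω) * dual ρ (extend F m.2) (Y ω) ∂P
  let L : (F → ℕ) × (F → ℕ) → ℝ := fun m =>
    (ρ : ℝ) ^ (extend F m.1).degree / ((extend F m.1).degree.factorial : ℝ) *
        transferSum q (extend F m.1) (extend F m.2)
  -- The correlations K and the matching sums L have the same generating function: the prefactors
  -- e^{ρu}, e^{ρv} of the Charlier series cancel the linear terms in the exponent of the joint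
  -- generating function.
  have hKL : ∀ u v : F → ℝ, (∀ x, 0 ≤ u x) → (∀ x, u x ≤ 1) → (∀ x, 0 ≤ v x) → (∀ x, v x ≤ 1) →
      ∃ s, HasSum (fun m => K m * ((∏ x, u x ^ m.1 x) * ∏ x, v x ^ m.2 x)) s ∧
        HasSum (fun m => L m * ((∏ x, u x ^ m.1 x) * ∏ x, v x ^ m.2 x)) s := by
    intro u v hu0 hu1 hv0 hv1
    let ext0 : (F → ℝ) → Site d → ℝ := fun w x => if h : x ∈ F then w ⟨x, h⟩ else 0
    have he : ∀ w (x : F), ext0 w x = w x := fun w x => by simp [ext0]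
    have hn : ∀ w, ∀ x ∉ F, ext0 w x = 0 := fun w x hx => by simp [ext0, hx]
    have h0 : ∀ w : F → ℝ, (∀ x, 0 ≤ w x) → ∀ x, 0 ≤ ext0 w x := fun w hw x => by
      by_cases hx : x ∈ F <;> simp [ext0, hx, hw]
    have h1 : ∀ w : F → ℝ, (∀ x, w x ≤ 1) → ∀ x, ext0 w x ≤ 1 := fun w hw x => by
      by_cases hx : x ∈ F <;> simp [ext0, hx, hw]
    have hK := hasSum_integral_dual_mul_dual hρ hX hY F hu0 hu1 hv0 hv1
    have hL := hasSum_exp_bilinear_extend hq (hn u) (hn v) (h0 u hu0) (h0 v hv0) ρ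
    simp only [he] at hL
    refine ⟨_, hK, ?_⟩
    convert hL using 1
    have hp := hpgf F (ext0 u) (ext0 v) (hn u) (hn v) (h0 u hu0) (h1 u hu1) (h0 v hv0) (h1 v hv1)
    have e : ∀ ω, (∏ x : F, Real.exp (ρ * u x) * (1 - u x) ^ X ω x) *
        ∏ x : F, Real.exp (ρ * v x) * (1 - v x) ^ Y ω x =
        Real.exp (ρ * (∑ x ∈ F, ext0 u x + ∑ x ∈ F, ext0 v x)) *
        ((∏ x ∈ F, (1 - ext0 u x) ^ X ω x) * ∏ x ∈ F, (1 - ext0 v x) ^ Y ω x) := by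
      intro ω
      rw [Finset.prod_mul_distrib, Finset.prod_mul_distrib, ← Real.exp_sum, ← Real.exp_sum,
        ← Finset.mul_sum, ← Finset.mul_sum, mul_add, Real.exp_add,
        ← Finset.sum_coe_sort F, ← Finset.sum_coe_sort F, ← Finset.prod_coe_sort F,
        ← Finset.prod_coe_sort F]
      simp only [he]
      ring
    simp_rw [e]
    rw [integral_const_mul, hp, ← Real.exp_add]
    congr 1
    ring
  have hsum : Summable fun m => K m - L m := by
    obtain ⟨s, hK, hL⟩ := hKL 1 1 (fun _ => zero_le_one) (fun _ => le_rfl) (fun _ => zero_le_one)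
      fun _ => le_rfl
    simp only [Pi.one_apply, one_pow, Finset.prod_const_one, mul_one] at hK hL
    exact hK.summable.sub hL.summable
  have h := eq_zero_of_tsum_prod_pow_mul_eq_zero hsum (fun u v hu0 hu1 hv0 hv1 => by
    obtain ⟨s, hK, hL⟩ := hKL u v hu0 hu1 hv0 hv1
    simp only [sub_mul]
    rw [(hK.sub hL).tsum_eq, sub_self]) (fun x => ξ x, fun x => ξ' x)
  simp only [K, L, sub_eq_zero, Finset.prod_div_distrib, ← factorials_extend,
    Finset.prod_pow_eq_pow_sum, ← degree_extend] at h
  rw [extend_restrict (Finset.subset_union_left : ξ.support ⊆ F),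
    extend_restrict (Finset.subset_union_right : ξ'.support ⊆ F)] at h
  have hf : ∀ ζ : FinConfig d, (factorials ζ : ℝ) ≠ 0 := fun ζ => by
    rw [factorials, Finsupp.prod, Nat.cast_prod]
    exact Finset.prod_ne_zero_iff.2 fun x _ => by positivity
  have := hf ξ
  have := hf ξ'
  have : ((ξ.degree.factorial : ℕ) : ℝ) ≠ 0 := by positivity
  field_simp at h ⊢
  linear_combination h

end

section

variable {d : ℕ} {Ω : Type*} [MeasurableSpace Ω] {P : Measure Ω}
  {p : Site d → Site d → ℝ} {ρ : ℝ≥0}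

/-! ### Orthogonality and bounds for the pair correlations -/

/-- The pair correlations of the duality polynomials when `q` is the transition probability from
the earlier to the later time. -/
def correlation (ρ : ℝ≥0) (q : Site d → ℝ) (ξ ξ' : FinConfig d) : ℝ :=
  factorials ξ * factorials ξ' / (ρ : ℝ) ^ ξ'.degree / (ξ.degree.factorial : ℝ) * transferSum q ξ ξ'

theorem factorials_pos (ξ : FinConfig d) : 0 < factorials ξ := by
  rw [factorials, Finsupp.prod]
  exact Finset.prod_pos fun x _ => Nat.factorial_pos _

theorem IsSystem.integral_dual_mul_dual [IsProbabilityMeasure P] (hρ : 0 < ρ) {η₀ : Ω → Config d}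
    {S : Site d × ℕ → ℝ≥0 → Ω → Site d} (hS : IsSystem P p ρ η₀ S) {s t : ℝ≥0} (hst : s ≤ t)
    (ξ ξ' : FinConfig d) :
    ∫ ω, dual ρ ξ (config η₀ S s ω) * dual ρ ξ' (config η₀ S t ω) ∂P =
      correlation ρ (fun z => walkProb p ((t : ℝ) - s) 0 z) ξ ξ' := by
  refine integral_dual_mul_dual_of_pgf hρ (hS.measurePreserving_config s)
    (hS.measurePreserving_config t) (fun z => ?_) (fun F u v hu hv hu0 hu1 hv0 hv1 =>
      hS.integral_prod_config hst hu hv hu0 hu1 hv0 hv1) ξ ξ'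
  have := (hS.walk 0).walkProb_nonneg (t - s) z
  rwa [NNReal.coe_sub hst] at this

theorem transferSum_single (ξ ξ' : FinConfig d) :
    transferSum (fun z => if z = 0 then 1 else 0) ξ ξ' =
      if ξ = ξ' then ((arrangements ξ.degree ξ).card : ℝ) else 0 := by
  classical
  have h1 : ∀ x z : Fin ξ.degree → Site d,
      ∏ i, (if z i - x i = 0 then (1 : ℝ) else 0) = if x = z then 1 else 0 := by
    intro x z
    rw [Finset.prod_ite_zero, Finset.prod_const_one]
    congr 1
    simp only [Finset.mem_univ, true_imp_iff, sub_eq_zero, eq_iff_iff]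
    exact ⟨fun h => funext fun i => (h i).symm, fun h i => (congrFun h i).symm⟩
  simp only [transferSum, h1, Finset.sum_ite_eq]
  split_ifs with h
  · rw [← h, Finset.sum_congr rfl fun x hx => if_pos hx, Finset.sum_const, nsmul_eq_mul, mul_one]
  · refine Finset.sum_eq_zero fun x hx => if_neg fun hx' => h ?_
    rw [← mem_arrangements.1 hx, mem_arrangements.1 hx']

/-- The static case, with X = Y and q = δ_0: a matching must be the identity, so distinct
configurations are orthogonal. -/
theorem integral_dual_mul_dual (hρ : 0 < ρ) (ξ ξ' : FinConfig d) :
    ∫ η, dual ρ ξ η * dual ρ ξ' η ∂(nu d ρ) =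
      if ξ = ξ' then (factorials ξ : ℝ) / (ρ : ℝ) ^ ξ.degree else 0 := by
  rw [integral_dual_mul_dual_of_pgf hρ (MeasurePreserving.id _) (MeasurePreserving.id _)
    (X := fun η => η) (Y := fun η => η) (q := fun z => if z = 0 then 1 else 0)
    (fun z => by split_ifs <;> simp), transferSum_single]
  · split_ifs with h
    · subst h
      have h1 := card_arrangements_mul_factorials ξ.degree ξ rfl
      have h2 : ((arrangements ξ.degree ξ).card : ℝ) * factorials ξ = ξ.degree.factorial := by
        exact_mod_cast h1
      have h3 : ((ξ.degree.factorial : ℕ) : ℝ) ≠ 0 := by positivity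
      have h4 : (ρ : ℝ) ≠ 0 := by exact_mod_cast hρ.ne'
      field_simp
      rw [← h2]
      ring
    · rw [mul_zero]
  · intro F u v _ _ _ _ _ _
    simp_rw [← Finset.prod_mul_distrib, ← mul_pow]
    rw [integral_prod_eval ρ F fun x n => ((1 - u x) * (1 - v x)) ^ n]
    simp_rw [integral_poisson_pow]
    rw [← Real.exp_sum, ← Finset.mul_sum, ← Finset.sum_neg_distrib, ← Finset.sum_sub_distrib,
      ← Finset.sum_add_distrib]
    congr 2
    refine Finset.sum_congr rfl fun x hx => ?_
    rw [Finset.sum_eq_single_of_mem x hx fun z _ hz => by simp [sub_eq_zero, hz]]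
    simp
    ring

theorem normSq_eq (hρ : 0 < ρ) (ξ : FinConfig d) :
    normSq ρ ξ = (factorials ξ : ℝ) / (ρ : ℝ) ^ ξ.degree := by
  have := integral_dual_mul_dual hρ ξ ξ
  simpa only [normSq, if_true, sq] using this

theorem normSq_pos (hρ : 0 < ρ) (ξ : FinConfig d) : 0 < normSq ρ ξ := by
  rw [normSq_eq hρ]
  have h1 := factorials_pos ξ
  have h2 : (0 : ℝ) < ρ := hρ
  positivity

theorem correlation_of_degree_ne {q : Site d → ℝ} {ξ ξ' : FinConfig d} (h : ξ.degree ≠ ξ'.degree) :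
    correlation ρ q ξ ξ' = 0 := by
  simp [correlation, transferSum, arrangements_eq_empty h.symm]

theorem enorm_correlation (q : Site d → ℝ) (ξ ξ' : FinConfig d) :
    ‖correlation ρ q ξ ξ'‖ₑ ≤
      ENNReal.ofReal (factorials ξ * factorials ξ' / (ρ : ℝ) ^ ξ'.degree / ξ.degree.factorial) *
        ∑ x ∈ arrangements ξ.degree ξ, ∑ z ∈ arrangements ξ.degree ξ', ∏ i, ‖q (z i - x i)‖ₑ := by
  rw [correlation, enorm_mul, Real.enorm_of_nonneg (by positivity), transferSum]
  gcongr
  refine (enorm_sum_le _ _).trans (Finset.sum_le_sum fun x _ => (enorm_sum_le _ _).trans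
    (Finset.sum_le_sum fun z _ => ?_))
  simp only [enorm_eq_nnnorm, nnnorm_prod, ENNReal.ofNNReal_finsetProd, le_refl]

/-- Summing the correlations over the translates of one of the two configurations. -/
theorem tsum_enorm_correlation_translate_le (hρ : 0 < ρ) {q : Site d → ℝ} {Q : ℝ≥0∞}
    (hq : ∑' z, ‖q z‖ₑ ≤ 1) (hQ : ∀ z, ‖q z‖ₑ ≤ Q) {k : ℕ} (hk : 1 ≤ k) {ξ ξ' : FinConfig d}
    (hkξ : k ≤ ξ.degree) :
    ∑' y, ‖correlation ρ q ξ (translate y ξ')‖ₑ ≤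
      ENNReal.ofReal (normSq ρ ξ') * (k.factorial * Q ^ (k - 1)) := by
  have hfac : ∀ y, factorials (translate y ξ') = factorials ξ' := fun y => by
    rw [factorials, factorials, translate_eq_mapDomain,
      Finsupp.prod_mapDomain_index_inj (Equiv.injective _)]
  set c := ENNReal.ofReal
    (factorials ξ * factorials ξ' / (ρ : ℝ) ^ ξ'.degree / ξ.degree.factorial) with hc
  calc ∑' y, ‖correlation ρ q ξ (translate y ξ')‖ₑ
      ≤ ∑' y, c * ∑ x ∈ arrangements ξ.degree ξ,
          ∑ z ∈ arrangements ξ.degree (translate y ξ'), ∏ i, ‖q (z i - x i)‖ₑ :=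
        ENNReal.tsum_le_tsum fun y => by
          have := enorm_correlation (ρ := ρ) q ξ (translate y ξ')
          rwa [hfac, degree_translate] at this
    _ = c * ∑ x ∈ arrangements ξ.degree ξ, ∑' y,
          ∑ z ∈ arrangements ξ.degree (translate y ξ'), ∏ i, ‖q (z i - x i)‖ₑ := by
        rw [ENNReal.tsum_mul_left, Summable.tsum_finsetSum fun _ _ => ENNReal.summable]
    _ ≤ c * ∑ x ∈ arrangements ξ.degree ξ, (k.factorial * Q ^ (k - 1)) := by
        gcongr with x hx
        -- Particle i starts at x_i; its weight is q recentred there, with the same total and the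
        -- same supremum bound.
        refine tsum_translates_le hk hkξ (fun i z => ‖q (z - x i)‖ₑ) Q (fun i => ?_)
          (fun i z => hQ _) ξ'
        exact ((Equiv.subRight (x i)).tsum_eq fun z => ‖q z‖ₑ).trans_le hq
    _ = ENNReal.ofReal (normSq ρ ξ') * (k.factorial * Q ^ (k - 1)) := by
        rw [Finset.sum_const, nsmul_eq_mul, ← mul_assoc]
        congr 1
        rw [hc, ← ENNReal.ofReal_natCast, ← ENNReal.ofReal_mul (by positivity), normSq_eq hρ]
        congr 1
        -- The number of arrangements of ξ times ξ! is n!, which cancels the denominator and leaves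
        -- ξ'!/ρ^n = a(ξ').
        have h2 : ((arrangements ξ.degree ξ).card : ℝ) * factorials ξ = ξ.degree.factorial := by
          exact_mod_cast card_arrangements_mul_factorials ξ.degree ξ rfl
        have h3 : ((ξ.degree.factorial : ℕ) : ℝ) ≠ 0 := by positivity
        have h4 : (ρ : ℝ) ≠ 0 := by exact_mod_cast hρ.ne'
        field_simp
        rw [← h2]
        ring

theorem measurable_correlation (hp : IsJumpKernel p) (ξ ξ' : FinConfig d) :
    Measurable fun r : ℝ => correlation ρ (fun z => walkProb p r 0 z) ξ ξ' := by
  have := hp.measurable_walkProb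
  unfold correlation transferSum
  fun_prop

/-! ### Orthogonal expansions -/

/-- The duality polynomial `D(ξ, ·)` as an element of `L²(ν_ρ)`. -/
def dualLp (hρ : 0 < ρ) (ξ : FinConfig d) : Lp ℝ 2 (nu d ρ) := (memLp_dual hρ ξ).toLp

theorem inner_toLp {X : Type*} [MeasurableSpace X] {μ : Measure X} {f g : X → ℝ} (hf : MemLp f 2 μ)
    (hg : MemLp g 2 μ) : inner ℝ (hf.toLp f) (hg.toLp g) = ∫ x, f x * g x ∂μ := by
  rw [L2.inner_def]
  refine integral_congr_ae ?_
  filter_upwards [hf.coeFn_toLp, hg.coeFn_toLp] with x h1 h2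
  rw [h1, h2, real_inner_eq_re_inner]
  simp [mul_comm]

theorem inner_dualLp (hρ : 0 < ρ) (ξ ξ' : FinConfig d) :
    inner ℝ (dualLp hρ ξ) (dualLp hρ ξ') = if ξ = ξ' then normSq ρ ξ else 0 := by
  rw [dualLp, dualLp, inner_toLp, integral_dual_mul_dual hρ, normSq_eq hρ]

/-- The normalized duality polynomials are orthonormal and, by totality, form a Hilbert basis;
undoing the normalization gives this expansion. -/
theorem hasSum_dualLp (hρ : 0 < ρ) (F : Lp ℝ 2 (nu d ρ)) :
    HasSum (fun ξ => (inner ℝ (dualLp hρ ξ) F / normSq ρ ξ) • dualLp hρ ξ) F := by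
  let e : FinConfig d → Lp ℝ 2 (nu d ρ) := fun ξ => (√(normSq ρ ξ))⁻¹ • dualLp hρ ξ
  have hpos := fun ξ : FinConfig d => Real.sqrt_pos.2 (normSq_pos hρ ξ)
  have he : Orthonormal ℝ e := by
    rw [orthonormal_iff_ite]
    intro ξ ξ'
    rw [real_inner_smul_left, real_inner_smul_right, inner_dualLp]
    split_ifs with h
    · subst h
      have := hpos ξ
      nth_rw 3 [← Real.mul_self_sqrt (normSq_pos hρ ξ).le]
      field_simp
    · simp
  have hbot : (Submodule.span ℝ (Set.range e))ᗮ = ⊥ := by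
    rw [Submodule.eq_bot_iff]
    intro G hG
    rw [Submodule.mem_orthogonal] at hG
    have h0 : ∀ ξ, ∫ η, G η * dual ρ ξ η ∂(nu d ρ) = 0 := by
      intro ξ
      have h1 := hG (e ξ) (Submodule.subset_span ⟨ξ, rfl⟩)
      rw [real_inner_smul_left, mul_eq_zero] at h1
      have h2 := h1.resolve_left (inv_ne_zero (hpos ξ).ne')
      rw [dualLp, ← Lp.toLp_coeFn G (Lp.memLp G), inner_toLp] at h2
      rw [← h2]
      exact integral_congr_ae (.of_forall fun η => mul_comm _ _)
    exact Lp.ext ((ae_eq_zero_of_integral_mul_dual_eq_zero hρ (Lp.memLp G) h0).trans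
      (Lp.coeFn_zero ℝ 2 (nu d ρ)).symm)
  have h := (HilbertBasis.mkOfOrthogonalEqBot he hbot).hasSum_repr F
  refine h.congr_fun fun ξ => ?_
  rw [HilbertBasis.repr_apply_apply, HilbertBasis.coe_mkOfOrthogonalEqBot]
  simp only [e]
  rw [real_inner_smul_left, smul_smul]
  congr 1
  have := hpos ξ
  nth_rw 1 [← Real.mul_self_sqrt (normSq_pos hρ ξ).le]
  field_simp

/-- The coefficients of `f - f_{k-1}`. -/
def tailCoeff (ρ : ℝ≥0) (k : ℕ) (f : Config d → ℝ) (ξ : FinConfig d) : ℝ :=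
  if k ≤ ξ.degree then coeff ρ f ξ else 0

/-- The function `f - f_{k-1}` as an element of `L²(ν_ρ)`. -/
def tailLp (k : ℕ) (f : Config d → ℝ) (hf : MemLp f 2 (nu d ρ)) : Lp ℝ 2 (nu d ρ) :=
  hf.toLp f - (polySpace d ρ (k - 1)).starProjection (hf.toLp f)

theorem coeFn_tailLp (k : ℕ) (f : Config d → ℝ) (hf : MemLp f 2 (nu d ρ)) :
    tailLp k f hf =ᵐ[nu d ρ] fun η => f η - proj ρ (k - 1) f hf η := by
  filter_upwards [Lp.coeFn_sub (hf.toLp f) ((polySpace d ρ (k - 1)).starProjection (hf.toLp f)),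
    hf.coeFn_toLp] with η h1 h2
  rw [tailLp, h1, Pi.sub_apply, h2, proj]

theorem dualLp_mem_polySpace (hρ : 0 < ρ) {n : ℕ} {ξ : FinConfig d} (h : ξ.degree ≤ n) :
    dualLp hρ ξ ∈ polySpace d ρ n :=
  Submodule.le_topologicalClosure _ (Submodule.subset_span ⟨ξ, h, (memLp_dual hρ ξ).coeFn_toLp⟩)

theorem inner_dualLp_eq_zero_of_mem_polySpace (hρ : 0 < ρ) {n : ℕ} {ξ : FinConfig d}
    (h : n < ξ.degree) {G : Lp ℝ 2 (nu d ρ)} (hG : G ∈ polySpace d ρ n) :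
    inner ℝ (dualLp hρ ξ) G = 0 := by
  have hle : polySpace d ρ n ≤ (ℝ ∙ dualLp hρ ξ)ᗮ := by
    refine Submodule.topologicalClosure_minimal _ (Submodule.span_le.2 ?_)
      (Submodule.isClosed_orthogonal _)
    rintro G ⟨ξ', h', hG⟩
    rw [SetLike.mem_coe, Submodule.mem_orthogonal_singleton_iff_inner_right]
    have : G = dualLp hρ ξ' := Lp.ext (hG.trans (memLp_dual hρ ξ').coeFn_toLp.symm)
    rw [this, inner_dualLp, if_neg]
    rintro rfl
    omega
  exact Submodule.mem_orthogonal_singleton_iff_inner_right.1 (hle hG)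

/-- Below degree k the residual is orthogonal to D(ξ, ·), which lies in H_{k-1}; from degree k on,
D(ξ, ·) is orthogonal to the projection. As k - 1 is a natural subtraction, k ≥ 1 is needed. -/
theorem hasSum_tailLp (hρ : 0 < ρ) {k : ℕ} (hk : 1 ≤ k) (f : Config d → ℝ)
    (hf : MemLp f 2 (nu d ρ)) :
    HasSum (fun ξ => tailCoeff ρ k f ξ • dualLp hρ ξ) (tailLp k f hf) := by
  refine (hasSum_dualLp hρ (tailLp k f hf)).congr_fun fun ξ => ?_
  congr 1
  rw [tailCoeff]
  split_ifs with h
  · rw [tailLp, inner_sub_right, inner_dualLp_eq_zero_of_mem_polySpace hρ (by omega)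
      (Submodule.starProjection_apply_mem _ _), sub_zero, coeff, dualLp, inner_toLp]
    congr 1
    exact integral_congr_ae (.of_forall fun η => mul_comm _ _)
  · rw [tailLp, real_inner_comm, Submodule.starProjection_inner_eq_zero _ _
      (dualLp_mem_polySpace hρ (by omega)), zero_div]

end

section

variable {d : ℕ} {Ω : Type*} [MeasurableSpace Ω] {P : Measure Ω}
  {p : Site d → Site d → ℝ} {ρ : ℝ≥0}

/-! ### Lattice sums of Schwartz functions -/

theorem tsum_nat_inv_sq_le {N : ℕ} (hN : 1 ≤ N) :
    ∑' m : ℕ, ENNReal.ofReal (((1 + (m : ℝ) / N) ^ 2)⁻¹) ≤ 2 * N := by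
  have hN' : (0 : ℝ) < N := by exact_mod_cast hN
  -- Telescoping: since N ≥ 1, the term N²/(N+n)² is at most the difference of 2N²/(N+n) and
  -- 2N²/(N+n+1).
  have h : ∀ n : ℕ, ∑ m ∈ Finset.range n, ((1 + (m : ℝ) / N) ^ 2)⁻¹ ≤
      2 * N - 2 * (N : ℝ) ^ 2 / (N + n) := by
    intro n
    induction n with
    | zero =>
      rw [Finset.sum_range_zero, Nat.cast_zero, add_zero, sq, ← mul_assoc,
        mul_div_cancel_right₀ _ hN'.ne', sub_self]
    | succ n ih =>
      rw [Finset.sum_range_succ]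
      have h1 : ((1 + (n : ℝ) / N) ^ 2)⁻¹ ≤
          2 * (N : ℝ) ^ 2 / (N + n) - 2 * (N : ℝ) ^ 2 / (N + (n + 1 : ℕ)) := by
        have e1 : ((1 + (n : ℝ) / N) ^ 2)⁻¹ = (N : ℝ) ^ 2 / (N + n) ^ 2 := by
          field_simp
        have e2 : 2 * (N : ℝ) ^ 2 / (N + n) - 2 * (N : ℝ) ^ 2 / (N + (n + 1 : ℕ)) =
            2 * (N : ℝ) ^ 2 / ((N + n) * (N + n + 1)) := by
          have : (N : ℝ) + n ≠ 0 := by positivity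
          have : (N : ℝ) + n + 1 ≠ 0 := by positivity
          push_cast
          rw [← add_assoc]
          field_simp
          ring
        have h2 : (1 : ℝ) ≤ N := by exact_mod_cast hN
        have h3 : (0 : ℝ) ≤ n := n.cast_nonneg
        rw [e1, e2, div_le_div_iff₀ (by positivity) (by positivity)]
        have h4 : (N + n : ℝ) * (N + n + 1) ≤ 2 * (N + n) ^ 2 := by nlinarith
        nlinarith [mul_le_mul_of_nonneg_left h4 (sq_nonneg (N : ℝ))]
      linarith
  refine ENNReal.tsum_le_of_sum_range_le fun n => ?_
  rw [← ENNReal.ofReal_sum_of_nonneg fun m _ => by positivity]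
  refine (ENNReal.ofReal_le_ofReal ((h n).trans
    (sub_le_self _ (by positivity)))).trans (le_of_eq ?_)
  rw [ENNReal.ofReal_mul zero_le_two, ENNReal.ofReal_natCast, ENNReal.ofReal_ofNat]

theorem tsum_int_inv_sq_le {N : ℕ} (hN : 1 ≤ N) :
    ∑' m : ℤ, ENNReal.ofReal (((1 + |(m : ℝ) / N|) ^ 2)⁻¹) ≤ 4 * N := by
  have hN' : (0 : ℝ) < N := by exact_mod_cast hN
  rw [(HasSum.of_nat_of_neg_add_one (f := fun m : ℤ =>
    ENNReal.ofReal (((1 + |(m : ℝ) / N|) ^ 2)⁻¹)) ENNReal.summable.hasSum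
    ENNReal.summable.hasSum).tsum_eq, show (4 : ℝ≥0∞) * N = 2 * N + 2 * N by ring]
  refine add_le_add ((ENNReal.tsum_le_tsum fun m => ?_).trans (tsum_nat_inv_sq_le hN))
    ((ENNReal.tsum_le_tsum fun m => ?_).trans (tsum_nat_inv_sq_le hN))
  · rw [Int.cast_natCast, abs_of_nonneg (by positivity)]
  · refine ENNReal.ofReal_le_ofReal ?_
    have : |((-((m : ℤ) + 1) : ℤ) : ℝ) / N| = ((m : ℝ) + 1) / N := by
      push_cast
      rw [neg_div, abs_neg, abs_of_nonneg (by positivity)]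
    rw [this]
    gcongr
    linarith

/-- Decay of order 2d is shared out as a factor (1+|x_i/N|)^{-2} for each coordinate; each
one-dimensional sum is of order N. -/
theorem exists_tsum_enorm_schwartz_le (φ : 𝓢(EuclideanSpace ℝ (Fin d), ℝ)) :
    ∃ A : ℝ≥0, ∀ N : ℕ, 1 ≤ N → ∑' x : Site d, ‖φ (scaled N x)‖ₑ ≤ A * (N : ℝ≥0∞) ^ d := by
  obtain ⟨C, hC⟩ : ∃ C : ℝ, ∀ v, (1 + ‖v‖) ^ (2 * d) * |φ v| ≤ C := by
    refine ⟨2 ^ (2 * d) * ((Finset.Iic (2 * d, 0)).sup fun m => SchwartzMap.seminorm ℝ m.1 m.2) φ,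
      fun v => ?_⟩
    have := SchwartzMap.one_add_le_sup_seminorm_apply (𝕜 := ℝ) (m := (2 * d, 0)) (k := 2 * d)
      (n := 0) le_rfl le_rfl φ v
    rwa [norm_iteratedFDeriv_zero] at this
  refine ⟨C.toNNReal * 4 ^ d, fun N hN => ?_⟩
  have hb : ∀ x : Site d, ‖φ (scaled N x)‖ₑ ≤
      ENNReal.ofReal C * ∏ i, ENNReal.ofReal (((1 + |(x i : ℝ) / N|) ^ 2)⁻¹) := by
    intro x
    have hC0 : 0 ≤ C := le_trans (by positivity) (hC (scaled N x))
    rw [← ENNReal.ofReal_prod_of_nonneg fun i _ => by positivity, ← ENNReal.ofReal_mul hC0,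
      ← ofReal_norm, Real.norm_eq_abs]
    refine ENNReal.ofReal_le_ofReal ?_
    have h1 : ∏ i, (1 + |(x i : ℝ) / N|) ^ 2 ≤ (1 + ‖scaled N x‖) ^ (2 * d) := by
      rw [pow_mul]
      calc ∏ i, (1 + |(x i : ℝ) / N|) ^ 2 ≤ ∏ _i : Fin d, (1 + ‖scaled N x‖) ^ 2 := by
            refine Finset.prod_le_prod (fun i _ => by positivity) fun i _ => ?_
            gcongr
            exact PiLp.norm_apply_le (scaled N x) i
        _ = _ := by simp
    rw [Finset.prod_inv_distrib, ← div_eq_mul_inv, le_div_iff₀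
      (Finset.prod_pos fun i _ => by positivity), mul_comm]
    exact (mul_le_mul_of_nonneg_right h1 (abs_nonneg _)).trans (hC _)
  refine (ENNReal.tsum_le_tsum hb).trans ?_
  rw [ENNReal.tsum_mul_left, ennreal_tsum_prod d fun _ (m : ℤ) =>
    ENNReal.ofReal (((1 + |(m : ℝ) / N|) ^ 2)⁻¹), Finset.prod_const, Finset.card_univ,
    Fintype.card_fin]
  refine (mul_le_mul_right (pow_le_pow_left' (tsum_int_inv_sq_le hN) d) _).trans (le_of_eq ?_)
  push_cast
  rw [mul_pow, mul_assoc]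
  rfl

/-! ### The fluctuation field in `L²` -/

section Pullback

variable {X Y : Type*} [MeasurableSpace X] [MeasurableSpace Y] {μ : Measure X} {ν : Measure Y}

/-- Composition with a measure preserving map on `L²`. -/
def pullback {h : X → Y} (hh : MeasurePreserving h μ ν) : Lp ℝ 2 ν →L[ℝ] Lp ℝ 2 μ :=
  (Lp.compMeasurePreservingₗᵢ ℝ h hh).toContinuousLinearMap

theorem pullback_toLp {h : X → Y} (hh : MeasurePreserving h μ ν) {g : Y → ℝ} (hg : MemLp g 2 ν) :
    pullback hh (hg.toLp g) = (hg.comp_measurePreserving hh).toLp (g ∘ h) :=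
  Lp.toLp_compMeasurePreserving hg hh

theorem coeFn_pullback {h : X → Y} (hh : MeasurePreserving h μ ν) (G : Lp ℝ 2 ν) :
    pullback hh G =ᵐ[μ] G ∘ h :=
  Lp.coeFn_compMeasurePreserving G hh

theorem norm_pullback {h : X → Y} (hh : MeasurePreserving h μ ν) (G : Lp ℝ 2 ν) :
    ‖pullback hh G‖ = ‖G‖ :=
  Lp.norm_compMeasurePreserving G hh

end Pullback

/-- The fluctuation field of `G` as an element of `L²(ν_ρ)`. -/
def fieldLp (N : ℕ) (φ : 𝓢(EuclideanSpace ℝ (Fin d), ℝ)) (G : Lp ℝ 2 (nu d ρ)) :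
    Lp ℝ 2 (nu d ρ) :=
  ∑' x, φ (scaled N x) • pullback (measurePreserving_shift ρ x) G

theorem tsum_enorm_fieldLp {N : ℕ} (hN : 1 ≤ N) (φ : 𝓢(EuclideanSpace ℝ (Fin d), ℝ))
    (G : Lp ℝ 2 (nu d ρ)) :
    ∑' x, ‖φ (scaled N x) • pullback (measurePreserving_shift ρ x) G‖ₑ ≠ ∞ := by
  obtain ⟨A, hA⟩ := exists_tsum_enorm_schwartz_le φ
  have : ∀ x, ‖φ (scaled N x) • pullback (measurePreserving_shift ρ x) G‖ₑ =
      ‖φ (scaled N x)‖ₑ * ‖G‖ₑ := fun x => by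
    rw [enorm_smul, ← ofReal_norm (pullback _ G), norm_pullback, ofReal_norm]
  simp_rw [this]
  rw [ENNReal.tsum_mul_right]
  exact ENNReal.mul_ne_top ((hA N hN).trans_lt (by finiteness)).ne enorm_ne_top

theorem hasSum_fieldLp {N : ℕ} (hN : 1 ≤ N) (φ : 𝓢(EuclideanSpace ℝ (Fin d), ℝ))
    (G : Lp ℝ 2 (nu d ρ)) :
    HasSum (fun x => φ (scaled N x) • pullback (measurePreserving_shift ρ x) G)
      (fieldLp N φ G) :=
  (Summable.of_enorm (tsum_enorm_fieldLp hN φ G)).hasSum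

/-- Shifts preserve the L² norm, so the norms of the terms are summable; this yields almost sure
absolute convergence and identifies the pointwise sum with the L² sum. -/
theorem ae_hasSum_fieldTerm {N : ℕ} (hN : 1 ≤ N) (φ : 𝓢(EuclideanSpace ℝ (Fin d), ℝ))
    {G : Lp ℝ 2 (nu d ρ)} {g : Config d → ℝ} (hg : G =ᵐ[nu d ρ] g) :
    ∀ᵐ η ∂(nu d ρ), HasSum (fieldTerm N φ g η) (fieldLp N φ G η) := by
  have h1 : ∀ᵐ η ∂(nu d ρ), ∀ x,
      (φ (scaled N x) • pullback (measurePreserving_shift ρ x) G : Lp ℝ 2 (nu d ρ)) η =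
        fieldTerm N φ g η x := by
    refine ae_all_iff.2 fun x => ?_
    filter_upwards [Lp.coeFn_smul (φ (scaled N x)) (pullback (measurePreserving_shift ρ x) G),
      coeFn_pullback (measurePreserving_shift ρ x) G,
      (measurePreserving_shift ρ x).quasiMeasurePreserving.ae hg] with η h2 h3 h4
    rw [h2, Pi.smul_apply, h3, Function.comp_apply, h4, smul_eq_mul, fieldTerm]
  filter_upwards [h1, Lp.hasSum_coeFn_tsum (tsum_enorm_fieldLp hN φ G)] with η h2 h3
  simp_rw [h2] at h3
  exact h3

/-! ### Time correlations of the field -/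

/-- The correlations of the field of `∑_ξ c ξ D(ξ, ·)`, where `q` is the transition probability
from the earlier to the later time. -/
def fieldCorrelation (ρ : ℝ≥0) (N : ℕ) (φ : 𝓢(EuclideanSpace ℝ (Fin d), ℝ)) (c : FinConfig d → ℝ)
    (q : Site d → ℝ) : ℝ :=
  ∑' x, φ (scaled N x) * ∑' y, φ (scaled N y) * ∑' ξ, c ξ * ∑' ξ', c ξ' *
    correlation ρ q (translate x ξ) (translate y ξ')

theorem inner_eq_tsum_left {ι E : Type*} [NormedAddCommGroup E] [InnerProductSpace ℝ E] {a : ι → ℝ}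
    {u : ι → E} {U : E} (h : HasSum (fun i => a i • u i) U) (w : E) :
    inner ℝ U w = ∑' i, a i * inner ℝ (u i) w := by
  have := h.mapL (innerSL ℝ w)
  simp only [innerSL_apply_apply, real_inner_smul_right] at this
  rw [real_inner_comm, ← this.tsum_eq]
  exact tsum_congr fun i => by rw [real_inner_comm]

theorem inner_eq_tsum_right {ι E : Type*} [NormedAddCommGroup E] [InnerProductSpace ℝ E]
    {a : ι → ℝ} {u : ι → E} {U : E} (h : HasSum (fun i => a i • u i) U) (w : E) :
    inner ℝ w U = ∑' i, a i * inner ℝ w (u i) := by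
  have := h.mapL (innerSL ℝ w)
  simp only [innerSL_apply_apply, real_inner_smul_right] at this
  exact this.tsum_eq.symm

/-- Continuity of the inner product expands one series at a time. Keeping the sums iterated means
that no joint summability has to be known here. -/
theorem inner_pullback_fieldLp [IsProbabilityMeasure P] (hρ : 0 < ρ) {η₀ : Ω → Config d}
    {S : Site d × ℕ → ℝ≥0 → Ω → Site d} (hS : IsSystem P p ρ η₀ S) {s t : ℝ≥0} (hst : s ≤ t)
    {N : ℕ} (hN : 1 ≤ N) (φ : 𝓢(EuclideanSpace ℝ (Fin d), ℝ)) {c : FinConfig d → ℝ}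
    {G : Lp ℝ 2 (nu d ρ)} (hG : HasSum (fun ξ => c ξ • dualLp hρ ξ) G) :
    inner ℝ (pullback (hS.measurePreserving_config s) (fieldLp N φ G))
      (pullback (hS.measurePreserving_config t) (fieldLp N φ G)) =
      fieldCorrelation ρ N φ c fun z => walkProb p ((t : ℝ) - s) 0 z := by
  have h1 : ∀ r : ℝ≥0, HasSum (fun x => φ (scaled N x) •
      pullback (hS.measurePreserving_config r) (pullback (measurePreserving_shift ρ x) G))
      (pullback (hS.measurePreserving_config r) (fieldLp N φ G)) := fun r => by
    have := (hasSum_fieldLp hN φ G).mapL (pullback (hS.measurePreserving_config r))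
    simpa only [map_smul] using this
  have h2 : ∀ (r : ℝ≥0) (x : Site d), HasSum (fun ξ => c ξ •
      pullback (hS.measurePreserving_config r)
        (pullback (measurePreserving_shift ρ x) (dualLp hρ ξ)))
      (pullback (hS.measurePreserving_config r) (pullback (measurePreserving_shift ρ x) G)) :=
    fun r x => by
      have := (hG.mapL (pullback (measurePreserving_shift ρ x))).mapL
        (pullback (hS.measurePreserving_config r))
      simpa only [map_smul] using this
  rw [inner_eq_tsum_left (h1 s), fieldCorrelation]
  refine tsum_congr fun x => congrArg _ ?_
  rw [inner_eq_tsum_right (h1 t)]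
  refine tsum_congr fun y => congrArg _ ?_
  rw [inner_eq_tsum_left (h2 s x)]
  refine tsum_congr fun ξ => congrArg _ ?_
  rw [inner_eq_tsum_right (h2 t y)]
  refine tsum_congr fun ξ' => congrArg _ ?_
  rw [dualLp, dualLp, pullback_toLp, pullback_toLp, pullback_toLp, pullback_toLp, inner_toLp,
    ← hS.integral_dual_mul_dual hρ hst]
  simp only [Function.comp_apply, dual_shift]

theorem measurable_fieldCorrelation (hp : IsJumpKernel p) (ρ : ℝ≥0) (N : ℕ)
    (φ : 𝓢(EuclideanSpace ℝ (Fin d), ℝ)) (c : FinConfig d → ℝ) :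
    Measurable fun r : ℝ => fieldCorrelation ρ N φ c fun z => walkProb p r 0 z :=
  Measurable.tsum fun _ => (Measurable.tsum fun _ => (Measurable.tsum fun _ =>
    (Measurable.tsum fun _ => (measurable_correlation hp _ _).const_mul _).const_mul _).const_mul
      _).const_mul _

/-- In extended nonnegative reals the sums may be reordered freely. Bounding φ(y/N) by its supremum
frees the sum over y for the translate estimate; the coefficient condition then handles ξ, ξ', and
the sum over x gives N^d. -/
theorem exists_enorm_fieldCorrelation_le (hρ : 0 < ρ) {k : ℕ} (hk : 1 ≤ k) {f : Config d → ℝ}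
    (hfC : CoeffSummable ρ f) (φ : 𝓢(EuclideanSpace ℝ (Fin d), ℝ)) :
    ∃ A : ℝ≥0, ∀ N : ℕ, 1 ≤ N → ∀ (q : Site d → ℝ) (Q : ℝ≥0∞), ∑' z, ‖q z‖ₑ ≤ 1 →
      (∀ z, ‖q z‖ₑ ≤ Q) →
      ‖fieldCorrelation ρ N φ (tailCoeff ρ k f) q‖ₑ ≤ A * (N : ℝ≥0∞) ^ d * Q ^ (k - 1) := by
  obtain ⟨A, hA⟩ := exists_tsum_enorm_schwartz_le φ
  let M : ℝ≥0 := (SchwartzMap.seminorm ℝ 0 0 φ).toNNReal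
  have hM : ∀ v, ‖φ v‖ₑ ≤ M := fun v => by
    rw [← ofReal_norm]
    exact ENNReal.ofReal_le_ofReal (SchwartzMap.norm_le_seminorm ℝ φ v)
  set c := tailCoeff ρ k f with hc
  let S : ℝ≥0∞ := ∑' q : {q : FinConfig d × FinConfig d // q.1.degree = q.2.degree},
    ENNReal.ofReal (|coeff ρ f q.1.1 * coeff ρ f q.1.2| * normSq ρ q.1.2)
  have hS : S ≠ ∞ := by
    rw [show S = _ from (ENNReal.ofReal_tsum_of_nonneg
      (fun q => mul_nonneg (abs_nonneg _) (normSq_pos hρ _).le) hfC).symm]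
    exact ENNReal.ofReal_ne_top
  refine ⟨A * M * S.toNNReal * k.factorial, fun N hN q Q hq hQ => ?_⟩
  let b : FinConfig d → FinConfig d → ℝ≥0∞ := fun ξ ξ' =>
    if ξ.degree = ξ'.degree then
      ENNReal.ofReal (|coeff ρ f ξ * coeff ρ f ξ'| * normSq ρ ξ') else 0
  have hbS : ∑' ξ, ∑' ξ', b ξ ξ' = S := by
    rw [← ENNReal.tsum_prod]
    change _ = ∑' q : {q : FinConfig d × FinConfig d | q.1.degree = q.2.degree},
      ENNReal.ofReal (|coeff ρ f q.1.1 * coeff ρ f q.1.2| * normSq ρ q.1.2)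
    rw [tsum_subtype {q : FinConfig d × FinConfig d | q.1.degree = q.2.degree} fun q =>
      ENNReal.ofReal (|coeff ρ f q.1 * coeff ρ f q.2| * normSq ρ q.2)]
    exact tsum_congr fun q => by simp only [b, Set.indicator_apply, Set.mem_ofPred_eq]
  have hpair : ∀ x ξ ξ', ∑' y, ‖c ξ‖ₑ * (‖c ξ'‖ₑ *
      ‖correlation ρ q (translate x ξ) (translate y ξ')‖ₑ) ≤
      b ξ ξ' * (k.factorial * Q ^ (k - 1)) := by
    intro x ξ ξ'
    rw [ENNReal.tsum_mul_left, ENNReal.tsum_mul_left]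
    by_cases h : ξ.degree = ξ'.degree
    · by_cases h' : k ≤ ξ.degree
      · have := tsum_enorm_correlation_translate_le hρ hq hQ hk (ξ := translate x ξ) (ξ' := ξ')
          (by rwa [degree_translate])
        calc ‖c ξ‖ₑ * (‖c ξ'‖ₑ * ∑' y, ‖correlation ρ q (translate x ξ) (translate y ξ')‖ₑ)
            ≤ ‖c ξ‖ₑ * (‖c ξ'‖ₑ *
                (ENNReal.ofReal (normSq ρ ξ') * (k.factorial * Q ^ (k - 1)))) := by gcongr
          _ = _ := by
            simp only [b, if_pos h]
            rw [hc, tailCoeff, tailCoeff, if_pos h', if_pos (h ▸ h'),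
              ENNReal.ofReal_mul (abs_nonneg _), ← Real.norm_eq_abs, ofReal_norm,
              enorm_mul]
            ring
      · simp [hc, tailCoeff, h']
    · have : ∀ y, correlation ρ q (translate x ξ) (translate y ξ') = 0 := fun y =>
        correlation_of_degree_ne (by rwa [degree_translate, degree_translate])
      simp [this]
  have hmul : ∀ (a : ℝ) (g : Site d → ℝ), ‖a * ∑' y, g y‖ₑ ≤ ‖a‖ₑ * ∑' y, ‖g y‖ₑ := fun a g => by
    rw [enorm_mul]
    gcongr
    exact enorm_tsum_le_tsum_enorm
  have hmul' : ∀ (a : ℝ) (g : FinConfig d → ℝ), ‖a * ∑' y, g y‖ₑ ≤ ∑' y, ‖a‖ₑ * ‖g y‖ₑ :=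
    fun a g => by
      rw [enorm_mul, ENNReal.tsum_mul_left]
      gcongr
      exact enorm_tsum_le_tsum_enorm
  calc ‖fieldCorrelation ρ N φ c q‖ₑ
      ≤ ∑' x, ‖φ (scaled N x)‖ₑ * ∑' y, M * ∑' ξ, ∑' ξ', ‖c ξ‖ₑ * (‖c ξ'‖ₑ *
          ‖correlation ρ q (translate x ξ) (translate y ξ')‖ₑ) := by
        refine enorm_tsum_le_tsum_enorm.trans (ENNReal.tsum_le_tsum fun x => ?_)
        refine (hmul _ _).trans ?_
        gcongr with y
        rw [enorm_mul]
        gcongr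
        · exact hM _
        refine enorm_tsum_le_tsum_enorm.trans (ENNReal.tsum_le_tsum fun ξ => ?_)
        refine (hmul' _ _).trans (ENNReal.tsum_le_tsum fun ξ' => ?_)
        rw [enorm_mul]
    _ = ∑' x, ‖φ (scaled N x)‖ₑ * (M * ∑' ξ, ∑' ξ', ∑' y, ‖c ξ‖ₑ * (‖c ξ'‖ₑ *
          ‖correlation ρ q (translate x ξ) (translate y ξ')‖ₑ)) := by
        refine tsum_congr fun x => ?_
        rw [ENNReal.tsum_mul_left, ENNReal.tsum_comm]
        congr 2
        exact tsum_congr fun ξ => by rw [ENNReal.tsum_comm]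
    _ ≤ ∑' x, ‖φ (scaled N x)‖ₑ * (M * ∑' ξ, ∑' ξ', b ξ ξ' * (k.factorial * Q ^ (k - 1))) := by
        gcongr with x ξ ξ'
        exact hpair x ξ ξ'
    _ = (∑' x, ‖φ (scaled N x)‖ₑ) * (M * (S * (k.factorial * Q ^ (k - 1)))) := by
        simp_rw [ENNReal.tsum_mul_right]
        rw [hbS]
    _ ≤ (A * (N : ℝ≥0∞) ^ d) * (M * (S * (k.factorial * Q ^ (k - 1)))) := by
        gcongr
        exact hA N hN
    _ = _ := by
        push_cast
        rw [ENNReal.coe_toNNReal hS]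
        ring

end

section

variable {d : ℕ} {Ω : Type*} [MeasurableSpace Ω] {P : Measure Ω}
  {p : Site d → Site d → ℝ} {ρ : ℝ≥0}

/-! ### The field of `f - f_{k-1}` -/

section Field

variable [IsProbabilityMeasure P] {η₀ : Ω → Config d} {S : Site d × ℕ → ℝ≥0 → Ω → Site d}

theorem IsSystem.ae_hasSum_fieldTerm (hS : IsSystem P p ρ η₀ S) (k : ℕ) {f : Config d → ℝ}
    (hf : MemLp f 2 (nu d ρ)) (φ : 𝓢(EuclideanSpace ℝ (Fin d), ℝ)) {N : ℕ} (hN : 1 ≤ N) (t : ℝ≥0) :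
    ∀ᵐ ω ∂P, HasSum (fieldTerm N φ (fun η => f η - proj ρ (k - 1) f hf η) (config η₀ S t ω))
      (pullback (hS.measurePreserving_config t) (fieldLp N φ (tailLp k f hf)) ω) := by
  filter_upwards [(hS.measurePreserving_config t).quasiMeasurePreserving.ae
    (IRW.ae_hasSum_fieldTerm hN φ (coeFn_tailLp k f hf)),
    coeFn_pullback (hS.measurePreserving_config t) (fieldLp N φ (tailLp k f hf))] with ω h1 h2
  rw [h2]
  exact h1

theorem IsSystem.projField_ae_eq (hS : IsSystem P p ρ η₀ S) (k : ℕ) {f : Config d → ℝ}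
    (hf : MemLp f 2 (nu d ρ)) (φ : 𝓢(EuclideanSpace ℝ (Fin d), ℝ)) {N : ℕ} (hN : 1 ≤ N) (t : ℝ) :
    projField η₀ S ρ k f hf φ N t =ᵐ[P]
      pullback (hS.measurePreserving_config ((N : ℝ) ^ 2 * t).toNNReal)
        (fieldLp N φ (tailLp k f hf)) := by
  filter_upwards [hS.ae_hasSum_fieldTerm k hf φ hN ((N : ℝ) ^ 2 * t).toNNReal] with ω h
  exact h.tsum_eq

theorem IsSystem.integral_projField_mul (hS : IsSystem P p ρ η₀ S) (hρ : 0 < ρ) {k : ℕ}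
    (hk : 1 ≤ k) {f : Config d → ℝ} (hf : MemLp f 2 (nu d ρ))
    (φ : 𝓢(EuclideanSpace ℝ (Fin d), ℝ)) {N : ℕ} (hN : 1 ≤ N) {t s : ℝ} (ht : 0 ≤ t)
    (hs : 0 ≤ s) :
    ∫ ω, projField η₀ S ρ k f hf φ N t ω * projField η₀ S ρ k f hf φ N s ω ∂P =
      fieldCorrelation ρ N φ (tailCoeff ρ k f) fun z => walkProb p ((N : ℝ) ^ 2 * |t - s|) 0 z := by
  wlog hts : t ≤ s generalizing t s
  · rw [abs_sub_comm, ← this hs ht (le_of_not_ge hts)]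
    simp_rw [mul_comm]
  have h1 := inner_pullback_fieldLp hρ hS (s := ((N : ℝ) ^ 2 * t).toNNReal)
    (t := ((N : ℝ) ^ 2 * s).toNNReal) (Real.toNNReal_le_toNNReal (by gcongr)) hN φ
    (hasSum_tailLp hρ hk f hf)
  rw [Real.coe_toNNReal _ (by positivity), Real.coe_toNNReal _ (by positivity), ← mul_sub] at h1
  rw [abs_sub_comm, abs_of_nonneg (sub_nonneg.2 hts), ← h1, L2.inner_def]
  refine integral_congr_ae ?_
  filter_upwards [hS.projField_ae_eq k hf φ hN t, hS.projField_ae_eq k hf φ hN s] with ω h2 h3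
  rw [h2, h3, real_inner_eq_re_inner]
  simp [mul_comm]

/-- The general bound with Q = 1 and with Q the heat kernel estimate. The first also covers
coinciding times. -/
theorem IsSystem.exists_fieldCorrelation_le (hS : IsSystem P p ρ η₀ S) (hp : IsJumpKernel p)
    (hρ : 0 < ρ) {k : ℕ} (hk : 1 ≤ k) {f : Config d → ℝ} (hfC : CoeffSummable ρ f)
    (φ : 𝓢(EuclideanSpace ℝ (Fin d), ℝ)) :
    ∃ A C : ℝ, 0 ≤ A ∧ 0 < C ∧ ∀ N : ℕ, 1 ≤ N → ∀ r : ℝ, 0 ≤ r →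
      ‖fieldCorrelation ρ N φ (tailCoeff ρ k f) fun z => walkProb p r 0 z‖ ≤ A * (N : ℝ) ^ d ∧
      (0 < r → ‖fieldCorrelation ρ N φ (tailCoeff ρ k f) fun z => walkProb p r 0 z‖ ≤
        A * (N : ℝ) ^ d * (C * (1 / √r) ^ d) ^ (k - 1)) := by
  obtain ⟨A, hA⟩ := exists_enorm_fieldCorrelation_le hρ hk hfC φ
  obtain ⟨C, hC, hwalk⟩ := hp.exists_walkProb_le
  refine ⟨A, C, A.2, hC, fun N hN r hr => ?_⟩
  have hnn : ∀ z, 0 ≤ walkProb p r 0 z := (hS.walk 0).walkProb_nonneg ⟨r, hr⟩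
  have hsum : HasSum (fun z => walkProb p r 0 z) 1 := (hS.walk 0).hasSum_walkProb ⟨r, hr⟩
  have he : ∀ z, ‖walkProb p r 0 z‖ₑ = ENNReal.ofReal (walkProb p r 0 z) := fun z =>
    Real.enorm_of_nonneg (hnn z)
  have h1 : ∑' z, ‖walkProb p r 0 z‖ₑ ≤ 1 := by
    simp_rw [he]
    rw [← ENNReal.ofReal_tsum_of_nonneg hnn hsum.summable, hsum.tsum_eq, ENNReal.ofReal_one]
  have hreal : ∀ Q : ℝ, 0 ≤ Q → (∀ z, walkProb p r 0 z ≤ Q) →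
      ‖fieldCorrelation ρ N φ (tailCoeff ρ k f) fun z => walkProb p r 0 z‖ ≤
        A * (N : ℝ) ^ d * Q ^ (k - 1) := by
    intro Q hQ hz
    have := hA N hN (fun z => walkProb p r 0 z) (ENNReal.ofReal Q) h1 fun z => by
      rw [he]
      exact ENNReal.ofReal_le_ofReal (hz z)
    rw [← ofReal_norm, ← ENNReal.ofReal_natCast, ← ENNReal.ofReal_coe_nnreal,
      ← ENNReal.ofReal_pow (by positivity), ← ENNReal.ofReal_pow (by positivity),
      ← ENNReal.ofReal_mul (by positivity), ← ENNReal.ofReal_mul (by positivity)] at this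
    exact (ENNReal.ofReal_le_ofReal_iff (by positivity)).1 this
  refine ⟨?_, fun hr' => hreal _ (by positivity) (hwalk r hr')⟩
  have := hreal 1 zero_le_one fun z => hsum.tsum_eq ▸ hsum.summable.le_tsum z fun z' _ => hnn z'
  rwa [one_pow, mul_one] at this

end Field

/-! ### The choice of the time scale -/

/-- The balance δ = (N²δ)^{-m/2}, solved by δ = N^{-2m/(2+m)}. -/
theorem one_div_sqrt_pow_eq {N : ℝ} (hN : 0 < N) (m : ℕ) :
    (1 / √(N ^ 2 * N ^ (-(2 * (m : ℝ) / (2 + m))))) ^ m = N ^ (-(2 * (m : ℝ) / (2 + m))) := by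
  rw [← Real.rpow_natCast N 2, ← Real.rpow_add hN, Real.sqrt_eq_rpow, ← Real.rpow_mul hN.le,
    one_div, ← Real.rpow_neg hN.le, ← Real.rpow_natCast, ← Real.rpow_mul hN.le]
  congr 1
  have : (2 : ℝ) + m ≠ 0 := by positivity
  push_cast
  field_simp
  ring

theorem integral_indicator_abs_sub_lt_le {T δ : ℝ} (hT : 0 ≤ T) (hδ : 0 < δ) (t : ℝ) :
    ∫ s in (0 : ℝ)..T, (Set.Ioo (t - δ) (t + δ)).indicator (fun _ => (1 : ℝ)) s ≤ 2 * δ := by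
  rw [intervalIntegral.integral_of_le hT, show (fun _ : ℝ => (1 : ℝ)) = 1 from rfl,
    integral_indicator_one measurableSet_Ioo,
    measureReal_restrict_apply measurableSet_Ioo]
  refine (measureReal_mono Set.inter_subset_left (by simp)).trans (le_of_eq ?_)
  rw [Real.volume_real_Ioo_of_le (by linarith)]
  ring

/-- For fixed t, the times s within δ of t have length at most 2δ and get the bound B; all others
get BD. -/
theorem integral_integral_le {Ψ : ℝ → ℝ → ℝ} {T δ B D : ℝ} (hT : 0 ≤ T) (hδ : 0 < δ) (hB : 0 ≤ B)
    (h1 : ∀ t s, 0 ≤ t → 0 ≤ s → ‖Ψ t s‖ ≤ B) (hD : 0 ≤ D)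
    (h2 : ∀ t s, 0 ≤ t → 0 ≤ s → δ ≤ |t - s| → ‖Ψ t s‖ ≤ B * D) :
    ∫ t in (0 : ℝ)..T, ∫ s in (0 : ℝ)..T, Ψ t s ≤ B * (2 * δ + D * T) * T := by
  refine (le_abs_self _).trans ?_
  have h := intervalIntegral.norm_integral_le_of_norm_le_const (a := 0) (b := T)
    (f := fun t => ∫ s in (0 : ℝ)..T, Ψ t s) (C := B * (2 * δ + D * T)) fun t ht => ?_
  · rwa [sub_zero, abs_of_nonneg hT] at h
  rw [Set.uIoc_of_le hT] at ht
  have hint : IntervalIntegrable ((Set.Ioo (t - δ) (t + δ)).indicator fun _ => (1 : ℝ))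
      volume 0 T := by
    rw [intervalIntegrable_iff]
    exact (intervalIntegrable_iff.1 (intervalIntegrable_const (c := (1 : ℝ)))).indicator
      measurableSet_Ioo
  refine (intervalIntegral.norm_integral_le_of_norm_le (g := fun s =>
    B * ((Set.Ioo (t - δ) (t + δ)).indicator (fun _ => (1 : ℝ)) s + D)) hT
    (.of_forall fun s hs => ?_) ?_).trans ?_
  · by_cases hts : |t - s| < δ
    · rw [Set.indicator_of_mem (by rw [abs_lt] at hts; constructor <;> linarith)]
      refine (h1 t s ht.1.le hs.1.le).trans ?_
      nlinarith
    · refine (h2 t s ht.1.le hs.1.le (not_lt.1 hts)).trans ?_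
      gcongr
      exact le_add_of_nonneg_left (Set.indicator_nonneg (fun _ _ => zero_le_one) _)
  · exact (hint.add intervalIntegrable_const).const_mul B
  · rw [intervalIntegral.integral_const_mul, intervalIntegral.integral_add hint
      intervalIntegrable_const, intervalIntegral.integral_const, sub_zero, smul_eq_mul, mul_comm T]
    gcongr
    exact integral_indicator_abs_sub_lt_le hT hδ t

end

end IRW

end

open IRW
theorem theorem3p6 {d : ℕ} (hd : 1 ≤ d)
    (p : Site d → Site d → ℝ) (hp : IsJumpKernel p)
    (ρ : ℝ≥0) (hρ : 0 < ρ)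
    {Ω : Type*} [MeasurableSpace Ω] (P : Measure Ω) [IsProbabilityMeasure P]
    (η₀ : Ω → Config d) (S : Site d × ℕ → ℝ≥0 → Ω → Site d) (hS : IsSystem P p ρ η₀ S)
    (k : ℕ) (hk : 1 ≤ k)
    (f : Config d → ℝ) (hf : MemLp f 2 (nu d ρ)) (hfC : CoeffSummable ρ f)
    (φ : 𝓢(EuclideanSpace ℝ (Fin d), ℝ)) :
    (∀ N : ℕ, 1 ≤ N → ∀ t : ℝ, 0 ≤ t →
      (∀ᵐ ω ∂P, Summable (fieldTerm N φ (fun η => f η - proj ρ (k - 1) f hf η)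
        (config η₀ S (((N : ℝ) ^ 2 * t).toNNReal) ω))) ∧
      MemLp (projField η₀ S ρ k f hf φ N t) 2 P) ∧
    ∀ T : ℝ, 0 < T →
      (∀ N : ℕ, 1 ≤ N → IntegrableOn
        (fun q : ℝ × ℝ => ∫ ω, projField η₀ S ρ k f hf φ N q.1 ω *
          projField η₀ S ρ k f hf φ N q.2 ω ∂P)
        (Set.Icc 0 T ×ˢ Set.Icc 0 T)) ∧
      ∃ C : ℝ, ∀ᶠ N : ℕ in atTop,
        1 / (N : ℝ) ^ d *
          ∫ t in (0 : ℝ)..T, ∫ s in (0 : ℝ)..T,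
            (∫ ω, projField η₀ S ρ k f hf φ N t ω * projField η₀ S ρ k f hf φ N s ω ∂P)
        ≤ C * (N : ℝ) ^ (-(2 * ((k : ℝ) - 1) * (d : ℝ) / (2 + ((k : ℝ) - 1) * (d : ℝ)))) := by
  refine ⟨fun N hN t _ => ⟨?_, ?_⟩, fun T hT => ?_⟩
  · filter_upwards [hS.ae_hasSum_fieldTerm k hf φ hN ((N : ℝ) ^ 2 * t).toNNReal] with ω h
    exact h.summable
  · exact (Lp.memLp _).ae_eq (hS.projField_ae_eq k hf φ hN t).symm
  obtain ⟨A, C, hA, hC, hAC⟩ := hS.exists_fieldCorrelation_le hp hρ hk hfC φ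
  -- The 2 is the relative length of the near-diagonal strip, the term C^{k-1} T comes from the far
  -- region, and the last T from the outer integral. The bound will hold for every N ≥ 1.
  refine ⟨fun N hN => ?_, A * (2 + C ^ (k - 1) * T) * T, ?_⟩
  · have hmeas : Measurable fun q : ℝ × ℝ => fieldCorrelation ρ N φ (tailCoeff ρ k f)
        fun z => walkProb p ((N : ℝ) ^ 2 * |q.1 - q.2|) 0 z :=
      (measurable_fieldCorrelation hp ρ N φ (tailCoeff ρ k f)).comp (by fun_prop)
    have hint : IntegrableOn (fun q : ℝ × ℝ => fieldCorrelation ρ N φ (tailCoeff ρ k f)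
        fun z => walkProb p ((N : ℝ) ^ 2 * |q.1 - q.2|) 0 z) (Set.Icc 0 T ×ˢ Set.Icc 0 T) :=
      IntegrableOn.of_bound (isCompact_Icc.prod isCompact_Icc).measure_lt_top
        hmeas.aestronglyMeasurable (A * (N : ℝ) ^ d)
        (.of_forall fun q => (hAC N hN _ (by positivity)).1)
    exact hint.congr_fun (fun q hq =>
      (hS.integral_projField_mul hρ hk hf φ hN hq.1.1 hq.2.1).symm)
      (measurableSet_Icc.prod measurableSet_Icc)
  filter_upwards [eventually_ge_atTop 1] with N hN
  have hN' : (0 : ℝ) < N := by exact_mod_cast hN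
  set m := (k - 1) * d with hm
  have hexp : 2 * ((k : ℝ) - 1) * (d : ℝ) / (2 + ((k : ℝ) - 1) * (d : ℝ)) =
      2 * (m : ℝ) / (2 + m) := by
    rw [hm, Nat.cast_mul, Nat.cast_sub hk, Nat.cast_one, mul_assoc]
  rw [hexp]
  set δ : ℝ := (N : ℝ) ^ (-(2 * (m : ℝ) / (2 + m))) with hδ
  have hδ0 : 0 < δ := Real.rpow_pos_of_pos hN' _
  have key := integral_integral_le (Ψ := fun t s =>
    ∫ ω, projField η₀ S ρ k f hf φ N t ω * projField η₀ S ρ k f hf φ N s ω ∂P) (T := T) (δ := δ)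
    (B := A * (N : ℝ) ^ d) (D := C ^ (k - 1) * δ) hT.le hδ0 (by positivity)
    (fun t s ht hs => by
      rw [hS.integral_projField_mul hρ hk hf φ hN ht hs]
      exact (hAC N hN _ (by positivity)).1) (by positivity)
    (fun t s ht hs hts => by
      rw [hS.integral_projField_mul hρ hk hf φ hN ht hs]
      have hpos : 0 < |t - s| := hδ0.trans_le hts
      refine ((hAC N hN _ (by positivity)).2 (by positivity)).trans ?_
      gcongr
      -- Far from the diagonal r ≥ N²δ, so r^{-m/2} ≤ (N²δ)^{-m/2} = δ by the choice of δ.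
      rw [mul_pow, ← pow_mul, mul_comm d, ← hm, hδ, ← one_div_sqrt_pow_eq hN' m]
      gcongr)
  rw [one_div, inv_mul_le_iff₀ (by positivity)]
  refine key.trans (le_of_eq ?_)
  ring
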